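/- Let $n\ge 4$. For nonzero integers $a_0,\dots,a_n$ with $\gcd(a_0,\dots,a_n)=1$, an integer $t$ and a real number $B\ge 1$, let $M_{\underline a,t}(B)$ be the set of $(\underline x,\underline y)\in(\mathbf Z\setminus\{0\})^{2n+2}$ with all $y_i$ squarefree such that $$\sum_{i=0}^n a_ix_i^2y_i^3=t,\qquad \max_{0\le i\le n}|a_ix_i^2y_i^3|\le B .$$ Write $e(x)=\exp(2\pi i x)$ and define $$C_{\underline a,t}=2^{n+1}\sum_{\underline y}\frac{\mathfrak S_{\underline y,\underline a,t}\,\mathfrak I_{\underline\varepsilon}}{\prod_{i=0}^n|a_iy_i^3|^{1/2}},$$ where $\underline y$ runs over all $(n+1)$-tuples of nonzero squarefree integers (of either sign), $\varepsilon_i=\operatorname{sgn}(a_iy_i)$, $$\mathfrak S_{\underline y,\underline a,t}=\sum_{q=1}^\infty\ \sum_{\substack{1\le b\le q\\ \gcd(b,q)=1}} q^{-(n+1)}\sum_{\underline z\in(\mathbf Z/q\mathbf Z)^{n+1}} e\Bigl(\frac{b\,(\sum_i a_iy_i^3z_i^2-t)}{q}\Bigr),\qquad \mathfrak I_{\underline\varepsilon}=\int_{-\infty}^{\infty}\Bigl(\int_{[0,1]^{n+1}}e\bigl(\gamma\textstyle\sum_i\varepsilon_ix_i^2\bigr)\,d\underline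 x\Bigr)d\gamma .$$ Then the double series defining $\mathfrak S_{\underline y,\underline a,t}$ (summed over the fractions $b/q$), the outer integral defining $\mathfrak I_{\underline\varepsilon}$ and the sum over $\underline y$ all converge absolutely, and there are $\delta\in(0,1)$ and $K$, depending only on $n$, such that for all such $\underline a$, all $t\in\mathbf Z$ and all real $B\ge1$ one has $|C_{\underline a,t}|\le K$, the set $M_{\underline a,t}(B)$ is finite, and $$\bigl|\#M_{\underline a,t}(B)-C_{\underline a,t}\,B^{(n-1)/2}\bigr|\le K\Bigl(B^{(n-1)/2-\delta}+|t|\,B^{(n-1)/2-1}\Bigr).$$ In particular, for fixed $t$, $\#M_{\underline a,t}(B)=C_{\underline a,t}B^{(n-1)/2}+O_{n,t}\bigl(B^{(n-1)/2-\delta}\bigr)$ uniformly in $\underline a$, and the error is $O_n\bigl(B^{(n-1)/2-\delta}\bigr)$ uniformly in $\underline a$ and $t$ in the range $|t|\le B^{1-\delta}$. -/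

import Mathlib

open scoped BigOperators

noncomputable section

namespace SquarefulCount

/-- The set `M_{a,t}(B)` of pairs `(x, y)` of `(n+1)`-tuples of nonzero integers, all `y i`
squarefree, with `∑ a i * x i ^ 2 * y i ^ 3 = t` and `|a i * x i ^ 2 * y i ^ 3| ≤ B`. -/
def solutionSet (n : ℕ) (a : Fin (n + 1) → ℤ) (t : ℤ) (B : ℝ) :
    Set ((Fin (n + 1) → ℤ) × (Fin (n + 1) → ℤ)) :=
  {p | (∀ i, p.1 i ≠ 0 ∧ p.2 i ≠ 0) ∧
    ∑ i, a i * p.1 i ^ 2 * p.2 i ^ 3 = t ∧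
    (∀ i, ((|a i * p.1 i ^ 2 * p.2 i ^ 3| : ℤ) : ℝ) ≤ B) ∧
    ∀ i, Squarefree (p.2 i)}

/-- `e(x) = exp(2πix)`. -/
def e (x : ℝ) : ℂ := Complex.exp (2 * Real.pi * Complex.I * x)

/-- The normalized complete exponential sum
`σ_y(b/q) = q^{-(n+1)} ∑_{z mod q} e(b (∑ a i * y i ^ 3 * z i ^ 2 - t) / q)`;
residues mod `q` are represented by `0, …, q - 1`. -/
def sigma (n : ℕ) (a : Fin (n + 1) → ℤ) (t : ℤ) (y : Fin (n + 1) → ℤ) (q b : ℕ) : ℂ :=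
  ((q : ℂ) ^ (n + 1))⁻¹ *
    ∑ z : Fin (n + 1) → Fin q,
      e ((((b : ℤ) * (∑ i, a i * y i ^ 3 * ((z i : ℕ) : ℤ) ^ 2 - t) : ℤ) : ℝ) / (q : ℝ))

/-- The numerators `1 ≤ b ≤ q` with `gcd(b, q) = 1`. -/
def reducedNumerators (q : ℕ) : Finset ℕ :=
  (Finset.Icc 1 q).filter fun b => Nat.Coprime b q

/-- The singular series `∑_{q ≥ 1} ∑_{1 ≤ b ≤ q, (b,q)=1} σ_y(b/q)` (the term `q = 0` is an
empty sum). -/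
def singularSeries (n : ℕ) (a : Fin (n + 1) → ℤ) (t : ℤ) (y : Fin (n + 1) → ℤ) : ℂ :=
  ∑' q : ℕ, ∑ b ∈ reducedNumerators q, sigma n a t y q b

/-- The inner integral `∫_{[0,1]^{n+1}} e(γ ∑ ε i * x i ^ 2) dx` of the singular integral. -/
def oscIntegral (n : ℕ) (ε : Fin (n + 1) → ℤ) (γ : ℝ) : ℂ :=
  ∫ x : Fin (n + 1) → ℝ in Set.Icc 0 1, e (γ * ∑ i, (ε i : ℝ) * x i ^ 2)

/-- The singular integral `∫_ℝ ∫_{[0,1]^{n+1}} e(γ ∑ ε i * x i ^ 2) dx dγ`. -/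
def singularIntegral (n : ℕ) (ε : Fin (n + 1) → ℤ) : ℂ :=
  ∫ γ : ℝ, oscIntegral n ε γ

/-- The sign vector `ε i = sgn(a i * y i)`. -/
def signs (n : ℕ) (a y : Fin (n + 1) → ℤ) : Fin (n + 1) → ℤ :=
  fun i => (a i * y i).sign

/-- The term of `C_{a,t}` at `y`: singular series times singular integral, divided by
`∏ |a i * y i ^ 3| ^ (1/2)`. -/
def leadingTerm (n : ℕ) (a : Fin (n + 1) → ℤ) (t : ℤ) (y : Fin (n + 1) → ℤ) : ℂ :=
  singularSeries n a t y * singularIntegral n (signs n a y) /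
    ((∏ i, Real.sqrt ((|a i * y i ^ 3| : ℤ) : ℝ) : ℝ) : ℂ)

/-- `C_{a,t}`: `2^{n+1}` times the sum of the terms over all tuples `y` of squarefree (in
particular nonzero) integers, of either sign. -/
def leadingConstant (n : ℕ) (a : Fin (n + 1) → ℤ) (t : ℤ) : ℂ :=
  2 ^ (n + 1) * ∑' y : {y : Fin (n + 1) → ℤ // ∀ i, Squarefree (y i)}, leadingTerm n a t y.1

end SquarefulCount

end

/-!
The count is treated by the circle method, once for each `y`, after removing the ranges in which
`a` or `y` is large.

*Upper bounds.* Let `w(x, y) = x² y³`. The exponential sum over all pairs with `|w| ≤ B` has fourth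
moment `O(B ^ (1 + ε))` (`exists_integral_pow_four_le`): on a dyadic block of `y`, Cauchy's
inequality over the values of `y` leads to the equation `w(p) - w(p') + w(r) - w(r') = 0` in which
`p` and `p'` share the same `y`, and there `w(p) - w(p') = y³ (x - x') (x + x')` factors, so that
the divisor bound applies. As `n + 1 ≥ 5`, one of the variables can be estimated trivially, four by
their fourth moments: if the `j`-th pair is restricted to a set `D`, there are
`O(#D · B ^ ((n - 2) / 2 + ε))` solutions (`exists_card_solutions_le`). The set `D` is small,
by a power of `B`, if `|a j| > B ^ η`, and also if it consists of pairs with `|y| > B ^ η`, because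
`∑ |y| ^ (-3 / 2)` converges. There is no loss in `a`, since the fourth moment does not depend on
the coefficient.

*Fixed `y`.* If all `|a i|` and `|y i|` are at most `B ^ η`, the coefficients `a i * y i ^ 3` of the
diagonal quadratic equation in `x` are at most `B ^ (4 η)`. Major arcs of radius `B ^ (1 / 20 - 1)`
around the fractions with denominator at most `B ^ (1 / 20)` produce the singular series and the
singular integral; on the minor arcs Weyl's inequality bounds one factor and the fourth moment four
others. The power saving is `B ^ (-1 / 100)` times the height of the coefficients
(`exists_norm_card_slice_sub_le`), which survives the summation over the `O(B ^ (η (n + 1)))`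
tuples `y` because `η = 1 / (400 (n + 5))`. The errors from truncating the singular series and from
replacing the singular integral for `t / B` by that for `0` keep the weight
`∏ |a i * y i ^ 3| ^ (-1 / 2)` and are summed over `y` together with the singular series.

*The sum over `y`.* The Gauss sum bound gives a term of the singular series of size at most
`∏ (2 gcd(q, a i * y i ^ 3) / q) ^ (1 / 2)`. Divided by `∏ |a i * y i ^ 3| ^ (1 / 2)` this is
a product of functions of the separate `y i`, essentially `(gcd(q, y) / |y|) ^ (3 / 2)`, and its
sum over `y` is `O(q ^ ε)`. For `n ≥ 4` the sum over `q` converges with room to spare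
(`exists_sum_absSeries_le`), even with a small power of `q`, of one `|a j|` and of one `|y j|`
inserted. This gives absolute convergence, uniform boundedness of the leading constant, its decay in
each coefficient (needed when some `|a j| > B ^ η`) and the truncation of the sum to
`|y i| ≤ B ^ η` (`exists_leadingConstant_bounds`).
-/

noncomputable section

namespace SquarefulCount

open MeasureTheory Finset

/-! ### Exponential sums and their moments -/

lemma e_add (x y : ℝ) : e (x + y) = e x * e y := by
  simp only [e, ← Complex.exp_add]; congr 1; push_cast; ring

lemma e_zero : e 0 = 1 := by simp [e]

lemma norm_e (x : ℝ) : ‖e x‖ = 1 := by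
  have : e x = Complex.exp ((2 * Real.pi * x : ℝ) * Complex.I) := by
    simp only [e]; congr 1; push_cast; ring
  rw [this, Complex.norm_exp_ofReal_mul_I]

lemma e_neg (x : ℝ) : e (-x) = (starRingEnd ℂ) (e x) := by
  simp only [e, ← Complex.exp_conj]
  congr 1
  simp [Complex.conj_ofReal, Complex.conj_ofNat]

lemma e_intCast (k : ℤ) : e k = 1 := by
  rw [e, Complex.exp_eq_one_iff]
  exact ⟨k, by push_cast; ring⟩

lemma e_sub (x y : ℝ) : e (x - y) = e x * (starRingEnd ℂ) (e y) := by
  rw [sub_eq_add_neg, e_add, e_neg]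

lemma e_sum {ι : Type*} (s : Finset ι) (f : ι → ℝ) : e (∑ i ∈ s, f i) = ∏ i ∈ s, e (f i) := by
  classical
  induction s using Finset.induction_on with
  | empty => simp [e_zero]
  | insert i s hi ih => rw [sum_insert hi, prod_insert hi, e_add, ih]

@[fun_prop]
lemma continuous_e : Continuous e := by unfold e; fun_prop

lemma hasDerivAt_e_comp {f : ℝ → ℝ} {f' x : ℝ} (hf : HasDerivAt f f' x) :
    HasDerivAt (fun x => e (f x)) (2 * Real.pi * Complex.I * f' * e (f x)) x := by
  have := ((hf.ofReal_comp).const_mul (2 * Real.pi * Complex.I)).cexp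
  simp only [e]
  convert this using 1
  ring

lemma integral_e_int (k : ℤ) : ∫ α in (0 : ℝ)..1, e (α * k) = if k = 0 then 1 else 0 := by
  split_ifs with h
  · simp [h, e_zero]
  · have hk : (2 * Real.pi * Complex.I * k : ℂ) ≠ 0 := by
      simp [h, Real.pi_ne_zero]
    have : ∀ x ∈ Set.uIcc (0 : ℝ) 1,
        HasDerivAt (fun x : ℝ => e (x * k) / (2 * Real.pi * Complex.I * k)) (e (x * k)) x := by
      intro x _
      have h1 := (hasDerivAt_e_comp ((hasDerivAt_id x).mul_const (k : ℝ))).div_const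
        (2 * Real.pi * Complex.I * k)
      refine HasDerivAt.congr_deriv h1 ?_
      simp only [id, one_mul]
      push_cast
      field_simp
    rw [intervalIntegral.integral_eq_sub_of_hasDerivAt this
      ((by fun_prop : Continuous fun x : ℝ => e (x * k)).intervalIntegrable _ _)]
    simp [e_intCast, e_zero]

/-- The exponential sum `∑_{p ∈ D} e(α v(p))` of an integer-valued function `v`. -/
def expSum {β : Type*} (D : Finset β) (v : β → ℤ) (α : ℝ) : ℂ := ∑ p ∈ D, e (α * v p)

@[fun_prop]
lemma continuous_expSum {β : Type*} (D : Finset β) (v : β → ℤ) : Continuous (expSum D v) := by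
  unfold expSum; fun_prop

lemma norm_expSum_le {β : Type*} (D : Finset β) (v : β → ℤ) (α : ℝ) :
    ‖expSum D v α‖ ≤ D.card :=
  (norm_sum_le _ _).trans (by simp [norm_e])

lemma expSum_add_int {β : Type*} (D : Finset β) (v : β → ℤ) (α : ℝ) (k : ℤ) :
    expSum D v (α + k) = expSum D v α := by
  refine sum_congr rfl fun p _ => ?_
  have : (α + k) * (v p : ℝ) = α * v p + ((k * v p : ℤ) : ℝ) := by push_cast; ring
  rw [this, e_add, e_intCast, mul_one]

lemma integral_expSum {β : Type*} (D : Finset β) (v : β → ℤ) :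
    ∫ α in (0 : ℝ)..1, expSum D v α = ((D.filter fun p => v p = 0).card : ℂ) := by
  simp only [expSum]
  rw [intervalIntegral.integral_finsetSum
    (fun p _ => (by fun_prop : Continuous fun x : ℝ => e (x * v p)).intervalIntegrable _ _)]
  rw [sum_congr rfl fun p _ => integral_e_int (v p), ← Finset.sum_filter]
  simp

lemma expSum_mul {β γ : Type*} (A : Finset β) (D : Finset γ) (v : β → ℤ) (w : γ → ℤ) (α : ℝ) :
    expSum A v α * expSum D w α = expSum (A ×ˢ D) (fun p => v p.1 + w p.2) α := by
  simp only [expSum, sum_mul_sum, sum_product]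
  refine sum_congr rfl fun p _ => sum_congr rfl fun r _ => ?_
  rw [← e_add]; congr 1; push_cast; ring

lemma conj_expSum {β : Type*} (D : Finset β) (v : β → ℤ) (α : ℝ) :
    (starRingEnd ℂ) (expSum D v α) = expSum D (fun p => -v p) α := by
  simp only [expSum, map_sum, ← e_neg]
  refine sum_congr rfl fun p _ => ?_
  congr 1; push_cast; ring

lemma normSq_expSum {β : Type*} (A : Finset β) (v : β → ℤ) (α : ℝ) :
    ((‖expSum A v α‖ ^ 2 : ℝ) : ℂ) = expSum (A ×ˢ A) (fun p => v p.1 - v p.2) α := by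
  have := Complex.mul_conj' (expSum A v α)
  push_cast
  rw [← this, conj_expSum, expSum_mul]
  rfl

/-- The number of solutions of `v p - v p' + w r - w r' = 0` with `p, p' ∈ A` and `r, r' ∈ D`
is the integral of `|expSum A v|² |expSum D w|²`. -/
lemma integral_normSq_mul_normSq {β γ : Type*} (A : Finset β) (D : Finset γ) (v : β → ℤ)
    (w : γ → ℤ) :
    ∫ α in (0 : ℝ)..1, ‖expSum A v α‖ ^ 2 * ‖expSum D w α‖ ^ 2 =
      ((((A ×ˢ A) ×ˢ (D ×ˢ D)).filter
        fun s => (v s.1.1 - v s.1.2) + (w s.2.1 - w s.2.2) = 0).card : ℝ) := by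
  have h := integral_expSum ((A ×ˢ A) ×ˢ (D ×ˢ D))
    (fun s => (v s.1.1 - v s.1.2) + (w s.2.1 - w s.2.2))
  rw [← Complex.ofReal_inj, ← intervalIntegral.integral_ofReal]
  rw [Complex.ofReal_natCast, ← h]
  refine intervalIntegral.integral_congr fun α _ => ?_
  rw [Complex.ofReal_mul, normSq_expSum, normSq_expSum, expSum_mul]

/-- The circle method identity: the number of solutions of `∑ v i (p i) = t` as an integral. -/
lemma card_solutions_eq_integral {ι β : Type*} [Fintype ι] [DecidableEq ι] (D : ι → Finset β)
    (v : ι → β → ℤ) (t : ℤ) :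
    (((Fintype.piFinset D).filter fun p => ∑ i, v i (p i) = t).card : ℂ) =
      ∫ α in (0 : ℝ)..1, (∏ i, expSum (D i) (v i) α) * e (-(α * t)) := by
  have h := integral_expSum (Fintype.piFinset D) (fun p => ∑ i, v i (p i) - t)
  simp only [sub_eq_zero] at h
  rw [← h]
  refine intervalIntegral.integral_congr fun α _ => ?_
  simp only [expSum, prod_univ_sum, sum_mul]
  refine sum_congr rfl fun p _ => ?_
  rw [← e_sum, ← e_add]; congr 1; push_cast
  rw [← mul_sum]; ring

lemma integrableOn_of_continuous {f : ℝ → ℝ} (hf : Continuous f) (s : ℝ) {m : Set ℝ}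
    (hm : m ⊆ Set.Ioc s (s + 1)) : IntegrableOn f m :=
  (hf.integrableOn_Icc (a := s) (b := s + 1)).mono_set (hm.trans Set.Ioc_subset_Icc_self)

/-- Five or more factors: one is bounded by `U`, four are estimated in mean by their fourth
moments and the remaining ones trivially. -/
lemma setIntegral_prod_le {n : ℕ} (hn : 4 ≤ n) {F : Fin (n + 1) → ℝ → ℂ}
    (hF : ∀ i, Continuous (F i)) {s U W J : ℝ} {m : Set ℝ} (hm : MeasurableSet m)
    (hms : m ⊆ Set.Ioc s (s + 1)) (hU0 : 0 ≤ U) (hW : ∀ i, ∀ α, ‖F i α‖ ≤ W) (j : Fin (n + 1))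
    (hU : ∀ α ∈ m, ‖F j α‖ ≤ U) (hJ : ∀ i, ∫ α in Set.Ioc s (s + 1), ‖F i α‖ ^ 4 ≤ J) :
    ∫ α in m, ∏ i, ‖F i α‖ ≤ U * (4 * J) * W ^ (n - 4) := by
  have hW0 : 0 ≤ W := (norm_nonneg _).trans (hW j s)
  obtain ⟨T, hT, hTc⟩ := exists_subset_card_eq (s := univ.erase j) (n := 4)
    (by rw [card_erase_of_mem (mem_univ _)]; simpa using hn)
  have key : ∀ α ∈ m, ∏ i, ‖F i α‖ ≤ U * W ^ (n - 4) * ∑ i ∈ T, ‖F i α‖ ^ 4 := by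
    intro α hα
    rw [← mul_prod_erase univ _ (mem_univ j), ← prod_sdiff hT, mul_assoc]
    have hTn : T.Nonempty := card_pos.mp (by omega)
    obtain ⟨k, hk, hkm⟩ := exists_max_image T (fun i => ‖F i α‖) hTn
    have h1 : ∏ i ∈ T, ‖F i α‖ ≤ ∑ i ∈ T, ‖F i α‖ ^ 4 :=
      calc ∏ i ∈ T, ‖F i α‖ ≤ ∏ i ∈ T, ‖F k α‖ :=
            prod_le_prod (fun _ _ => norm_nonneg _) hkm
        _ = ‖F k α‖ ^ 4 := by rw [prod_const, hTc]
        _ ≤ _ := single_le_sum (f := fun i => ‖F i α‖ ^ 4) (fun i _ => by positivity) hk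
    have h2 : ∏ i ∈ (univ.erase j) \ T, ‖F i α‖ ≤ W ^ (n - 4) := by
      calc _ ≤ ∏ i ∈ (univ.erase j) \ T, W :=
            prod_le_prod (fun _ _ => norm_nonneg _) (fun i _ => hW i α)
        _ = _ := by
          rw [prod_const, card_sdiff_of_subset hT, card_erase_of_mem (mem_univ _), hTc]
          simp
    gcongr
    · exact hU α hα
  have hc : ∀ i, Continuous fun α => ‖F i α‖ ^ 4 := fun i => ((hF i).norm).pow 4
  calc ∫ α in m, ∏ i, ‖F i α‖ ≤ ∫ α in m, U * W ^ (n - 4) * ∑ i ∈ T, ‖F i α‖ ^ 4 := by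
        refine setIntegral_mono_on ?_ ?_ hm key
        · exact integrableOn_of_continuous (continuous_finsetProd _ fun i _ => (hF i).norm) s hms
        · exact integrableOn_of_continuous
            (continuous_const.mul (continuous_finsetSum _ fun i _ => hc i)) s hms
    _ = U * W ^ (n - 4) * ∑ i ∈ T, ∫ α in m, ‖F i α‖ ^ 4 := by
        rw [integral_const_mul, integral_finsetSum]
        exact fun i _ => integrableOn_of_continuous (hc i) s hms
    _ ≤ U * W ^ (n - 4) * ∑ i ∈ T, J := by
        gcongr with i hi
        refine le_trans ?_ (hJ i)
        exact setIntegral_mono_set (integrableOn_of_continuous (hc i) s subset_rfl)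
          (Filter.Eventually.of_forall fun x => by positivity)
          (Filter.Eventually.of_forall hms)
    _ = _ := by rw [sum_const, hTc]; simp; ring

lemma setIntegral_Ioc_expSum_pow {β : Type*} (D : Finset β) (v : β → ℤ) (s : ℝ) :
    ∫ α in Set.Ioc s (s + 1), ‖expSum D v α‖ ^ 4 =
      ∫ α in (0 : ℝ)..1, ‖expSum D v α‖ ^ 4 := by
  rw [← intervalIntegral.integral_of_le (by linarith)]
  have hp : Function.Periodic (fun α => ‖expSum D v α‖ ^ 4) 1 := fun α => by
    have := expSum_add_int D v α 1
    simp only [Int.cast_one] at this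
    simp only [this]
  simpa using hp.intervalIntegral_add_eq s 0

/-! ### The divisor bound -/

/-- The divisor function is `O(m ^ ε)`: in `∏ (v_p + 1) / p ^ (ε v_p)` only the boundedly many
primes `p < 2 ^ (1 / ε)` contribute factors exceeding `1`, each of them bounded. -/
lemma exists_card_divisors_le {ε : ℝ} (hε : 0 < ε) :
    ∃ C : ℝ, 1 ≤ C ∧ ∀ m : ℕ, m ≠ 0 → (m.divisors.card : ℝ) ≤ C * (m : ℝ) ^ ε := by
  obtain ⟨R, hR⟩ := exists_nat_ge ((2 : ℝ) ^ (1 / ε))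
  set C0 : ℝ := max 1 (1 / (ε * Real.log 2)) with hC0
  have hlog : 0 < Real.log 2 := Real.log_pos (by norm_num)
  have hC01 : 1 ≤ C0 := le_max_left _ _
  refine ⟨C0 ^ R, one_le_pow₀ hC01, fun m hm => ?_⟩
  have small : ∀ p v : ℕ, 2 ≤ p → ((v + 1 : ℕ) : ℝ) ≤ C0 * (((p : ℝ) ^ v) ^ ε) := by
    intro p v hp
    have h1 : (1 : ℝ) + v * ε * Real.log 2 ≤ ((p : ℝ) ^ v) ^ ε := by
      calc (1 : ℝ) + v * ε * Real.log 2 ≤ Real.exp (v * ε * Real.log 2) := by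
            rw [add_comm]; exact Real.add_one_le_exp _
        _ = ((2 : ℝ) ^ v) ^ ε := by
            rw [← Real.rpow_natCast, ← Real.rpow_mul (by norm_num),
              Real.rpow_def_of_pos (by norm_num)]
            ring_nf
        _ ≤ _ := by
            gcongr
            exact_mod_cast hp
    have h2 : (1 : ℝ) ≤ C0 * (ε * Real.log 2) := by
      have : 1 / (ε * Real.log 2) ≤ C0 := le_max_right _ _
      rwa [div_le_iff₀ (by positivity)] at this
    calc ((v + 1 : ℕ) : ℝ) = 1 + v * 1 := by push_cast; ring
      _ ≤ C0 + v * (C0 * (ε * Real.log 2)) := by gcongr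
      _ = C0 * (1 + v * ε * Real.log 2) := by ring
      _ ≤ _ := by gcongr
  have large : ∀ p v : ℕ, R ≤ p → ((v + 1 : ℕ) : ℝ) ≤ (((p : ℝ) ^ v) ^ ε) := by
    intro p v hp
    have h1 : (2 : ℝ) ≤ (p : ℝ) ^ ε := by
      calc (2 : ℝ) = ((2 : ℝ) ^ (1 / ε)) ^ ε := by
            rw [← Real.rpow_mul (by norm_num)]; field_simp; simp
        _ ≤ (p : ℝ) ^ ε := by
            gcongr
            exact hR.trans (by exact_mod_cast hp)
    calc ((v + 1 : ℕ) : ℝ) ≤ ((2 ^ v : ℕ) : ℝ) := by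
            exact_mod_cast Nat.lt_two_pow_self
      _ = (2 : ℝ) ^ v := by push_cast; rfl
      _ ≤ ((p : ℝ) ^ ε) ^ v := by gcongr
      _ = _ := by
        rw [← Real.rpow_natCast, ← Real.rpow_natCast, ← Real.rpow_mul (by positivity),
          ← Real.rpow_mul (by positivity), mul_comm]
  have hfac : (m : ℝ) ^ ε = ∏ p ∈ m.primeFactors, ((p : ℝ) ^ m.factorization p) ^ ε := by
    rw [Real.finsetProd_rpow _ _ (fun i _ => by positivity)]
    congr 1
    conv_lhs => rw [← Nat.prod_factorization_pow_eq_self hm]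
    rw [Finsupp.prod]
    push_cast
    rfl
  rw [Nat.card_divisors hm, hfac]
  push_cast
  calc ∏ p ∈ m.primeFactors, ((m.factorization p : ℝ) + 1)
      ≤ ∏ p ∈ m.primeFactors, ((if p < R then C0 else 1) *
          ((p : ℝ) ^ m.factorization p) ^ ε) := by
        refine prod_le_prod (fun _ _ => by positivity) fun p hp => ?_
        split_ifs with h
        · exact_mod_cast small p _ (Nat.prime_of_mem_primeFactors hp).two_le
        · rw [one_mul]; exact_mod_cast large p _ (not_lt.mp h)
    _ = (∏ p ∈ m.primeFactors, if p < R then C0 else 1) *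
          ∏ p ∈ m.primeFactors, ((p : ℝ) ^ m.factorization p) ^ ε := prod_mul_distrib
    _ ≤ _ := by
        gcongr
        rw [← prod_filter, prod_const]
        refine pow_le_pow_right₀ hC01 ?_
        calc _ ≤ (range R).card := card_le_card fun p hp => by
              simp only [mem_filter] at hp; exact mem_range.mpr hp.2
          _ = R := card_range R

/-! ### Squareful numbers: counting and additive energy -/

/-- The number `x² y³` attached to a pair `(x, y)`. -/
def sqf (p : ℤ × ℤ) : ℤ := p.1 ^ 2 * p.2 ^ 3

/-- The finite set of pairs `(x, y)` of nonzero integers with `|x² y³| ≤ N`. -/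
def pairs (N : ℝ) : Finset (ℤ × ℤ) :=
  (Icc (-(⌊N⌋₊ : ℤ)) ⌊N⌋₊ ×ˢ Icc (-(⌊N⌋₊ : ℤ)) ⌊N⌋₊).filter fun p =>
    p.1 ≠ 0 ∧ p.2 ≠ 0 ∧ ((|sqf p| : ℤ) : ℝ) ≤ N

lemma abs_le_abs_sqf {p : ℤ × ℤ} (h1 : p.1 ≠ 0) (h2 : p.2 ≠ 0) :
    |p.1| ≤ |sqf p| ∧ |p.2| ≤ |sqf p| := by
  have h1' : 1 ≤ |p.1| := Int.one_le_abs h1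
  have h2' : 1 ≤ |p.2| := Int.one_le_abs h2
  rw [sqf, abs_mul, abs_pow, abs_pow]
  have a1 : |p.1| ≤ |p.1| ^ 2 := le_self_pow₀ h1' (by norm_num)
  have a2 : |p.2| ≤ |p.2| ^ 3 := le_self_pow₀ h2' (by norm_num)
  constructor <;> nlinarith

lemma mem_pairs {N : ℝ} {p : ℤ × ℤ} :
    p ∈ pairs N ↔ p.1 ≠ 0 ∧ p.2 ≠ 0 ∧ ((|sqf p| : ℤ) : ℝ) ≤ N := by
  simp only [pairs, mem_filter, mem_product, mem_Icc, and_iff_right_iff_imp]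
  rintro ⟨h1, h2, h3⟩
  obtain ⟨a1, a2⟩ := abs_le_abs_sqf h1 h2
  have h4 : |sqf p| ≤ (⌊N⌋₊ : ℤ) := by
    have h5 : (sqf p).natAbs ≤ ⌊N⌋₊ := Nat.le_floor (by rwa [Nat.cast_natAbs])
    rw [← Int.natCast_natAbs]
    exact_mod_cast h5
  exact ⟨abs_le.mp (a1.trans h4), abs_le.mp (a2.trans h4)⟩

lemma sqf_ne_zero {N : ℝ} {p : ℤ × ℤ} (hp : p ∈ pairs N) : sqf p ≠ 0 := by
  obtain ⟨h1, h2, -⟩ := mem_pairs.mp hp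
  exact mul_ne_zero (pow_ne_zero _ h1) (pow_ne_zero _ h2)

lemma card_le_two_mul_sqrt {S : Finset ℤ} {Z : ℝ} (h : ∀ x ∈ S, x ≠ 0 ∧ ((x : ℝ)) ^ 2 ≤ Z) :
    (S.card : ℝ) ≤ 2 * √Z := by
  set m := ⌊√Z⌋₊ with hm
  have hsub : S ⊆ (Icc (-(m : ℤ)) m).erase 0 := by
    intro x hx
    obtain ⟨h0, h1⟩ := h x hx
    have h2 : |(x : ℝ)| ≤ √Z := Real.abs_le_sqrt h1
    have h3 : x.natAbs ≤ m := Nat.le_floor (by rw [Nat.cast_natAbs]; exact_mod_cast h2)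
    rw [mem_erase, mem_Icc]
    omega
  have h1 := card_le_card hsub
  rw [card_erase_of_mem (by simp), Int.card_Icc] at h1
  have h2 : S.card ≤ 2 * m := by omega
  calc (S.card : ℝ) ≤ 2 * (m : ℝ) := by exact_mod_cast h2
    _ ≤ _ := by gcongr; exact Nat.floor_le (Real.sqrt_nonneg _)

lemma card_fiber_pairs_le {N : ℝ} {D : Finset (ℤ × ℤ)} (hD : D ⊆ pairs N) (y : ℤ) :
    ((D.filter fun p => p.2 = y).card : ℝ) ≤ 2 * √(N / |(y : ℝ)| ^ 3) := by
  rw [← card_image_of_injOn (f := Prod.fst)]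
  · refine card_le_two_mul_sqrt fun x hx => ?_
    obtain ⟨p, hp, rfl⟩ := mem_image.mp hx
    obtain ⟨hpD, rfl⟩ := mem_filter.mp hp
    obtain ⟨h1, h2, h3⟩ := mem_pairs.mp (hD hpD)
    refine ⟨h1, ?_⟩
    have : 0 < |(p.2 : ℝ)| := by positivity
    rw [le_div_iff₀ (by positivity)]
    refine le_trans (le_of_eq ?_) h3
    rw [sqf]; push_cast
    rw [abs_mul, abs_pow, abs_pow, sq_abs]
  · intro p hp r hr hpr
    simp only [coe_filter, Set.mem_ofPred_eq] at hp hr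
    exact Prod.ext hpr (hp.2.trans hr.2.symm)

/-- Pairs with `|x² y³| ≤ N` and `|y| ≥ Y` number `O(N ^ (1/2) Y ^ (-1/4))`. -/
lemma exists_card_pairs_le : ∃ C : ℝ, 1 ≤ C ∧ ∀ N Y : ℝ, 0 ≤ N → 1 ≤ Y →
    (((pairs N).filter fun p => Y ≤ |(p.2 : ℝ)|).card : ℝ) ≤
      C * √N * Y ^ (-(1 / 4) : ℝ) := by
  have hs : Summable fun y : ℤ => |(y : ℝ)| ^ (-(5 / 4) : ℝ) :=
    Real.summable_abs_int_rpow (by norm_num)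
  have hs0 : 0 ≤ ∑' y : ℤ, |(y : ℝ)| ^ (-(5 / 4) : ℝ) := tsum_nonneg fun y => by positivity
  refine ⟨1 + 2 * ∑' y : ℤ, |(y : ℝ)| ^ (-(5 / 4) : ℝ), by linarith, fun N Y hN hY => ?_⟩
  set D := (pairs N).filter fun p => Y ≤ |(p.2 : ℝ)| with hD
  have hY0 : 0 < Y := by linarith
  have h1 : ∀ y ∈ D.image Prod.snd, ((D.filter fun p => p.2 = y).card : ℝ) ≤
      2 * √N * Y ^ (-(1 / 4) : ℝ) * |(y : ℝ)| ^ (-(5 / 4) : ℝ) := by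
    intro y hy
    obtain ⟨p, hp, rfl⟩ := mem_image.mp hy
    have hYp : Y ≤ |(p.2 : ℝ)| := (mem_filter.mp hp).2
    have hp0 : 0 < |(p.2 : ℝ)| := hY0.trans_le hYp
    refine (card_fiber_pairs_le (filter_subset _ _) p.2).trans ?_
    rw [Real.sqrt_div hN, div_eq_mul_inv, mul_assoc (2 * √N), mul_assoc 2]
    have : (√(|(p.2 : ℝ)| ^ 3))⁻¹ =
        |(p.2 : ℝ)| ^ (-(1 / 4) : ℝ) * |(p.2 : ℝ)| ^ (-(5 / 4) : ℝ) := by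
      rw [Real.sqrt_eq_rpow, ← Real.rpow_natCast, ← Real.rpow_mul hp0.le, ← Real.rpow_neg hp0.le,
        ← Real.rpow_add hp0]
      norm_num
    rw [this]
    have : |(p.2 : ℝ)| ^ (-(1 / 4) : ℝ) ≤ Y ^ (-(1 / 4) : ℝ) :=
      Real.rpow_le_rpow_of_nonpos hY0 hYp (by norm_num)
    gcongr
  rw [card_eq_sum_card_image Prod.snd D]
  push_cast
  calc _ ≤ ∑ y ∈ D.image Prod.snd, 2 * √N * Y ^ (-(1 / 4) : ℝ) * |(y : ℝ)| ^ (-(5 / 4) : ℝ) :=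
        sum_le_sum h1
    _ = 2 * √N * Y ^ (-(1 / 4) : ℝ) * ∑ y ∈ D.image Prod.snd, |(y : ℝ)| ^ (-(5 / 4) : ℝ) := by
        rw [mul_sum]
    _ ≤ 2 * √N * Y ^ (-(1 / 4) : ℝ) * ∑' y : ℤ, |(y : ℝ)| ^ (-(5 / 4) : ℝ) := by
        gcongr
        exact hs.sum_le_tsum _ fun _ _ => by positivity
    _ ≤ _ := by
        have : 0 ≤ √N * Y ^ (-(1 / 4) : ℝ) := by positivity
        nlinarith

/-- The finite set of integer divisors (of either sign) of a nonzero integer. -/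
def intDivisors (h : ℤ) : Finset ℤ :=
  h.natAbs.divisors.image (fun d : ℕ => (d : ℤ)) ∪ h.natAbs.divisors.image fun d : ℕ => -(d : ℤ)

lemma mem_intDivisors {h d : ℤ} (hh : h ≠ 0) (hd : d ∣ h) : d ∈ intDivisors h := by
  simp only [intDivisors, mem_union, mem_image, Nat.mem_divisors]
  have h1 : d.natAbs ∣ h.natAbs := Int.natAbs_dvd_natAbs.mpr hd
  rcases Int.natAbs_eq d with h2 | h2
  · exact Or.inl ⟨_, ⟨h1, by simpa using hh⟩, h2.symm⟩
  · exact Or.inr ⟨_, ⟨h1, by simpa using hh⟩, h2.symm⟩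

lemma card_intDivisors_le (h : ℤ) : (intDivisors h).card ≤ 2 * h.natAbs.divisors.card := by
  refine (card_union_le _ _).trans ?_
  have := card_image_le (s := h.natAbs.divisors) (f := fun d : ℕ => (d : ℤ))
  have := card_image_le (s := h.natAbs.divisors) (f := fun d : ℕ => -(d : ℤ))
  omega

/-- The solutions of `w(p) - w(p') + w(r) - w(r') = 0`, `w(x, y) = x² y³`, for which `p` and `p'`
have the same second coordinate: given `r, r'` with `w(r) ≠ w(r')`, the numbers `y`, `x - x'` and
`x + x'` divide `w(r') - w(r) = y³ (x² - x'²)`. If `w(r) = w(r')`, then `p' = (±x, y)`, and `r'` is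
determined by divisors of `w(r)`. The number `τ` bounds the number of divisors. -/
lemma card_same_snd_le {N : ℝ} {D : Finset (ℤ × ℤ)} (hD : D ⊆ pairs N) {τ : ℕ}
    (hτ : ∀ m : ℕ, m ≠ 0 → (m : ℝ) ≤ 2 * N → m.divisors.card ≤ τ) :
    (((D ×ˢ D) ×ˢ (D ×ˢ D)).filter fun s => s.1.1.2 = s.1.2.2 ∧
      (sqf s.1.1 - sqf s.1.2) + (sqf s.2.1 - sqf s.2.2) = 0).card ≤
      (8 * τ ^ 2 + 8 * τ ^ 3) * D.card ^ 2 := by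
  classical
  set S := ((D ×ˢ D) ×ˢ (D ×ˢ D)).filter fun s => s.1.1.2 = s.1.2.2 ∧
      (sqf s.1.1 - sqf s.1.2) + (sqf s.2.1 - sqf s.2.2) = 0 with hS
  have hSm : ∀ s ∈ S, s.1.1 ∈ D ∧ s.1.2 ∈ D ∧ s.2.1 ∈ D ∧ s.2.2 ∈ D ∧ s.1.1.2 = s.1.2.2 ∧
      (sqf s.1.1 - sqf s.1.2) + (sqf s.2.1 - sqf s.2.2) = 0 := by
    intro s hs
    simp only [hS, mem_filter, mem_product] at hs
    tauto
  have hN : ∀ p ∈ D, ((sqf p).natAbs : ℝ) ≤ N := fun p hp => by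
    rw [Nat.cast_natAbs]; exact (mem_pairs.mp (hD hp)).2.2
  rw [← card_filter_add_card_filter_not (s := S) (fun s => sqf s.2.1 = sqf s.2.2), add_mul]
  refine Nat.add_le_add ?_ ?_
  · have := card_le_mul_card_image_of_maps_to (s := S.filter fun s => sqf s.2.1 = sqf s.2.2)
      (t := D ×ˢ D) (f := fun s => (s.1.1, s.2.1)) (fun s hs => by
        have := hSm s (mem_filter.mp hs).1
        exact mem_product.mpr ⟨this.1, this.2.2.1⟩) (8 * τ ^ 2) ?_
    · rwa [card_product, ← pow_two] at this
    · rintro ⟨p, r⟩ hpr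
      have hr : r ∈ D := (mem_product.mp hpr).2
      have hr0 : sqf r ≠ 0 := sqf_ne_zero (hD hr)
      have hdiv : (intDivisors (sqf r)).card ≤ 2 * τ :=
        (card_intDivisors_le _).trans (Nat.mul_le_mul_left _ (hτ _ (by simpa using hr0) (by
          have := hN r hr
          have : (0 : ℝ) ≤ (sqf r).natAbs := by positivity
          linarith)))
      calc _ ≤ (({p, (-p.1, p.2)} : Finset (ℤ × ℤ)) ×ˢ
            (intDivisors (sqf r) ×ˢ intDivisors (sqf r))).card := by
            refine card_le_card_of_injOn (fun s => (s.1.2, s.2.2)) ?_ ?_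
            · rintro ⟨⟨p1, p2⟩, ⟨r1, r2⟩⟩ hs
              simp only [coe_filter, Set.mem_ofPred_eq, mem_filter, Prod.mk.injEq] at hs
              obtain ⟨⟨hsS, hrr⟩, rfl, rfl⟩ := hs
              obtain ⟨q1, q2, q3, q4, q5, q6⟩ := hSm _ hsS
              simp only at q1 q2 q3 q4 q5 q6
              simp only [mem_coe, mem_product, mem_insert, mem_singleton]
              refine ⟨?_, mem_intDivisors hr0 ?_, mem_intDivisors hr0 ?_⟩
              · have h1 : sqf p1 = sqf p2 := by linarith
                rw [sqf, sqf, ← q5] at h1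
                have h2 : p1.1 ^ 2 = p2.1 ^ 2 :=
                  mul_right_cancel₀ (pow_ne_zero 3 (mem_pairs.mp (hD q1)).2.1) h1
                rcases sq_eq_sq_iff_eq_or_eq_neg.mp h2 with h3 | h3
                · left; exact Prod.ext h3.symm q5.symm
                · right; exact Prod.ext (by simp [h3]) q5.symm
              · rw [hrr, sqf, pow_two, mul_assoc]; exact dvd_mul_right _ _
              · rw [hrr, sqf, pow_succ' r2.2, ← mul_assoc, mul_comm (_ ^ 2), mul_assoc]
                exact dvd_mul_right _ _
            · rintro ⟨⟨p1, p2⟩, ⟨r1, r2⟩⟩ hs ⟨⟨p1', p2'⟩, ⟨r1', r2'⟩⟩ hs' hss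
              simp only [coe_filter, Set.mem_ofPred_eq, mem_filter, Prod.mk.injEq] at hs hs' hss ⊢
              obtain ⟨-, rfl, rfl⟩ := hs
              obtain ⟨-, rfl, rfl⟩ := hs'
              exact ⟨⟨rfl, hss.1⟩, rfl, hss.2⟩
        _ ≤ 2 * ((2 * τ) * (2 * τ)) := by
            rw [card_product, card_product]
            exact Nat.mul_le_mul card_le_two (Nat.mul_le_mul hdiv hdiv)
        _ = _ := by ring
  · have := card_le_mul_card_image_of_maps_to (s := S.filter fun s => ¬ sqf s.2.1 = sqf s.2.2)
      (t := D ×ˢ D) (f := fun s => s.2) (fun s hs => by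
        have := hSm s (mem_filter.mp hs).1
        exact mem_product.mpr ⟨this.2.2.1, this.2.2.2.1⟩) (8 * τ ^ 3) ?_
    · rwa [card_product, ← pow_two] at this
    · rintro ⟨r, r'⟩ hpr
      by_cases hrr : sqf r = sqf r'
      · refine le_trans (le_of_eq ?_) (Nat.zero_le _)
        rw [card_eq_zero, filter_eq_empty_iff]
        intro s hs hsr
        exact (mem_filter.mp hs).2 (by rw [hsr]; exact hrr)
      have hr : r ∈ D := (mem_product.mp hpr).1
      have hr' : r' ∈ D := (mem_product.mp hpr).2
      set h := sqf r' - sqf r with hh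
      have hh0 : h ≠ 0 := sub_ne_zero.mpr (Ne.symm hrr)
      have hdiv : (intDivisors h).card ≤ 2 * τ :=
        (card_intDivisors_le _).trans (Nat.mul_le_mul_left _ (hτ _ (by simpa using hh0) (by
          have h1 := hN r hr
          have h2 := hN r' hr'
          have h3 : h.natAbs ≤ (sqf r').natAbs + (sqf r).natAbs := Int.natAbs_sub_le _ _
          have h4 : (h.natAbs : ℝ) ≤ (sqf r').natAbs + (sqf r).natAbs := by exact_mod_cast h3
          linarith)))
      calc _ ≤ (intDivisors h ×ˢ (intDivisors h ×ˢ intDivisors h)).card := by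
            refine card_le_card_of_injOn
              (fun s => (s.1.1.2, s.1.1.1 - s.1.2.1, s.1.1.1 + s.1.2.1)) ?_ ?_
            · rintro ⟨⟨p1, p2⟩, s2⟩ hs
              simp only [coe_filter, Set.mem_ofPred_eq, mem_filter] at hs
              obtain ⟨⟨hsS, -⟩, rfl⟩ := hs
              obtain ⟨q1, q2, q3, q4, q5, q6⟩ := hSm _ hsS
              simp only at q1 q2 q3 q4 q5 q6
              have hk : h = p1.2 ^ 3 * ((p1.1 - p2.1) * (p1.1 + p2.1)) := by
                have : h = sqf p1 - sqf p2 := by rw [hh]; linarith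
                rw [this, sqf, sqf, ← q5]; ring
              simp only [mem_coe, mem_product]
              refine ⟨mem_intDivisors hh0 ?_, mem_intDivisors hh0 ?_, mem_intDivisors hh0 ?_⟩
              · rw [hk, pow_succ', mul_assoc]; exact dvd_mul_right _ _
              · rw [hk]; exact (dvd_mul_right _ _).mul_left _
              · rw [hk]; exact (dvd_mul_left _ _).mul_left _
            · rintro ⟨⟨p1, p2⟩, s2⟩ hs ⟨⟨p1', p2'⟩, s2'⟩ hs' hss
              simp only [coe_filter, Set.mem_ofPred_eq, mem_filter, Prod.mk.injEq] at hs hs' hss ⊢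
              obtain ⟨⟨hsS, -⟩, rfl⟩ := hs
              obtain ⟨⟨hsS', -⟩, rfl⟩ := hs'
              have q5 := (hSm _ hsS).2.2.2.2.1
              have q5' := (hSm _ hsS').2.2.2.2.1
              simp only at q5 q5'
              obtain ⟨g1, g2, g3⟩ := hss
              exact ⟨⟨Prod.ext (by omega) (by omega), Prod.ext (by omega) (by omega)⟩, rfl⟩
        _ ≤ (2 * τ) * ((2 * τ) * (2 * τ)) := by
            rw [card_product, card_product]
            exact Nat.mul_le_mul hdiv (Nat.mul_le_mul hdiv hdiv)
        _ = _ := by ring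

/-- Cauchy's inequality over the values of `y` reduces the fourth moment to the solutions counted in
`card_same_snd_le`. -/
lemma integral_expSum_pow_four_le {N : ℝ} {D : Finset (ℤ × ℤ)} (hD : D ⊆ pairs N) {τ : ℕ}
    (hτ : ∀ m : ℕ, m ≠ 0 → (m : ℝ) ≤ 2 * N → m.divisors.card ≤ τ) :
    ∫ α in (0 : ℝ)..1, ‖expSum D sqf α‖ ^ 4 ≤
      (D.image Prod.snd).card * ((8 * τ ^ 2 + 8 * τ ^ 3) * D.card ^ 2) := by
  classical
  set Ys := D.image Prod.snd with hYs
  set A : ℤ → Finset (ℤ × ℤ) := fun y => D.filter fun p => p.2 = y with hA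
  have hsum : ∀ α, expSum D sqf α = ∑ y ∈ Ys, expSum (A y) sqf α := fun α =>
    (sum_fiberwise_of_maps_to (fun p hp => mem_image_of_mem _ hp) _).symm
  have hpt : ∀ α, ‖expSum D sqf α‖ ^ 4 ≤
      Ys.card * ∑ y ∈ Ys, ‖expSum (A y) sqf α‖ ^ 2 * ‖expSum D sqf α‖ ^ 2 := by
    intro α
    have h1 : ‖expSum D sqf α‖ ^ 2 ≤ Ys.card * ∑ y ∈ Ys, ‖expSum (A y) sqf α‖ ^ 2 :=
      calc ‖expSum D sqf α‖ ^ 2 ≤ (∑ y ∈ Ys, ‖expSum (A y) sqf α‖) ^ 2 := by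
            gcongr
            rw [hsum]; exact norm_sum_le _ _
        _ ≤ _ := sq_sum_le_card_mul_sum_sq
    calc ‖expSum D sqf α‖ ^ 4 = ‖expSum D sqf α‖ ^ 2 * ‖expSum D sqf α‖ ^ 2 := by ring
      _ ≤ (Ys.card * ∑ y ∈ Ys, ‖expSum (A y) sqf α‖ ^ 2) * ‖expSum D sqf α‖ ^ 2 := by gcongr
      _ = _ := by rw [mul_assoc, sum_mul]
  have hci : ∀ y, IntervalIntegrable
      (fun α => ‖expSum (A y) sqf α‖ ^ 2 * ‖expSum D sqf α‖ ^ 2) volume 0 1 := fun y =>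
    (by fun_prop : Continuous fun α => ‖expSum (A y) sqf α‖ ^ 2 * ‖expSum D sqf α‖ ^ 2
      ).intervalIntegrable _ _
  calc _ ≤ ∫ α in (0 : ℝ)..1,
        Ys.card * ∑ y ∈ Ys, ‖expSum (A y) sqf α‖ ^ 2 * ‖expSum D sqf α‖ ^ 2 :=
        intervalIntegral.integral_mono_on (by norm_num)
          ((by fun_prop : Continuous fun α => ‖expSum D sqf α‖ ^ 4).intervalIntegrable _ _)
          ((by fun_prop : Continuous fun α => Ys.card *
            ∑ y ∈ Ys, ‖expSum (A y) sqf α‖ ^ 2 * ‖expSum D sqf α‖ ^ 2).intervalIntegrable _ _)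
          fun α _ => hpt α
    _ = Ys.card * ∑ y ∈ Ys, ((((A y ×ˢ A y) ×ˢ (D ×ˢ D)).filter
        fun s => (sqf s.1.1 - sqf s.1.2) + (sqf s.2.1 - sqf s.2.2) = 0).card : ℝ) := by
        rw [intervalIntegral.integral_const_mul,
          intervalIntegral.integral_finsetSum fun y _ => hci y]
        congr 1
        exact sum_congr rfl fun y _ => integral_normSq_mul_normSq _ _ _ _
    _ ≤ Ys.card * ((8 * τ ^ 2 + 8 * τ ^ 3) * D.card ^ 2) := by
        gcongr
        have h2 := card_same_snd_le hD hτ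
        rw [card_eq_sum_card_fiberwise (f := fun s => s.1.1.2) (t := Ys)] at h2
        · refine le_trans ?_ (show ((_ : ℕ) : ℝ) ≤ _ by exact_mod_cast h2)
          push_cast
          refine sum_le_sum fun y _ => ?_
          norm_cast
          refine card_le_card fun s hs => ?_
          simp only [hA, mem_filter, mem_product] at hs ⊢
          obtain ⟨⟨⟨⟨h1, h3⟩, h4, h5⟩, h6⟩, h7⟩ := hs
          exact ⟨⟨⟨⟨h1, h4⟩, h6⟩, h3.trans h5.symm, h7⟩, h3⟩
        · intro s hs
          simp only [coe_filter, Set.mem_ofPred_eq, mem_product] at hs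
          exact mem_image_of_mem _ hs.1.1.1

/-- The fourth moment of the exponential sum over all squareful numbers up to `N` is
`O(N ^ (1 + ε))`, as is the fourth moment over any set of such numbers. The range of `y` is cut
into dyadic blocks; the block `|y| ∼ 2 ^ j` has `O((N / 2 ^ j) ^ (1 / 2))` elements. -/
lemma exists_integral_pow_four_le {ε : ℝ} (hε : 0 < ε) :
    ∃ C : ℝ, 1 ≤ C ∧ ∀ N : ℝ, 1 ≤ N → ∀ D ⊆ pairs N, ∀ a : ℤ, a ≠ 0 →
      ∫ α in (0 : ℝ)..1, ‖expSum D (fun p => a * sqf p) α‖ ^ 4 ≤ C * N ^ (1 + ε) := by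
  classical
  obtain ⟨C, hC1, hC⟩ := exists_card_divisors_le (ε := ε / 7) (by positivity)
  refine ⟨8000 * (2 * C * 2 ^ (ε / 7)) ^ 7, ?_, fun N hN D hD a ha => ?_⟩
  · have : (1 : ℝ) ≤ 2 ^ (ε / 7) := Real.one_le_rpow (by norm_num) (by positivity)
    have h1 : (1 : ℝ) ≤ 2 * C * 2 ^ (ε / 7) := by nlinarith
    have := one_le_pow₀ (n := 7) h1
    linarith
  have hN0 : 0 < N := by linarith
  set τ := ⌊C * (2 * N) ^ (ε / 7)⌋₊ with hτdef
  have hτ : ∀ m : ℕ, m ≠ 0 → (m : ℝ) ≤ 2 * N → m.divisors.card ≤ τ := fun m hm hmN =>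
    Nat.le_floor ((hC m hm).trans (by gcongr))
  have hτ1 : 1 ≤ τ := by simpa using hτ 1 (by norm_num) (by push_cast; linarith)
  have hτN : (τ : ℝ) ≤ C * (2 * N) ^ (ε / 7) := Nat.floor_le (by positivity)
  set E := pairs N with hE
  -- reduction to the full set of pairs and to `a = 1`
  have red : ∫ α in (0 : ℝ)..1, ‖expSum D (fun p => a * sqf p) α‖ ^ 4 ≤
      ∫ α in (0 : ℝ)..1, ‖expSum E sqf α‖ ^ 4 := by
    have h4 : ∀ z : ℂ, ‖z‖ ^ 4 = ‖z‖ ^ 2 * ‖z‖ ^ 2 := fun z => by ring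
    simp only [h4]
    rw [integral_normSq_mul_normSq, integral_normSq_mul_normSq]
    norm_cast
    refine card_le_card fun s hs => ?_
    simp only [mem_filter, mem_product] at hs ⊢
    obtain ⟨⟨⟨h1, h2⟩, h3, h4⟩, h5⟩ := hs
    refine ⟨⟨⟨hD h1, hD h2⟩, hD h3, hD h4⟩, ?_⟩
    have : a * ((sqf s.1.1 - sqf s.1.2) + (sqf s.2.1 - sqf s.2.2)) = 0 := by linarith
    exact (mul_eq_zero.mp this).resolve_left ha
  refine red.trans ?_
  set L := Nat.log 2 ⌊N⌋₊ with hL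
  set A : ℕ → Finset (ℤ × ℤ) := fun j => E.filter fun p => Nat.log 2 p.2.natAbs = j with hA
  have hfl : 1 ≤ ⌊N⌋₊ := Nat.le_floor (by simpa using hN)
  have hmaps : ∀ p ∈ E, Nat.log 2 p.2.natAbs ∈ range (L + 1) := by
    intro p hp
    obtain ⟨h1, h2, h3⟩ := mem_pairs.mp hp
    have h4 := (abs_le_abs_sqf h1 h2).2
    have h5 : p.2.natAbs ≤ ⌊N⌋₊ := Nat.le_floor (by
      rw [Nat.cast_natAbs]; exact le_trans (by exact_mod_cast h4) h3)
    exact mem_range.mpr (Nat.lt_succ_of_le (Nat.log_mono_right h5))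
  have hsum : ∀ α, expSum E sqf α = ∑ j ∈ range (L + 1), expSum (A j) sqf α := fun α =>
    (sum_fiberwise_of_maps_to hmaps _).symm
  -- `2 ^ L` has `L + 1` divisors, so `τ` also bounds the number of dyadic blocks
  have hLτ : L + 1 ≤ τ := by
    have h1 := hτ (2 ^ L) (by positivity) (by
      have h2 : 2 ^ L ≤ ⌊N⌋₊ := Nat.pow_log_le_self 2 (by omega)
      have h3 : ((2 ^ L : ℕ) : ℝ) ≤ ⌊N⌋₊ := by exact_mod_cast h2
      have := Nat.floor_le hN0.le
      linarith)
    rwa [Nat.divisors_prime_pow Nat.prime_two, card_map, card_range] at h1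
  have hblock : ∀ j ∈ range (L + 1), ∫ α in (0 : ℝ)..1, ‖expSum (A j) sqf α‖ ^ 4 ≤
      8000 * N * τ ^ 3 := by
    intro j _
    refine (integral_expSum_pow_four_le (filter_subset _ _) hτ).trans ?_
    set Ys := (A j).image Prod.snd with hYs
    have hy : ∀ y ∈ Ys, 2 ^ j ≤ y.natAbs ∧ y.natAbs < 2 ^ (j + 1) := by
      intro y hy
      obtain ⟨p, hp, rfl⟩ := mem_image.mp hy
      obtain ⟨hp1, rfl⟩ := mem_filter.mp hp
      have h0 : p.2.natAbs ≠ 0 := by simpa using (mem_pairs.mp hp1).2.1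
      exact ⟨Nat.pow_log_le_self 2 h0, Nat.lt_pow_succ_log_self (by norm_num) _⟩
    have hYc : (Ys.card : ℝ) ≤ 5 * 2 ^ j := by
      have h1 : Ys ⊆ Icc (-((2 ^ (j + 1) : ℕ) : ℤ)) ((2 ^ (j + 1) : ℕ) : ℤ) := fun y hyy => by
        have := (hy y hyy).2
        rw [mem_Icc]; omega
      have h2 := card_le_card h1
      rw [Int.card_Icc] at h2
      have h3 : 1 ≤ 2 ^ j := Nat.one_le_two_pow
      have h4 : Ys.card ≤ 5 * 2 ^ j := by rw [pow_succ] at h2; omega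
      exact_mod_cast h4
    have hAc : ((A j).card : ℝ) ≤ 5 * 2 ^ j * (2 * √(N / (2 ^ j) ^ 3)) := by
      rw [card_eq_sum_card_image Prod.snd (A j)]
      push_cast
      calc _ ≤ ∑ y ∈ Ys, 2 * √(N / (2 ^ j) ^ 3) := by
            refine sum_le_sum fun y hyy => ?_
            refine (card_fiber_pairs_le (filter_subset _ _) y).trans ?_
            have : ((2 : ℝ) ^ j) ≤ |(y : ℝ)| := by
              have := (hy y hyy).1
              rw [← Int.cast_abs, ← Nat.cast_natAbs]
              exact_mod_cast this
            gcongr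
        _ = Ys.card * (2 * √(N / (2 ^ j) ^ 3)) := by rw [sum_const, nsmul_eq_mul]
        _ ≤ _ := by gcongr
    have hτ1' : (1 : ℝ) ≤ τ := by exact_mod_cast hτ1
    calc (Ys.card : ℝ) * ((8 * τ ^ 2 + 8 * τ ^ 3) * ((A j).card : ℝ) ^ 2)
        ≤ (5 * 2 ^ j) * ((8 * τ ^ 3 + 8 * τ ^ 3) * (5 * 2 ^ j * (2 * √(N / (2 ^ j) ^ 3))) ^ 2) := by
          have : (τ : ℝ) ^ 2 ≤ τ ^ 3 := pow_le_pow_right₀ hτ1' (by norm_num)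
          gcongr
      _ = 8000 * N * τ ^ 3 := by
          rw [mul_pow, mul_pow 2, Real.sq_sqrt (by positivity)]
          field_simp
          ring
  have hpt : ∀ α, ‖expSum E sqf α‖ ^ 4 ≤
      (L + 1 : ℕ) ^ 3 * ∑ j ∈ range (L + 1), ‖expSum (A j) sqf α‖ ^ 4 := by
    intro α
    calc ‖expSum E sqf α‖ ^ 4 ≤ (∑ j ∈ range (L + 1), ‖expSum (A j) sqf α‖) ^ 4 := by
          gcongr
          rw [hsum]; exact norm_sum_le _ _
      _ ≤ _ := by
          have := pow_sum_le_card_mul_sum_pow (s := range (L + 1))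
            (f := fun j => ‖expSum (A j) sqf α‖) (fun _ _ => norm_nonneg _) 3
          simpa using this
  calc _ ≤ ∫ α in (0 : ℝ)..1, (L + 1 : ℕ) ^ 3 * ∑ j ∈ range (L + 1), ‖expSum (A j) sqf α‖ ^ 4 :=
        intervalIntegral.integral_mono_on (by norm_num)
          ((by fun_prop : Continuous fun α => ‖expSum E sqf α‖ ^ 4).intervalIntegrable _ _)
          ((by fun_prop : Continuous fun α => ((L + 1 : ℕ) : ℝ) ^ 3 *
            ∑ j ∈ range (L + 1), ‖expSum (A j) sqf α‖ ^ 4).intervalIntegrable _ _)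
          fun α _ => hpt α
    _ = (L + 1 : ℕ) ^ 3 * ∑ j ∈ range (L + 1), ∫ α in (0 : ℝ)..1, ‖expSum (A j) sqf α‖ ^ 4 := by
        rw [intervalIntegral.integral_const_mul, intervalIntegral.integral_finsetSum fun j _ =>
          (by fun_prop : Continuous fun α => ‖expSum (A j) sqf α‖ ^ 4).intervalIntegrable _ _]
    _ ≤ (L + 1 : ℕ) ^ 3 * ∑ j ∈ range (L + 1), 8000 * N * τ ^ 3 := by
        gcongr with j hj
        exact hblock j hj
    _ = 8000 * N * τ ^ 3 * (L + 1 : ℕ) ^ 4 := by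
        rw [sum_const, card_range, nsmul_eq_mul]; ring
    _ ≤ 8000 * N * τ ^ 3 * τ ^ 4 := by gcongr
    _ = 8000 * N * (τ : ℝ) ^ 7 := by ring
    _ ≤ 8000 * N * (C * (2 * N) ^ (ε / 7)) ^ 7 := by gcongr
    _ ≤ 8000 * N * (2 * C * (2 * N) ^ (ε / 7)) ^ 7 := by
        gcongr
        linarith
    _ = _ := by
        rw [Real.mul_rpow (by norm_num) hN0.le, Real.rpow_add hN0, Real.rpow_one, ← mul_assoc,
          mul_pow (2 * C * 2 ^ (ε / 7)), ← Real.rpow_natCast (N ^ (ε / 7)), ← Real.rpow_mul hN0.le]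
        have : ε / 7 * ((7 : ℕ) : ℝ) = ε := by push_cast; ring
        rw [this]; ring

/-! ### Weyl's inequality for quadratic exponential sums -/

/-- Weyl differencing: expand the square by the difference `h` of the two variables; `h` and `-h`
contribute conjugate terms. -/
lemma norm_sq_sum_range_le (z : ℕ → ℂ) (n : ℕ) :
    ‖∑ x ∈ range n, z x‖ ^ 2 ≤
      2 * ∑ h ∈ range n, ‖∑ x ∈ range (n - h), z (h + x) * (starRingEnd ℂ) (z x)‖ := by
  set T : ℕ → ℂ := fun n => ∑ m ∈ range n, ∑ k ∈ range (m + 1), z m * (starRingEnd ℂ) (z (m - k))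
    with hT
  have h1 : ∀ n, ‖∑ x ∈ range n, z x‖ ^ 2 ≤ 2 * (T n).re := by
    intro n
    induction n with
    | zero => simp [hT]
    | succ n ih =>
      have hTn : T (n + 1) = T n + z n * (starRingEnd ℂ) (∑ x ∈ range n, z x) +
          z n * (starRingEnd ℂ) (z n) := by
        have h2 : ∑ k ∈ range (n + 1), z (n - k) = ∑ x ∈ range n, z x + z n := by
          rw [← sum_range_succ]
          exact sum_range_reflect (fun k => z k) (n + 1)
        rw [add_assoc, ← mul_add, ← map_add, ← h2, map_sum, mul_sum]
        exact sum_range_succ _ n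
      rw [hTn, sum_range_succ, ← Complex.normSq_eq_norm_sq, Complex.normSq_add,
        Complex.normSq_eq_norm_sq, Complex.add_re, Complex.add_re, Complex.mul_conj (z n),
        Complex.ofReal_re]
      have h3 : ((∑ x ∈ range n, z x) * (starRingEnd ℂ) (z n)).re =
          (z n * (starRingEnd ℂ) (∑ x ∈ range n, z x)).re := by
        simp only [Complex.mul_re, Complex.conj_re, Complex.conj_im]; ring
      have := Complex.normSq_nonneg (z n)
      rw [h3]
      linarith
  refine (h1 n).trans ?_
  have h2 : T n = ∑ h ∈ range n, ∑ x ∈ range (n - h), z (h + x) * (starRingEnd ℂ) (z x) := by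
    rw [← sum_range_diag_flip n fun h x => z (h + x) * (starRingEnd ℂ) (z x)]
    refine sum_congr rfl fun m _ => sum_congr rfl fun k hk => ?_
    rw [Nat.add_sub_cancel' (Nat.lt_succ_iff.mp (mem_range.mp hk))]
  rw [h2]
  gcongr
  exact (Complex.re_le_norm _).trans (norm_sum_le _ _)

lemma norm_e_sub_one_ge (θ : ℝ) : 4 * |θ - round θ| ≤ ‖e θ - 1‖ := by
  set u := θ - round θ with hu
  have h1 : e θ = e u := by
    have : θ = u + (round θ : ℝ) := by rw [hu]; ring
    conv_lhs => rw [this]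
    rw [e_add, e_intCast, mul_one]
  have h2 : e u = Complex.exp (Complex.I * ((2 * Real.pi * u : ℝ) : ℂ)) := by
    rw [e]; congr 1; push_cast; ring
  have hu2 : |u| ≤ 1 / 2 := abs_sub_round θ
  rw [h1, h2, Complex.norm_exp_I_mul_ofReal_sub_one, norm_mul, Real.norm_eq_abs, Real.norm_eq_abs]
  have h3 : |Real.sin (2 * Real.pi * u / 2)| = Real.sin (Real.pi * |u|) := by
    have : 2 * Real.pi * u / 2 = Real.pi * u := by ring
    rw [this]
    have hpos : 0 ≤ Real.sin (Real.pi * |u|) :=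
      Real.sin_nonneg_of_nonneg_of_le_pi (by positivity) (by nlinarith [Real.pi_pos])
    rcases abs_cases u with ⟨h, _⟩ | ⟨h, _⟩
    · rw [h] at hpos ⊢; exact abs_of_nonneg hpos
    · rw [h] at hpos ⊢
      rw [mul_neg, Real.sin_neg] at hpos ⊢
      rw [abs_of_nonpos (by linarith)]
  rw [h3]
  have h4 := Real.mul_le_sin (x := Real.pi * |u|) (by positivity) (by nlinarith [Real.pi_pos])
  have h5 : 2 / Real.pi * (Real.pi * |u|) = 2 * |u| := by field_simp
  rw [h5] at h4
  rw [abs_of_pos (by norm_num : (0 : ℝ) < 2)]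
  linarith

/-- A geometric sum whose ratio `e θ` has `θ` at distance at least `δ` from the integers. -/
lemma norm_geom_sum_le {θ δ : ℝ} (hδ : 0 < δ) (h : δ ≤ |θ - round θ|) (n : ℕ) :
    ‖∑ x ∈ range n, e (θ * x)‖ ≤ 1 / δ := by
  have h1 := norm_e_sub_one_ge θ
  have h0 : 0 < ‖e θ - 1‖ := by linarith
  have h2 : ∑ x ∈ range n, e (θ * x) = (e θ ^ n - 1) / (e θ - 1) := by
    rw [← geom_sum_eq (fun h => by simp [h] at h0)]
    refine sum_congr rfl fun x _ => ?_
    rw [e, e, ← Complex.exp_nat_mul]; congr 1; push_cast; ring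
  rw [h2, norm_div, div_le_div_iff₀ h0 hδ]
  have h3 : ‖e θ ^ n - 1‖ ≤ 2 := by
    refine (norm_sub_le _ _).trans ?_
    rw [norm_pow, norm_e]; norm_num
  nlinarith

/-- If `α` is within `1 / q²` of `b / q`, the multiples `α k` with `k` in an interval of length
less than `q / 2` are `1 / (2 q)`-separated modulo one; hence few of them lie close to
an integer. -/
lemma card_near_int_le {α : ℝ} {b : ℤ} {q : ℕ} (hq : 0 < q) (hbq : IsCoprime b (q : ℤ))
    (hα : |α - b / q| ≤ 1 / (q : ℝ) ^ 2) {δ : ℝ} (hδ : 0 < δ) (K : ℕ) :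
    (((range K).filter fun k : ℕ => |α * k - round (α * k)| < δ).card : ℝ) ≤
      (2 * K / q + 1) * (4 * q * δ + 3) := by
  have hq0 : (0 : ℝ) < q := by exact_mod_cast hq
  set m := (q + 1) / 2 with hm
  have hm0 : 0 < m := by omega
  have sep : ∀ d : ℕ, 0 < d → 2 * d < q → ∀ k : ℤ, 1 / (2 * (q : ℝ)) < |α * d - k| := by
    intro d hd hdq k
    have h1 : b * d - k * q ≠ 0 := by
      intro h
      have h2 : (q : ℤ) ∣ b * d := ⟨k, by linarith⟩
      have h3 : (q : ℤ) ∣ d := hbq.symm.dvd_of_dvd_mul_left h2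
      have := Nat.le_of_dvd hd (Int.natCast_dvd_natCast.mp h3)
      omega
    have h4 : (1 : ℝ) ≤ |((b * d - k * q : ℤ) : ℝ)| := by exact_mod_cast Int.one_le_abs h1
    have h5 : α * d - k = ((b * d - k * q : ℤ) : ℝ) / q + (α - b / q) * d := by
      push_cast; field_simp; ring
    have h6 : |(α - b / q) * d| < 1 / (2 * (q : ℝ)) := by
      rw [abs_mul, Nat.abs_cast]
      have : (2 : ℝ) * d < q := by exact_mod_cast hdq
      calc |α - b / q| * d ≤ 1 / (q : ℝ) ^ 2 * d := by gcongr
        _ < 1 / (q : ℝ) ^ 2 * (q / 2) := by gcongr; linarith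
        _ = _ := by field_simp
    have h7 : 1 / (q : ℝ) ≤ |((b * d - k * q : ℤ) : ℝ) / q| := by
      rw [abs_div, Nat.abs_cast]; gcongr
    have h8 := abs_sub_abs_le_abs_sub (((b * d - k * q : ℤ) : ℝ) / q) (-((α - b / q) * d))
    rw [abs_neg, sub_neg_eq_add, ← h5] at h8
    have : 1 / (q : ℝ) = 1 / (2 * q) + 1 / (2 * q) := by field_simp; norm_num
    linarith
  -- record the block of length `m` in which `k` lies and the cell of length `1 / (2 q)` in which
  -- the signed distance of `α k` to the nearest integer lies; by separation `g` is injective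
  set g : ℕ → ℕ × ℤ := fun k => (k / m, ⌊2 * q * (α * k - round (α * k))⌋) with hg
  set M := ⌈2 * q * δ⌉ with hM
  have hM0 : 0 ≤ M := Int.ceil_nonneg (by positivity)
  have hinj : ∀ k k' : ℕ, k < k' → g k ≠ g k' := by
    intro k k' hkk h
    simp only [hg, Prod.mk.injEq] at h
    obtain ⟨h1, h2⟩ := h
    have h3 : k' - k < m := by
      have e1 := Nat.div_add_mod k m
      have e2 := Nat.div_add_mod k' m
      have e3 := Nat.mod_lt k' hm0
      rw [h1] at e1
      omega
    have h4 := sep (k' - k) (by omega) (by omega) (round (α * k') - round (α * k))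
    have h5 := Int.abs_sub_lt_one_of_floor_eq_floor h2
    rw [← mul_sub, abs_mul, abs_of_pos (by positivity : 0 < 2 * (q : ℝ))] at h5
    rw [Nat.cast_sub hkk.le] at h4
    have h6 : |α * ((k' : ℝ) - k) - ((round (α * k') - round (α * k) : ℤ) : ℝ)| =
        |α * k - round (α * k) - (α * k' - round (α * k'))| := by
      rw [← abs_neg]; congr 1; push_cast; ring
    rw [h6, div_lt_iff₀ (by positivity)] at h4
    linarith
  have hcard : ((range K).filter fun k : ℕ => |α * k - round (α * k)| < δ).card ≤
      (range (K / m + 1) ×ˢ Icc (-M) M).card := by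
    refine card_le_card_of_injOn g ?_ ?_
    · intro k hk
      simp only [coe_filter, mem_range, Set.mem_ofPred_eq] at hk
      obtain ⟨h1, h2⟩ := hk
      obtain ⟨h3, h4⟩ := abs_lt.mp h2
      simp only [hg, mem_coe, mem_product, mem_range, mem_Icc]
      refine ⟨Nat.lt_succ_of_le (Nat.div_le_div_right h1.le), ?_, ?_⟩
      · rw [Int.le_floor]; push_cast
        have := Int.le_ceil (2 * q * δ)
        nlinarith
      · have h5 : (⌊2 * q * (α * k - round (α * k))⌋ : ℝ) ≤ (M : ℝ) := by
          have := Int.le_ceil (2 * q * δ)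
          have := Int.floor_le (2 * q * (α * k - round (α * k)))
          nlinarith
        exact_mod_cast h5
    · intro k _ k' _ h
      rcases lt_trichotomy k k' with h1 | h1 | h1
      · exact (hinj k k' h1 h).elim
      · exact h1
      · exact (hinj k' k h1 h.symm).elim
  rw [card_product, card_range, Int.card_Icc] at hcard
  have h1 : ((K / m : ℕ) : ℝ) ≤ 2 * K / q := by
    refine Nat.cast_div_le.trans ?_
    have : (q : ℝ) ≤ 2 * m := by exact_mod_cast (by omega : q ≤ 2 * m)
    rw [div_le_div_iff₀ (by exact_mod_cast hm0) hq0]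
    nlinarith [(Nat.cast_nonneg K : (0 : ℝ) ≤ K)]
  have h2 : (((M + 1 - -M).toNat : ℕ) : ℝ) ≤ 4 * q * δ + 3 := by
    have : (((M + 1 - -M).toNat : ℤ) : ℝ) = 2 * M + 1 := by
      rw [Int.toNat_of_nonneg (by omega)]; push_cast; ring
    rw [Int.cast_natCast] at this
    rw [this]
    have := Int.ceil_lt_add_one (2 * q * δ)
    linarith
  calc _ ≤ (((K / m + 1) * (M + 1 - -M).toNat : ℕ) : ℝ) := by exact_mod_cast hcard
    _ ≤ _ := by
      push_cast at h2 ⊢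
      gcongr

/-- The quadratic exponential sum `∑_{1 ≤ x ≤ X} e(α c x²)`. -/
def quadSum (c : ℤ) (X : ℕ) (α : ℝ) : ℂ := ∑ x ∈ range X, e (α * (c * ((x : ℝ) + 1) ^ 2))

/-- Weyl's inequality. After differencing, the inner sum is at most `1 / δ` unless `2 c h α` is
within `δ` of an integer; the exceptional `h` are counted by `card_near_int_le`. The parameter `δ`
is left free. -/
lemma norm_sq_quadSum_le {α : ℝ} {b : ℤ} {q : ℕ} (hq : 0 < q) (hbq : IsCoprime b (q : ℤ))
    (hα : |α - b / q| ≤ 1 / (q : ℝ) ^ 2) {c : ℤ} (hc : c ≠ 0) (X : ℕ) {δ : ℝ} (hδ : 0 < δ) :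
    ‖quadSum c X α‖ ^ 2 ≤
      2 * X * ((4 * |(c : ℝ)| * X / q + 1) * (4 * q * δ + 3) + 1 / δ) := by
  classical
  set near : ℕ → Prop := fun k => |α * k - round (α * k)| < δ with hnear
  set κ := 2 * c.natAbs with hκ
  have hκ0 : 0 < κ := by have := Int.natAbs_pos.mpr hc; omega
  -- the inner sum in the differenced expression is geometric with ratio `e (2 α c h)`
  have hinner : ∀ h ∈ range X, ‖∑ x ∈ range (X - h),
      e (α * (c * (((h + x : ℕ) : ℝ) + 1) ^ 2)) *
        (starRingEnd ℂ) (e (α * (c * ((x : ℝ) + 1) ^ 2)))‖ ≤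
      (if near (κ * h) then (X : ℝ) else 0) + 1 / δ := by
    intro h _
    split_ifs with hn
    · refine (norm_sum_le _ _).trans ?_
      simp only [norm_mul, norm_e, RCLike.norm_conj, mul_one, sum_const, card_range, nsmul_eq_mul]
      have : ((X - h : ℕ) : ℝ) ≤ X := by exact_mod_cast Nat.sub_le _ _
      have : 0 < 1 / δ := by positivity
      linarith
    · rw [zero_add]
      have h1 : ∀ x ∈ range (X - h), e (α * (c * (((h + x : ℕ) : ℝ) + 1) ^ 2)) *
          (starRingEnd ℂ) (e (α * (c * ((x : ℝ) + 1) ^ 2))) =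
          e (α * c * (h ^ 2 + 2 * h)) * e (2 * α * c * h * x) := by
        intro x _
        rw [← e_sub, ← e_add]; congr 1; push_cast; ring
      rw [sum_congr rfl h1, ← mul_sum, norm_mul, norm_e, one_mul]
      refine norm_geom_sum_le hδ ?_ _
      simp only [hnear, not_lt] at hn
      rcases Int.natAbs_eq c with hcc | hcc
      · have : 2 * α * c * h = α * ((κ * h : ℕ) : ℝ) := by
          rw [hκ]; conv_lhs => rw [hcc]
          push_cast [Nat.cast_natAbs]; ring
        rw [this]; exact hn
      · have : 2 * α * c * h = -(α * ((κ * h : ℕ) : ℝ)) := by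
          rw [hκ]; conv_lhs => rw [hcc]
          push_cast [Nat.cast_natAbs]; ring
        rw [this]
        refine hn.trans ((round_le _ (-round (-(α * ((κ * h : ℕ) : ℝ))))).trans (le_of_eq ?_))
        rw [← abs_neg]; congr 1; push_cast; ring
  have hcount : (((range X).filter fun h => near (κ * h)).card : ℝ) ≤
      (4 * |(c : ℝ)| * X / q + 1) * (4 * q * δ + 3) := by
    have h1 : ((range X).filter fun h => near (κ * h)).card ≤
        ((range (κ * X)).filter near).card := by
      refine card_le_card_of_injOn (fun h => κ * h) ?_ ?_
      · intro h hh
        simp only [coe_filter, mem_range, Set.mem_ofPred_eq] at hh ⊢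
        exact ⟨Nat.mul_lt_mul_of_pos_left hh.1 hκ0, hh.2⟩
      · intro h _ h' _ hh
        exact Nat.eq_of_mul_eq_mul_left hκ0 hh
    calc _ ≤ (((range (κ * X)).filter near).card : ℝ) := by exact_mod_cast h1
      _ ≤ (2 * (κ * X : ℕ) / q + 1) * (4 * q * δ + 3) := card_near_int_le hq hbq hα hδ _
      _ = _ := by
        rw [hκ]; push_cast [Nat.cast_natAbs]; ring
  calc ‖quadSum c X α‖ ^ 2 ≤ 2 * ∑ h ∈ range X, ((if near (κ * h) then (X : ℝ) else 0) + 1 / δ) :=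
        (norm_sq_sum_range_le _ X).trans (by gcongr with h hh; exact hinner h hh)
    _ = 2 * X * (((range X).filter fun h => near (κ * h)).card + 1 / δ) := by
        rw [sum_add_distrib, ← sum_filter, sum_const, sum_const, card_range]
        simp only [nsmul_eq_mul]; ring
    _ ≤ _ := by gcongr

/-! ### Quadratic Gauss sums -/

/-- The quadratic Gauss sum `∑_{z mod q} e(m z² / q)`. -/
def gaussQuad (q : ℕ) (m : ℤ) : ℂ := ∑ z : Fin q, e (((m * ((z : ℕ) : ℤ) ^ 2 : ℤ) : ℝ) / q)

lemma gaussQuad_eq_sum_zmod (q : ℕ) [NeZero q] (m : ℤ) :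
    gaussQuad q m = ∑ z : ZMod q, ZMod.stdAddChar ((m : ZMod q) * z ^ 2) := by
  refine Fintype.sum_bijective (fun z : Fin q => ((z : ℕ) : ZMod q)) ?_ _ _ fun z => ?_
  · rw [Fintype.bijective_iff_injective_and_card]
    refine ⟨fun z w h => ?_, by simp [ZMod.card]⟩
    simp only [ZMod.natCast_eq_natCast_iff', Nat.mod_eq_of_lt z.2, Nat.mod_eq_of_lt w.2] at h
    exact Fin.ext h
  · have := ZMod.stdAddChar_coe (N := q) (m * ((z : ℕ) : ℤ) ^ 2)
    push_cast at this ⊢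
    rw [this, e]; congr 1; push_cast; ring

lemma norm_stdAddChar (q : ℕ) [NeZero q] (z : ZMod q) :
    ‖(ZMod.stdAddChar z : ℂ)‖ = 1 := by
  rw [ZMod.stdAddChar_apply]; exact Circle.norm_coe _

lemma card_mul_eq_zero_le (q : ℕ) [NeZero q] (c : ℤ) :
    ((univ : Finset (ZMod q)).filter fun h => (c : ZMod q) * h = 0).card ≤
      Nat.gcd q c.natAbs := by
  have hpos : 0 < Nat.gcd q c.natAbs := Nat.gcd_pos_of_pos_left _ (Nat.pos_of_neZero q)
  refine le_trans (card_le_card fun h hh => ?_) (IsAddCyclic.card_nsmul_eq_zero_le hpos)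
  simp only [mem_filter, mem_univ, true_and] at hh ⊢
  have h1 : ((Int.gcd (q : ℤ) c : ℤ) : ZMod q) = (c : ZMod q) * (Int.gcdB q c : ℤ) := by
    rw [Int.gcd_eq_gcd_ab]; push_cast; simp
  have h2 : Int.gcd (q : ℤ) c = Nat.gcd q c.natAbs := by simp [Int.gcd]
  rw [h2] at h1
  rw [nsmul_eq_mul]
  push_cast at h1
  rw [h1, mul_right_comm, hh, zero_mul]

/-- The Gauss sum bound, by squaring out: the inner sum over one variable is complete and linear. -/
lemma norm_sq_gaussQuad_le {q b : ℕ} (hq : 0 < q) (hbq : Nat.Coprime b q) (c : ℤ) :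
    ‖gaussQuad q (b * c)‖ ^ 2 ≤ 2 * q * Nat.gcd q c.natAbs := by
  have : NeZero q := ⟨hq.ne'⟩
  set ψ : AddChar (ZMod q) ℂ := ZMod.stdAddChar with hψ
  set m : ZMod q := (((b : ℤ) * c : ℤ) : ZMod q) with hm
  have hbu : IsUnit (b : ZMod q) := (ZMod.isUnit_iff_coprime b q).mpr hbq
  have h1 : ((‖gaussQuad q (b * c)‖ ^ 2 : ℝ) : ℂ) =
      ∑ h : ZMod q, ψ (m * h ^ 2) * ∑ w : ZMod q, ψ (w * (2 * m * h)) := by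
    push_cast
    rw [← Complex.mul_conj', gaussQuad_eq_sum_zmod, map_sum, sum_mul_sum, sum_comm]
    have : ∀ w : ZMod q, ∑ z : ZMod q, ψ (m * z ^ 2) * (starRingEnd ℂ) (ψ (m * w ^ 2)) =
        ∑ h : ZMod q, ψ (m * h ^ 2) * ψ (w * (2 * m * h)) := by
      intro w
      rw [← Equiv.sum_comp (Equiv.addRight w)]
      refine sum_congr rfl fun h _ => ?_
      rw [← AddChar.map_neg_eq_conj, ← AddChar.map_add_eq_mul, ← AddChar.map_add_eq_mul]
      congr 1
      simp only [Equiv.coe_addRight]; ring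
    rw [sum_congr rfl fun w _ => this w, sum_comm]
    simp only [mul_sum]
  have h2 : ∀ h : ZMod q, ‖ψ (m * h ^ 2) * ∑ w : ZMod q, ψ (w * (2 * m * h))‖ =
      if ((2 * c : ℤ) : ZMod q) * h = 0 then (q : ℝ) else 0 := by
    intro h
    rw [AddChar.sum_mulShift _ (ZMod.isPrimitive_stdAddChar q), norm_mul, norm_stdAddChar, one_mul,
      ZMod.card]
    have : 2 * m * h = 0 ↔ ((2 * c : ℤ) : ZMod q) * h = 0 := by
      have h3 : 2 * m * h = (b : ZMod q) * (((2 * c : ℤ) : ZMod q) * h) := by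
        rw [hm]; push_cast; ring
      rw [h3, hbu.mul_right_eq_zero]
    simp only [this]
    split_ifs <;> simp
  have h4 : Nat.gcd q (2 * c).natAbs ≤ 2 * Nat.gcd q c.natAbs := by
    rw [Int.natAbs_mul]
    have h5 : Nat.gcd q c.natAbs ≠ 0 := (Nat.gcd_pos_of_pos_left _ hq).ne'
    refine (Nat.le_of_dvd ?_ (Nat.gcd_mul_right_dvd_mul_gcd q _ c.natAbs)).trans ?_
    · have := Nat.gcd_pos_of_pos_left (Int.natAbs 2) hq
      positivity
    · exact Nat.mul_le_mul_right _ (Nat.gcd_le_right _ (by norm_num))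
  calc ‖gaussQuad q (b * c)‖ ^ 2
      = ‖((‖gaussQuad q (b * c)‖ ^ 2 : ℝ) : ℂ)‖ := by
        rw [Complex.norm_real, Real.norm_of_nonneg (by positivity)]
    _ ≤ ∑ h : ZMod q, ‖ψ (m * h ^ 2) * ∑ w : ZMod q, ψ (w * (2 * m * h))‖ := by
        rw [h1]; exact norm_sum_le _ _
    _ = q * ((univ : Finset (ZMod q)).filter fun h => ((2 * c : ℤ) : ZMod q) * h = 0).card := by
        rw [sum_congr rfl fun h _ => h2 h, ← sum_filter, sum_const, nsmul_eq_mul, mul_comm]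
    _ ≤ q * (2 * Nat.gcd q c.natAbs : ℕ) := by
        gcongr
        exact (card_mul_eq_zero_le q (2 * c)).trans h4
    _ = _ := by push_cast; ring

lemma sigma_eq_prod (n : ℕ) (a : Fin (n + 1) → ℤ) (t : ℤ) (y : Fin (n + 1) → ℤ) (q b : ℕ) :
    sigma n a t y q b =
      (∏ i, gaussQuad q (b * (a i * y i ^ 3)) / q) * e (-(b / q * t)) := by
  have h1 : ∑ z : Fin (n + 1) → Fin q,
      e ((((b : ℤ) * (∑ i, a i * y i ^ 3 * ((z i : ℕ) : ℤ) ^ 2 - t) : ℤ) : ℝ) / (q : ℝ)) =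
      (∏ i, gaussQuad q (b * (a i * y i ^ 3))) * e (-(b / q * t)) := by
    simp only [gaussQuad, prod_univ_sum, sum_mul, Fintype.piFinset_univ]
    refine sum_congr rfl fun z _ => ?_
    rw [← e_sum, ← e_add, ← sum_div]
    congr 1
    push_cast
    rw [mul_sub, mul_sum, sub_div, sub_eq_add_neg]
    congr 2
    · exact sum_congr rfl fun i _ => by ring
    · ring
  rw [sigma, h1, prod_div_distrib, prod_const, card_univ, Fintype.card_fin]
  ring

lemma norm_sigma_le (n : ℕ) (a : Fin (n + 1) → ℤ) (t : ℤ) (y : Fin (n + 1) → ℤ) {q b : ℕ}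
    (hq : 0 < q) (hbq : Nat.Coprime b q) :
    ‖sigma n a t y q b‖ ≤ ∏ i, √(2 * Nat.gcd q (a i * y i ^ 3).natAbs / q) := by
  rw [sigma_eq_prod, norm_mul, norm_e, mul_one, norm_prod]
  refine prod_le_prod (fun _ _ => norm_nonneg _) fun i _ => ?_
  refine Real.le_sqrt_of_sq_le ?_
  have hq0 : (0 : ℝ) < q := by exact_mod_cast hq
  rw [norm_div, div_pow, Complex.norm_natCast, div_le_div_iff₀ (by positivity) hq0]
  have := norm_sq_gaussQuad_le hq hbq (a i * y i ^ 3)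
  nlinarith

/-! ### The singular integral -/

/-- The one-dimensional oscillatory integral `∫_0^1 e(γ x²) dx`. -/
def fresnel (γ : ℝ) : ℂ := ∫ x in (0 : ℝ)..1, e (γ * x ^ 2)

@[fun_prop]
lemma continuous_fresnel : Continuous fresnel := by
  unfold fresnel
  exact intervalIntegral.continuous_parametric_intervalIntegral_of_continuous'
    (f := fun γ x => e (γ * x ^ 2)) (by simp only [Function.uncurry_def]; fun_prop) _ _

lemma norm_fresnel_le_one (γ : ℝ) : ‖fresnel γ‖ ≤ 1 := by
  have := intervalIntegral.norm_integral_le_of_norm_le_const (a := 0) (b := 1) (C := 1)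
    (f := fun x => e (γ * x ^ 2)) fun x _ => (norm_e _).le
  simpa [fresnel] using this

/-- Near the critical point `x = 0` the integral is bounded trivially, up to `1 / √|γ|`; the
remaining part is integrated by parts. -/
lemma norm_fresnel_le (γ : ℝ) (hγ : 1 ≤ |γ|) : ‖fresnel γ‖ ≤ 2 / √|γ| := by
  have hγ0 : γ ≠ 0 := fun h => by simp [h] at hγ; linarith
  set s := √|γ| with hs
  have hs1 : 1 ≤ s := Real.one_le_sqrt.mpr hγ
  have hs0 : 0 < s := by linarith
  have hss : s * s = |γ| := Real.mul_self_sqrt (abs_nonneg _)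
  set d := 1 / s with hd
  have hd0 : 0 < d := by positivity
  have hd1 : d ≤ 1 := by rw [hd, div_le_one hs0]; exact hs1
  have hcont : Continuous fun x : ℝ => e (γ * x ^ 2) := by fun_prop
  -- integration by parts on `[d, 1]`
  set Φ : ℝ → ℂ := fun x => e (γ * x ^ 2) * ((4 * Real.pi * Complex.I * γ)⁻¹ * ((x⁻¹ : ℝ) : ℂ))
  set R : ℝ → ℂ := fun x => e (γ * x ^ 2) * ((4 * Real.pi * Complex.I * γ)⁻¹ *
    (((x ^ 2)⁻¹ : ℝ) : ℂ)) with hR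
  have hπ : (4 * Real.pi * Complex.I * γ : ℂ) ≠ 0 := by
    simp [hγ0, Real.pi_ne_zero]
  have hpos : ∀ x ∈ Set.uIcc d 1, x ≠ 0 := fun x hx => by
    rw [Set.uIcc_of_le hd1] at hx; linarith [hx.1]
  have hderiv : ∀ x ∈ Set.uIcc d 1, HasDerivAt Φ (e (γ * x ^ 2) - R x) x := by
    intro x hx
    have hx0 := hpos x hx
    have h1 := hasDerivAt_e_comp ((hasDerivAt_pow 2 x).const_mul γ)
    have h2 := ((hasDerivAt_inv hx0).ofReal_comp).const_mul ((4 * Real.pi * Complex.I * γ)⁻¹)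
    refine HasDerivAt.congr_deriv (h1.mul h2) ?_
    simp only [hR]
    have hx0' : (x : ℂ) ≠ 0 := by exact_mod_cast hx0
    have hγ0' : (γ : ℂ) ≠ 0 := by exact_mod_cast hγ0
    push_cast
    field_simp
    ring
  have hRc : ContinuousOn R (Set.uIcc d 1) := by
    refine (hcont.continuousOn).mul (continuousOn_const.mul ?_)
    refine Complex.continuous_ofReal.comp_continuousOn ?_
    exact ContinuousOn.inv₀ (by fun_prop) fun x hx => pow_ne_zero _ (hpos x hx)
  have hRi : IntervalIntegrable R volume d 1 := hRc.intervalIntegrable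
  have hFTC := intervalIntegral.integral_eq_sub_of_hasDerivAt hderiv
    ((hcont.intervalIntegrable _ _).sub hRi)
  rw [intervalIntegral.integral_sub (hcont.intervalIntegrable _ _) hRi] at hFTC
  have hsplit : fresnel γ =
      (∫ x in (0 : ℝ)..d, e (γ * x ^ 2)) + (Φ 1 - Φ d + ∫ x in d..1, R x) := by
    rw [← hFTC, fresnel, ← intervalIntegral.integral_add_adjacent_intervals
      (hcont.intervalIntegrable 0 d) (hcont.intervalIntegrable d 1)]
    ring
  have hκ : ‖(4 * Real.pi * Complex.I * γ : ℂ)⁻¹‖ ≤ 1 / (4 * |γ|) := by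
    rw [norm_inv, ← one_div]
    have : ‖(4 * Real.pi * Complex.I * γ : ℂ)‖ = 4 * Real.pi * |γ| := by
      simp [abs_of_pos Real.pi_pos]
    rw [this]
    have : 1 ≤ Real.pi := by linarith [Real.pi_gt_three]
    gcongr
    nlinarith [abs_nonneg γ]
  have b1 : ‖∫ x in (0 : ℝ)..d, e (γ * x ^ 2)‖ ≤ d := by
    have := intervalIntegral.norm_integral_le_of_norm_le_const (a := 0) (b := d) (C := 1)
      (f := fun x => e (γ * x ^ 2)) fun x _ => (norm_e _).le
    simpa [abs_of_pos hd0] using this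
  have bΦ : ∀ x, 0 < x → ‖Φ x‖ ≤ 1 / (4 * |γ|) * x⁻¹ := by
    intro x hx
    rw [norm_mul, norm_e, one_mul, norm_mul, Complex.norm_real, Real.norm_of_nonneg (by positivity)]
    gcongr
  have bR : ‖∫ x in d..1, R x‖ ≤ 1 / (4 * |γ|) * (1 / d - 1) := by
    have hint : ∫ x in d..1, 1 / (4 * |γ|) * (x ^ 2)⁻¹ = 1 / (4 * |γ|) * (1 / d - 1) := by
      rw [intervalIntegral.integral_const_mul]
      congr 1
      have h1 : ∀ x ∈ Set.uIcc d 1, HasDerivAt (fun x : ℝ => -x⁻¹) ((x ^ 2)⁻¹) x := fun x hx => by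
        have := (hasDerivAt_inv (hpos x hx)).neg
        refine HasDerivAt.congr_deriv this (neg_neg _)
      rw [intervalIntegral.integral_eq_sub_of_hasDerivAt h1]
      · rw [one_div]; ring
      · refine ContinuousOn.intervalIntegrable ?_
        exact ContinuousOn.inv₀ (by fun_prop) fun x hx => pow_ne_zero _ (hpos x hx)
    rw [← hint]
    refine intervalIntegral.norm_integral_le_of_norm_le hd1 ?_ ?_
    · refine Filter.Eventually.of_forall fun x hx => ?_
      have hx0 : 0 < x := hd0.trans hx.1
      rw [hR]
      rw [norm_mul, norm_e, one_mul, norm_mul, Complex.norm_real,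
        Real.norm_of_nonneg (by positivity)]
      gcongr
    · refine ContinuousOn.intervalIntegrable ?_
      exact continuousOn_const.mul
        (ContinuousOn.inv₀ (by fun_prop) fun x hx => pow_ne_zero _ (hpos x hx))
  have hdinv : 1 / d = s := by rw [hd, one_div_one_div]
  rw [hsplit]
  calc _ ≤ d + (1 / (4 * |γ|) * 1⁻¹ + 1 / (4 * |γ|) * d⁻¹ + 1 / (4 * |γ|) * (1 / d - 1)) := by
        refine (norm_add_le _ _).trans (add_le_add b1 ((norm_add_le _ _).trans (add_le_add
          ((norm_sub_le _ _).trans (add_le_add (bΦ 1 one_pos) (bΦ d hd0))) bR)))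
    _ = 1 / s + 1 / (4 * (s * s)) * (2 * s) := by
        rw [← one_div d, hdinv, hd, hss]; ring
    _ = 3 / 2 / s := by field_simp; norm_num
    _ ≤ 2 / s := by gcongr; norm_num

lemma norm_fresnel_le_rpow (γ : ℝ) : ‖fresnel γ‖ ≤ 3 * (1 + |γ|) ^ (-(1 / 2) : ℝ) := by
  have h0 : 0 < 1 + |γ| := by positivity
  rw [Real.rpow_neg h0.le, ← Real.sqrt_eq_rpow, ← div_eq_mul_inv,
    le_div_iff₀ (Real.sqrt_pos.mpr h0)]
  by_cases h : 1 ≤ |γ|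
  · have h1 := norm_fresnel_le γ h
    have h2 : √(1 + |γ|) ≤ √2 * √|γ| := by
      rw [← Real.sqrt_mul (by norm_num)]; exact Real.sqrt_le_sqrt (by linarith)
    have h3 : √2 ≤ 3 / 2 := by
      rw [Real.sqrt_le_left (by norm_num)]; norm_num
    have h4 : 0 < √|γ| := Real.sqrt_pos.mpr (by linarith)
    calc ‖fresnel γ‖ * √(1 + |γ|) ≤ 2 / √|γ| * (3 / 2 * √|γ|) := by
          gcongr
          exact h2.trans (by gcongr)
      _ = 3 := by field_simp
  · have h1 := norm_fresnel_le_one γ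
    have h2 : √(1 + |γ|) ≤ 3 := by
      rw [Real.sqrt_le_left (by norm_num)]; linarith
    have := Real.sqrt_nonneg (1 + |γ|)
    nlinarith [norm_nonneg (fresnel γ)]

lemma oscIntegral_eq_prod (n : ℕ) (ε : Fin (n + 1) → ℤ) (γ : ℝ) :
    oscIntegral n ε γ = ∏ i, fresnel (ε i * γ) := by
  have h1 : ∀ x : Fin (n + 1) → ℝ, e (γ * ∑ i, (ε i : ℝ) * x i ^ 2) =
      ∏ i, e (ε i * γ * x i ^ 2) := fun x => by
    rw [← e_sum, mul_sum]; congr 1; exact sum_congr rfl fun i _ => by ring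
  rw [oscIntegral]
  simp only [h1]
  rw [← Set.pi_univ_Icc, volume_pi, Measure.restrict_pi_pi,
    integral_fintype_prod_eq_prod (f := fun i (x : ℝ) => e (ε i * γ * x ^ 2))]
  refine prod_congr rfl fun i _ => ?_
  rw [fresnel, intervalIntegral.integral_of_le zero_le_one, ← integral_Icc_eq_integral_Ioc]
  rfl

/-- A vector with entries `1` and `-1`. -/
def IsSigns {n : ℕ} (ε : Fin (n + 1) → ℤ) : Prop := ∀ i, |(ε i : ℝ)| = 1

lemma isSigns_signs {n : ℕ} {a y : Fin (n + 1) → ℤ} (ha : ∀ i, a i ≠ 0) (hy : ∀ i, y i ≠ 0) :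
    IsSigns (signs n a y) := by
  intro i
  rw [← Int.cast_abs, signs, Int.abs_sign_of_ne_zero (mul_ne_zero (ha i) (hy i)), Int.cast_one]

lemma continuous_oscIntegral (n : ℕ) (ε : Fin (n + 1) → ℤ) : Continuous (oscIntegral n ε) := by
  simp only [funext (oscIntegral_eq_prod n ε)]
  fun_prop

/-- The exponent is that of the case of five factors, each decaying like `|γ| ^ (-1 / 2)`. -/
lemma norm_oscIntegral_le {n : ℕ} (hn : 4 ≤ n) {ε : Fin (n + 1) → ℤ} (hε : IsSigns ε) (γ : ℝ) :
    ‖oscIntegral n ε γ‖ ≤ 3 ^ (n + 1) * (1 + ‖γ‖) ^ (-(5 / 2) : ℝ) := by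
  have h0 : 1 ≤ 1 + |γ| := by linarith [abs_nonneg γ]
  rw [oscIntegral_eq_prod, norm_prod]
  calc ∏ i, ‖fresnel (ε i * γ)‖ ≤ ∏ i : Fin (n + 1), 3 * (1 + |γ|) ^ (-(1 / 2) : ℝ) := by
        refine prod_le_prod (fun _ _ => norm_nonneg _) fun i _ => ?_
        have := norm_fresnel_le_rpow (ε i * γ)
        rwa [abs_mul, hε i, one_mul] at this
    _ = 3 ^ (n + 1) * (1 + |γ|) ^ (-(1 / 2) * (n + 1 : ℕ) : ℝ) := by
        rw [prod_const, card_univ, Fintype.card_fin, mul_pow, ← Real.rpow_natCast (_ ^ _),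
          ← Real.rpow_mul (by positivity)]
    _ ≤ _ := by
        rw [Real.norm_eq_abs]
        gcongr 3 ^ (n + 1) * ?_
        refine Real.rpow_le_rpow_of_exponent_le h0 ?_
        have : (4 : ℝ) ≤ n := by exact_mod_cast hn
        push_cast; linarith

lemma integrable_one_add_norm_rpow {r : ℝ} (hr : 1 < r) :
    Integrable (fun γ : ℝ => (1 + ‖γ‖) ^ (-r)) :=
  integrable_one_add_norm (by simpa using hr)

lemma integrable_oscIntegral {n : ℕ} (hn : 4 ≤ n) {ε : Fin (n + 1) → ℤ} (hε : IsSigns ε) :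
    Integrable (oscIntegral n ε) := by
  refine Integrable.mono' ((integrable_one_add_norm_rpow (r := 5 / 2) (by norm_num)).const_mul
    (3 ^ (n + 1))) (continuous_oscIntegral n ε).aestronglyMeasurable
    (Filter.Eventually.of_forall fun γ => ?_)
  exact norm_oscIntegral_le hn hε γ

lemma norm_e_sub_one_le (x : ℝ) : ‖e x - 1‖ ≤ 2 * Real.pi * |x| := by
  have h2 : e x = Complex.exp (Complex.I * ((2 * Real.pi * x : ℝ) : ℂ)) := by
    rw [e]; congr 1; push_cast; ring
  rw [h2]
  refine Real.norm_exp_I_mul_ofReal_sub_one_le.trans (le_of_eq ?_)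
  rw [Real.norm_eq_abs, abs_mul, abs_of_pos (by positivity)]

/-- Truncating the singular integral at `R` and inserting the factor `e(-γ τ)` changes it by
`O(R ^ (-1 / 2) + |τ|)`. -/
lemma exists_singularIntegral_truncation {n : ℕ} (hn : 4 ≤ n) :
    ∃ C : ℝ, 0 ≤ C ∧ ∀ ε : Fin (n + 1) → ℤ, IsSigns ε →
      ‖singularIntegral n ε‖ ≤ C ∧ ∀ R τ : ℝ, 1 ≤ R →
      ‖(∫ γ in (-R)..R, oscIntegral n ε γ * e (-(γ * τ))) - singularIntegral n ε‖ ≤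
        C * (R ^ (-(1 / 2) : ℝ) + |τ|) := by
  have hi52 := integrable_one_add_norm_rpow (r := 5 / 2) (by norm_num)
  have hi2 := integrable_one_add_norm_rpow (r := 2) (by norm_num)
  have hi32 := integrable_one_add_norm_rpow (r := 3 / 2) (by norm_num)
  set I52 := ∫ γ : ℝ, (1 + ‖γ‖) ^ (-(5 / 2) : ℝ)
  set I2 := ∫ γ : ℝ, (1 + ‖γ‖) ^ (-2 : ℝ)
  set I32 := ∫ γ : ℝ, (1 + ‖γ‖) ^ (-(3 / 2) : ℝ)
  have p52 : 0 ≤ I52 := integral_nonneg fun γ => by positivity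
  have p2 : 0 ≤ I2 := integral_nonneg fun γ => by positivity
  have p32 : 0 ≤ I32 := integral_nonneg fun γ => by positivity
  refine ⟨3 ^ (n + 1) * (I52 + I2 + 2 * Real.pi * I32), by positivity, fun ε hε => ⟨?_, ?_⟩⟩
  · rw [singularIntegral]
    calc _ ≤ ∫ γ : ℝ, 3 ^ (n + 1) * (1 + ‖γ‖) ^ (-(5 / 2) : ℝ) :=
          norm_integral_le_of_norm_le (hi52.const_mul _)
            (Filter.Eventually.of_forall (norm_oscIntegral_le hn hε))
      _ = 3 ^ (n + 1) * I52 := integral_const_mul _ _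
      _ ≤ _ := by
          have : 0 ≤ 2 * Real.pi * I32 := by positivity
          gcongr; linarith
  · intro R τ hR
    have hR0 : 0 < R := by linarith
    have hosc := integrable_oscIntegral hn hε
    have hS : singularIntegral n ε = (∫ γ in Set.Ioc (-R) R, oscIntegral n ε γ) +
        ∫ γ in (Set.Ioc (-R) R)ᶜ, oscIntegral n ε γ := by
      rw [singularIntegral, integral_add_compl measurableSet_Ioc hosc]
    have hmul : Continuous fun γ => oscIntegral n ε γ * e (-(γ * τ)) :=
      (continuous_oscIntegral n ε).mul (by fun_prop)
    have hE1 : ‖∫ γ in Set.Ioc (-R) R, oscIntegral n ε γ * (e (-(γ * τ)) - 1)‖ ≤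
        3 ^ (n + 1) * (2 * Real.pi * I32) * |τ| := by
      calc _ ≤ ∫ γ in Set.Ioc (-R) R,
            3 ^ (n + 1) * (2 * Real.pi) * |τ| * (1 + ‖γ‖) ^ (-(3 / 2) : ℝ) := by
            refine norm_integral_le_of_norm_le (hi32.integrableOn.const_mul _)
              (Filter.Eventually.of_forall fun γ => ?_)
            rw [norm_mul]
            have hp : 0 < 1 + ‖γ‖ := by positivity
            calc _ ≤ (3 ^ (n + 1) * (1 + ‖γ‖) ^ (-(5 / 2) : ℝ)) *
                  (2 * Real.pi * ((1 + ‖γ‖) * |τ|)) := by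
                  gcongr
                  · exact norm_oscIntegral_le hn hε γ
                  · refine (norm_e_sub_one_le _).trans ?_
                    rw [abs_neg, abs_mul, ← Real.norm_eq_abs γ]
                    gcongr; linarith
              _ = 3 ^ (n + 1) * (2 * Real.pi) * |τ| *
                  ((1 + ‖γ‖) ^ (-(5 / 2) : ℝ) * (1 + ‖γ‖) ^ (1 : ℝ)) := by
                  rw [Real.rpow_one]; ring
              _ = _ := by rw [← Real.rpow_add hp]; norm_num
        _ ≤ ∫ γ : ℝ, 3 ^ (n + 1) * (2 * Real.pi) * |τ| * (1 + ‖γ‖) ^ (-(3 / 2) : ℝ) :=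
            setIntegral_le_integral (hi32.const_mul _)
              (Filter.Eventually.of_forall fun γ => by positivity)
        _ = _ := by rw [integral_const_mul]; ring
    have hE2 : ‖∫ γ in (Set.Ioc (-R) R)ᶜ, oscIntegral n ε γ‖ ≤
        3 ^ (n + 1) * I2 * R ^ (-(1 / 2) : ℝ) := by
      calc _ ≤ ∫ γ in (Set.Ioc (-R) R)ᶜ,
            3 ^ (n + 1) * R ^ (-(1 / 2) : ℝ) * (1 + ‖γ‖) ^ (-2 : ℝ) := by
            refine norm_integral_le_of_norm_le (hi2.integrableOn.const_mul _) ?_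
            refine (ae_restrict_iff' measurableSet_Ioc.compl).mpr
              (Filter.Eventually.of_forall fun γ hγ => ?_)
            have hγR : R ≤ 1 + ‖γ‖ := by
              rw [Real.norm_eq_abs]
              rw [Set.mem_compl_iff, Set.mem_Ioc, not_and_or, not_lt, not_le] at hγ
              rcases hγ with h | h
              · linarith [neg_le_abs γ]
              · linarith [le_abs_self γ]
            have hp : 0 < 1 + ‖γ‖ := by positivity
            calc _ ≤ 3 ^ (n + 1) * (1 + ‖γ‖) ^ (-(5 / 2) : ℝ) := norm_oscIntegral_le hn hε γ
              _ = 3 ^ (n + 1) * (1 + ‖γ‖) ^ (-(1 / 2) : ℝ) * (1 + ‖γ‖) ^ (-2 : ℝ) := by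
                  rw [mul_assoc, ← Real.rpow_add hp]; norm_num
              _ ≤ _ := by
                  have := Real.rpow_le_rpow_of_nonpos hR0 hγR
                    (by norm_num : (-(1 / 2) : ℝ) ≤ 0)
                  gcongr
        _ ≤ ∫ γ : ℝ, 3 ^ (n + 1) * R ^ (-(1 / 2) : ℝ) * (1 + ‖γ‖) ^ (-2 : ℝ) :=
            setIntegral_le_integral (hi2.const_mul _)
              (Filter.Eventually.of_forall fun γ => by positivity)
        _ = _ := by rw [integral_const_mul]; ring
    have hdiff : (∫ γ in (-R)..R, oscIntegral n ε γ * e (-(γ * τ))) - singularIntegral n ε =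
        (∫ γ in Set.Ioc (-R) R, oscIntegral n ε γ * (e (-(γ * τ)) - 1)) -
          ∫ γ in (Set.Ioc (-R) R)ᶜ, oscIntegral n ε γ := by
      rw [hS, intervalIntegral.integral_of_le (by linarith)]
      simp only [mul_sub, mul_one]
      rw [integral_sub ((hmul.integrableOn_Icc).mono_set Set.Ioc_subset_Icc_self)
        hosc.integrableOn]
      ring
    rw [hdiff]
    refine (norm_sub_le _ _).trans ((add_le_add hE1 hE2).trans ?_)
    have hx : 0 ≤ R ^ (-(1 / 2) : ℝ) := by positivity
    have hτ := abs_nonneg τ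
    have hπ := Real.pi_pos
    rw [mul_assoc _ _ |τ|, mul_assoc _ I2, mul_assoc _ _ (R ^ (-(1 / 2) : ℝ) + |τ|), ← mul_add]
    gcongr 3 ^ (n + 1) * ?_
    have e1 : 0 ≤ (2 * Real.pi * I32) * R ^ (-(1 / 2) : ℝ) := by positivity
    have e2 : 0 ≤ I52 * (R ^ (-(1 / 2) : ℝ) + |τ|) := by positivity
    have e3 : 0 ≤ I2 * |τ| := by positivity
    nlinarith

/-! ### Approximation of quadratic exponential sums near rational points -/

/-- Partial sums of a periodic sequence of numbers of modulus at most `1` grow linearly, up to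
an error bounded in terms of the period. -/
lemma norm_sum_range_sub_le {u : ℕ → ℂ} {q : ℕ} (hq : 0 < q) (hu : Function.Periodic u q)
    (hu1 : ∀ k, ‖u k‖ ≤ 1) (m : ℕ) :
    ‖∑ k ∈ range m, u k - m * ((∑ k ∈ range q, u k) / q)‖ ≤ 2 * q := by
  have hq0 : (0 : ℝ) < q := by exact_mod_cast hq
  set κ := (∑ k ∈ range q, u k) / q with hκ
  have hκ1 : ‖κ‖ ≤ 1 := by
    rw [hκ, norm_div, Complex.norm_natCast, div_le_one hq0]
    exact (norm_sum_le_of_le _ fun k _ => hu1 k).trans (by simp)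
  set D : ℕ → ℂ := fun m => ∑ k ∈ range m, u k - m * κ with hD
  have hper : Function.Periodic D q := by
    intro m
    induction m with
    | zero =>
      simp only [hD, hκ, zero_add, sum_range_zero, Nat.cast_zero, zero_mul, sub_zero]
      have : (q : ℂ) ≠ 0 := by exact_mod_cast hq.ne'
      field_simp; ring
    | succ m ih =>
      have h1 : ∀ k, D (k + 1) = D k + (u k - κ) := fun k => by
        simp only [hD, sum_range_succ]; push_cast; ring
      rw [add_right_comm, h1, h1, ih, hu m]
  have h2 : D m = D (m % q) := (hper.map_mod_nat m).symm
  change ‖D m‖ ≤ _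
  rw [h2]
  have h3 : ((m % q : ℕ) : ℝ) ≤ q := by exact_mod_cast (Nat.mod_lt m hq).le
  calc ‖D (m % q)‖ ≤ ‖∑ k ∈ range (m % q), u k‖ + ‖((m % q : ℕ) : ℂ) * κ‖ := norm_sub_le _ _
    _ ≤ (m % q : ℕ) + (m % q : ℕ) * 1 := by
        rw [norm_mul, Complex.norm_natCast]
        gcongr
        exact (norm_sum_le_of_le _ fun k _ => hu1 k).trans (by simp)
    _ ≤ _ := by linarith

/-- Partial summation: if the partial sums of `w` are `κ t + O(A)`, then
`∑ f(k) w(k)` is `κ ∫ f` up to `A` times the sum of the sup norm and the variation of `f`. -/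
lemma norm_sum_mul_sub_integral_le {w : ℕ → ℂ} {κ : ℂ} {A Z L : ℝ} (hZ : 0 ≤ Z)
    {f f' : ℝ → ℂ} (hf : ∀ t, HasDerivAt f (f' t) t) (hf' : Continuous f') (hf1 : ‖f Z‖ ≤ 1)
    (hfL : ∀ t, 0 ≤ t → ‖f' t‖ ≤ L * t)
    (hw : ∀ t : ℝ, 0 ≤ t → ‖∑ k ∈ Icc 0 ⌊t⌋₊, w k - t * κ‖ ≤ A) :
    ‖∑ k ∈ Icc 0 ⌊Z⌋₊, f k * w k - κ * ∫ t in (0 : ℝ)..Z, f t‖ ≤ A * (1 + L * Z ^ 2 / 2) := by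
  have hA : 0 ≤ A := (norm_nonneg _).trans (hw 0 le_rfl)
  have hderiv : deriv f = f' := funext fun t => (hf t).deriv
  have hfc : Continuous f := continuous_iff_continuousAt.mpr fun t => (hf t).continuousAt
  have habel := sum_mul_eq_sub_integral_mul (c := w) (f := f) hZ
    (fun t _ => (hf t).differentiableAt) (by rw [hderiv]; exact hf'.integrableOn_Icc)
  rw [hderiv] at habel
  have hint1 : IntegrableOn (fun t => f' t * ∑ k ∈ Icc 0 ⌊t⌋₊, w k) (Set.Ioc 0 Z) :=
    (integrableOn_mul_sum_Icc (c := w) le_rfl hf'.integrableOn_Icc).mono_set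
      Set.Ioc_subset_Icc_self
  have hint2 : IntegrableOn (fun t : ℝ => f' t * (t * κ)) (Set.Ioc 0 Z) :=
    ((by fun_prop : Continuous fun t : ℝ => f' t * (t * κ)).integrableOn_Icc).mono_set
      Set.Ioc_subset_Icc_self
  have hparts : ∫ t in (0 : ℝ)..Z, f t = Z * f Z - ∫ t in (0 : ℝ)..Z, t * f' t := by
    have h1 : ∀ t ∈ Set.uIcc 0 Z, HasDerivAt (fun t : ℝ => (t : ℂ) * f t) (1 * f t + t * f' t) t :=
      fun t _ => (hasDerivAt_id t).ofReal_comp.mul (hf t)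
    have h2 := intervalIntegral.integral_eq_sub_of_hasDerivAt h1
      ((by fun_prop : Continuous fun t : ℝ => 1 * f t + t * f' t).intervalIntegrable _ _)
    rw [intervalIntegral.integral_add
      ((by fun_prop : Continuous fun t : ℝ => 1 * f t).intervalIntegrable _ _)
      ((by fun_prop : Continuous fun t : ℝ => t * f' t).intervalIntegrable _ _)] at h2
    simp only [one_mul, Complex.ofReal_zero, zero_mul, sub_zero] at h2
    rw [← h2]; ring
  have hid : ∑ k ∈ Icc 0 ⌊Z⌋₊, f k * w k - κ * ∫ t in (0 : ℝ)..Z, f t =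
      f Z * (∑ k ∈ Icc 0 ⌊Z⌋₊, w k - Z * κ) -
        ∫ t in Set.Ioc 0 Z, f' t * (∑ k ∈ Icc 0 ⌊t⌋₊, w k - t * κ) := by
    simp only [mul_sub]
    rw [integral_sub hint1 hint2, habel, hparts, mul_sub, ← intervalIntegral.integral_const_mul,
      intervalIntegral.integral_of_le hZ]
    have : ∀ t : ℝ, κ * (t * f' t) = f' t * (t * κ) := fun t => by ring
    simp only [this]
    ring
  have hE : ‖∫ t in Set.Ioc 0 Z, f' t * (∑ k ∈ Icc 0 ⌊t⌋₊, w k - t * κ)‖ ≤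
      A * (L * Z ^ 2 / 2) := by
    have h1 : ∫ t in Set.Ioc 0 Z, L * t * A = A * (L * Z ^ 2 / 2) := by
      rw [← intervalIntegral.integral_of_le hZ, intervalIntegral.integral_mul_const,
        intervalIntegral.integral_const_mul, integral_id]
      ring
    rw [← h1]
    refine norm_integral_le_of_norm_le
      ((by fun_prop : Continuous fun t : ℝ => L * t * A).integrableOn_Icc.mono_set
        Set.Ioc_subset_Icc_self) ?_
    refine (ae_restrict_iff' measurableSet_Ioc).mpr (Filter.Eventually.of_forall fun t ht => ?_)
    rw [norm_mul]
    have h2 := hfL t ht.1.le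
    have h3 := hw t ht.1.le
    have h4 := norm_nonneg (f' t)
    gcongr
    linarith
  rw [hid]
  calc _ ≤ 1 * A + A * (L * Z ^ 2 / 2) := by
        refine (norm_sub_le _ _).trans (add_le_add ?_ hE)
        rw [norm_mul]
        gcongr
        exact hw Z hZ
    _ = _ := by ring

/-- Close to `b / q`, the quadratic exponential sum is a Gauss sum times an oscillatory integral. -/
lemma norm_quadSum_sub_le {b q : ℕ} (hq : 0 < q) {c : ℤ} (hc : c ≠ 0) {B : ℝ} (hB : 0 ≤ B)
    (β : ℝ) :
    ‖quadSum c ⌊√(B / |(c : ℝ)|)⌋₊ (b / q + β) -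
      gaussQuad q (b * c) / q * √(B / |(c : ℝ)|) * fresnel (c.sign * (B * β))‖ ≤
      28 * q * (1 + B * |β|) := by
  have hq0 : (0 : ℝ) < q := by exact_mod_cast hq
  have hq1 : (1 : ℝ) ≤ q := by exact_mod_cast hq
  have hc0 : 0 < |(c : ℝ)| := by positivity
  set Z := √(B / |(c : ℝ)|) with hZ
  have hZ0 : 0 ≤ Z := Real.sqrt_nonneg _
  have hZ2 : |(c : ℝ)| * Z ^ 2 = B := by
    rw [hZ, Real.sq_sqrt (by positivity)]; field_simp
  have hsgn : (c : ℝ) * Z ^ 2 = c.sign * B := by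
    rw [← hZ2, ← mul_assoc]; congr 1
    have := Int.sign_mul_abs c
    exact_mod_cast this.symm
  set w : ℕ → ℂ := fun k => e (((b * c * (k : ℤ) ^ 2 : ℤ) : ℝ) / q) with hw
  set f : ℝ → ℂ := fun t => e (β * c * t ^ 2) with hf
  set f' : ℝ → ℂ := fun t => 2 * Real.pi * Complex.I * ((β * c * (2 * t) : ℝ) : ℂ) * f t with hf'
  have hper : Function.Periodic w q := by
    intro k
    simp only [hw]
    have : (((b * c * ((k + q : ℕ) : ℤ) ^ 2 : ℤ) : ℝ) / q) =
        ((b * c * (k : ℤ) ^ 2 : ℤ) : ℝ) / q + ((b * c * (2 * k + q) : ℤ) : ℝ) := by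
      push_cast; field_simp; ring
    rw [this, e_add, e_intCast, mul_one]
  have hw1 : ∀ k, ‖w k‖ ≤ 1 := fun k => (norm_e _).le
  have hG : ∑ k ∈ range q, w k = gaussQuad q (b * c) := by
    rw [gaussQuad, ← Fin.sum_univ_eq_sum_range]
  set κ := gaussQuad q (b * c) / q with hκ
  have hκ1 : ‖κ‖ ≤ 1 := by
    rw [hκ, ← hG, norm_div, Complex.norm_natCast, div_le_one hq0]
    exact (norm_sum_le_of_le _ fun k _ => hw1 k).trans (by simp)
  have hwA : ∀ t : ℝ, 0 ≤ t → ‖∑ k ∈ Icc 0 ⌊t⌋₊, w k - t * κ‖ ≤ 2 * q + 1 := by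
    intro t ht
    have h1 := norm_sum_range_sub_le hq hper hw1 (⌊t⌋₊ + 1)
    rw [hG] at h1
    have h2 : ∑ k ∈ Icc 0 ⌊t⌋₊, w k = ∑ k ∈ range (⌊t⌋₊ + 1), w k := by
      rw [Finset.range_eq_Ico]; rfl
    have h3 : ∑ k ∈ Icc 0 ⌊t⌋₊, w k - t * κ =
        (∑ k ∈ range (⌊t⌋₊ + 1), w k - ((⌊t⌋₊ + 1 : ℕ) : ℂ) * κ) +
          (((⌊t⌋₊ : ℝ) + 1 - t : ℝ) : ℂ) * κ := by
      rw [h2]; push_cast; ring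
    rw [h3]
    refine (norm_add_le _ _).trans (add_le_add h1 ?_)
    rw [norm_mul, Complex.norm_real, Real.norm_eq_abs]
    have h4 : |(⌊t⌋₊ : ℝ) + 1 - t| ≤ 1 := by
      rw [abs_le]
      constructor <;> linarith [Nat.floor_le ht, Nat.lt_floor_add_one t]
    calc _ ≤ (1 : ℝ) * 1 := by gcongr
      _ = 1 := one_mul _
  have hderiv : ∀ t, HasDerivAt f (f' t) t := by
    intro t
    have := hasDerivAt_e_comp ((hasDerivAt_pow 2 t).const_mul (β * c))
    refine HasDerivAt.congr_deriv this ?_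
    simp only [hf', hf]
    norm_num
  have key := norm_sum_mul_sub_integral_le (w := w) (κ := κ) (A := 2 * q + 1)
    (L := 4 * Real.pi * (|β| * |(c : ℝ)|)) hZ0 hderiv (by fun_prop) (norm_e _).le ?_ hwA
  swap
  · intro t ht
    simp only [hf', hf]
    rw [norm_mul, norm_e, mul_one, norm_mul, Complex.norm_real, Real.norm_eq_abs, abs_mul, abs_mul,
      abs_mul, abs_of_nonneg ht]
    simp only [norm_mul, Complex.norm_ofNat, Complex.norm_real, Complex.norm_I, Real.norm_eq_abs,
      abs_of_pos Real.pi_pos, mul_one, abs_of_pos (by norm_num : (0 : ℝ) < 2)]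
    apply le_of_eq; ring
  have hI : ∫ t in (0 : ℝ)..Z, f t = Z * fresnel (c.sign * (B * β)) := by
    have h1 := intervalIntegral.smul_integral_comp_mul_left (a := 0) (b := 1) f Z
    rw [mul_zero, mul_one] at h1
    rw [← h1, fresnel, Complex.real_smul]
    congr 1
    refine intervalIntegral.integral_congr fun x _ => ?_
    simp only [hf]
    congr 1
    linear_combination β * x ^ 2 * hsgn
  -- partial summation includes the term `k = 0`, which `quadSum` omits
  have hS : ∑ k ∈ Icc 0 ⌊Z⌋₊, f k * w k = 1 + quadSum c ⌊Z⌋₊ (b / q + β) := by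
    have h2 : ∑ k ∈ Icc 0 ⌊Z⌋₊, f k * w k = ∑ k ∈ range (⌊Z⌋₊ + 1), f k * w k := by
      rw [Finset.range_eq_Ico]; rfl
    rw [h2, sum_range_succ', add_comm, quadSum]
    congr 1
    · simp [hf, hw, e_zero]
    · refine sum_congr rfl fun x _ => ?_
      simp only [hf, hw]
      rw [← e_add]; congr 1; push_cast; field_simp; ring
  rw [hI, hS] at key
  have hfin : quadSum c ⌊Z⌋₊ (b / q + β) - κ * Z * fresnel (c.sign * (B * β)) =
      (1 + quadSum c ⌊Z⌋₊ (b / q + β) - κ * (Z * fresnel (c.sign * (B * β)))) - 1 := by ring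
  rw [hfin]
  have hLB : 4 * Real.pi * (|β| * |(c : ℝ)|) * Z ^ 2 / 2 = 2 * Real.pi * (B * |β|) := by
    rw [← hZ2]; ring
  rw [hLB] at key
  have hx : 0 ≤ B * |β| := by positivity
  calc _ ≤ (2 * q + 1) * (1 + 2 * Real.pi * (B * |β|)) + 1 := by
        refine (norm_sub_le _ _).trans (add_le_add key (by simp))
    _ ≤ (3 * q) * (1 + 2 * 4 * (B * |β|)) + q := by
        have := Real.pi_le_four
        gcongr; linarith
    _ ≤ _ := by nlinarith [mul_nonneg hq0.le hx]

/-! ### The dissection into major and minor arcs -/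

/-- The reduced fractions `b / q` with `1 ≤ b ≤ q ≤ P`, as pairs `⟨q, b⟩`. -/
def fareyIndex (P : ℝ) : Finset (Σ _ : ℕ, ℕ) := (Icc 1 ⌊P⌋₊).sigma reducedNumerators

lemma mem_fareyIndex {P : ℝ} {s : Σ _ : ℕ, ℕ} :
    s ∈ fareyIndex P ↔ (1 ≤ s.1 ∧ s.1 ≤ ⌊P⌋₊) ∧ (1 ≤ s.2 ∧ s.2 ≤ s.1) ∧ Nat.Coprime s.2 s.1 := by
  simp only [fareyIndex, mem_sigma, reducedNumerators, mem_filter, mem_Icc]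

/-- The major arc of radius `η` around `b / q`, where `s = ⟨q, b⟩`. -/
def majorArc (η : ℝ) (s : Σ _ : ℕ, ℕ) : Set ℝ :=
  Set.Ioc ((s.2 : ℝ) / s.1 - η) ((s.2 : ℝ) / s.1 + η)

/-- The minor arcs: the part of a unit interval outside the major arcs. The interval `(η, η + 1]`
contains the major arcs around all `b / q` with `1 ≤ b ≤ q ≤ P`, including that around `1`. -/
def minorArcs (P η : ℝ) : Set ℝ :=
  Set.Ioc η (η + 1) \ ⋃ s ∈ fareyIndex P, majorArc η s

lemma measurableSet_minorArcs (P η : ℝ) : MeasurableSet (minorArcs P η) :=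
  measurableSet_Ioc.diff (Finset.measurableSet_biUnion _ fun _ _ => measurableSet_Ioc)

lemma majorArc_subset {P η : ℝ} (hPη : 2 * η * P ^ 2 < 1)
    {s : Σ _ : ℕ, ℕ} (hs : s ∈ fareyIndex P) : majorArc η s ⊆ Set.Ioc η (η + 1) := by
  obtain ⟨⟨h1, h2⟩, ⟨h3, h4⟩, -⟩ := mem_fareyIndex.mp hs
  have hP : (s.1 : ℝ) ≤ P := (Nat.le_floor_iff' (by omega)).mp h2
  have hq1 : (1 : ℝ) ≤ s.1 := by exact_mod_cast h1
  have hb1 : (1 : ℝ) ≤ s.2 := by exact_mod_cast h3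
  have hbq : (s.2 : ℝ) ≤ s.1 := by exact_mod_cast h4
  refine Set.Ioc_subset_Ioc ?_ ?_
  · have : 2 * η ≤ (s.2 : ℝ) / s.1 := by
      rw [le_div_iff₀ (by linarith)]
      nlinarith
    linarith
  · have : (s.2 : ℝ) / s.1 ≤ 1 := by rw [div_le_one (by linarith)]; exact hbq
    linarith

lemma pairwiseDisjoint_majorArc {P η : ℝ} (hPη : 2 * η * P ^ 2 < 1) :
    (fareyIndex P : Set (Σ _ : ℕ, ℕ)).Pairwise (Function.onFun Disjoint (majorArc η)) := by
  intro s hs s' hs' hne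
  obtain ⟨⟨h1, h2⟩, ⟨h3, h4⟩, h5⟩ := mem_fareyIndex.mp hs
  obtain ⟨⟨h1', h2'⟩, ⟨h3', h4'⟩, h5'⟩ := mem_fareyIndex.mp hs'
  have hP : (s.1 : ℝ) ≤ P := (Nat.le_floor_iff' (by omega)).mp h2
  have hP' : (s'.1 : ℝ) ≤ P := (Nat.le_floor_iff' (by omega)).mp h2'
  have hq : (0 : ℝ) < s.1 := by exact_mod_cast h1
  have hq' : (0 : ℝ) < s'.1 := by exact_mod_cast h1'
  have hcross : (s.2 * s'.1 : ℤ) - s'.2 * s.1 ≠ 0 := by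
    intro h
    have h6 : s.2 * s'.1 = s'.2 * s.1 := by zify; linarith
    have d1 : s.1 ∣ s'.1 := h5.symm.dvd_of_dvd_mul_left (h6 ▸ dvd_mul_left _ _)
    have d2 : s'.1 ∣ s.1 := h5'.symm.dvd_of_dvd_mul_left (h6 ▸ dvd_mul_left _ _)
    have e1 : s.1 = s'.1 := Nat.dvd_antisymm d1 d2
    have e2 : s.2 = s'.2 := by
      rw [e1] at h6; exact Nat.eq_of_mul_eq_mul_right h1' h6
    exact hne (Sigma.ext e1 (heq_of_eq e2))
  have hgap : 2 * η < |(s.2 : ℝ) / s.1 - s'.2 / s'.1| := by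
    rw [div_sub_div _ _ hq.ne' hq'.ne', abs_div, abs_of_pos (mul_pos hq hq'),
      lt_div_iff₀ (mul_pos hq hq')]
    have h7 : (1 : ℝ) ≤ |(s.2 : ℝ) * s'.1 - s.1 * s'.2| := by
      have := Int.one_le_abs hcross
      rw [mul_comm (s'.2 : ℤ)] at this
      exact_mod_cast this
    by_cases hη : 0 ≤ η
    · have : (s.1 : ℝ) * s'.1 ≤ P ^ 2 := by nlinarith
      nlinarith
    · have := mul_pos hq hq'
      nlinarith
  rw [Function.onFun, Set.disjoint_left]
  intro α hα hα'
  rw [majorArc, Set.mem_Ioc] at hα hα'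
  rcases abs_cases ((s.2 : ℝ) / s.1 - s'.2 / s'.1) with ⟨h, _⟩ | ⟨h, _⟩ <;> linarith

lemma integral_eq_major_add_minor {P η : ℝ} (hη : 0 < η) (hPη : 2 * η * P ^ 2 < 1)
    {g : ℝ → ℂ} (hg : Continuous g) (hper : Function.Periodic g 1) :
    ∫ α in (0 : ℝ)..1, g α =
      ∑ q ∈ Icc 1 ⌊P⌋₊, ∑ b ∈ reducedNumerators q, (∫ β in (-η)..η, g (b / q + β)) +
        ∫ α in minorArcs P η, g α := by
  have hint : ∀ u v : ℝ, IntegrableOn g (Set.Ioc u v) := fun u v =>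
    (hg.integrableOn_Icc).mono_set Set.Ioc_subset_Icc_self
  have h1 : ∫ α in (0 : ℝ)..1, g α = ∫ α in Set.Ioc η (η + 1), g α := by
    have := hper.intervalIntegral_add_eq 0 η
    rw [zero_add] at this
    rw [this, intervalIntegral.integral_of_le (by linarith)]
  have hsub : (⋃ s ∈ fareyIndex P, majorArc η s) ⊆ Set.Ioc η (η + 1) :=
    Set.iUnion₂_subset fun s hs => majorArc_subset hPη hs
  have h2 : ∫ α in ⋃ s ∈ fareyIndex P, majorArc η s, g α =
      ∑ s ∈ fareyIndex P, ∫ α in majorArc η s, g α :=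
    integral_biUnion_finset _ (fun _ _ => measurableSet_Ioc) (pairwiseDisjoint_majorArc hPη)
      fun _ _ => hint _ _
  have h3 : ∀ s : Σ _ : ℕ, ℕ, ∫ α in majorArc η s, g α =
      ∫ β in (-η)..η, g ((s.2 : ℝ) / s.1 + β) := by
    intro s
    rw [intervalIntegral.integral_comp_add_left (fun x => g x), majorArc,
      intervalIntegral.integral_of_le (by linarith), sub_eq_add_neg]
  have hmeas : MeasurableSet (⋃ s ∈ fareyIndex P, majorArc η s) :=
    Finset.measurableSet_biUnion (fareyIndex P) fun _ _ => measurableSet_Ioc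
  have h4 := setIntegral_sdiff hmeas (hint η (η + 1)) hsub
  rw [h1, minorArcs, h4, h2, fareyIndex, sum_sigma]
  simp only [h3]
  ring

/-- Dirichlet's theorem supplies rational approximations with denominators beyond `P` on the
minor arcs. -/
lemma exists_approx_of_mem_minorArcs {P η : ℝ} (hP : 1 ≤ P) (hη : 0 < η)
    (hPη : 2 * η * P ^ 2 < 1) {α : ℝ} (hα : α ∈ minorArcs P η) :
    ∃ (b : ℤ) (q : ℕ), 0 < q ∧ IsCoprime b (q : ℤ) ∧ |α - b / q| ≤ 1 / (q : ℝ) ^ 2 ∧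
      P ≤ q ∧ (q : ℝ) ≤ 1 / η := by
  obtain ⟨hα1, hα2⟩ := hα
  have hη2 : η < 1 / 2 := by nlinarith
  have hN : 0 < ⌊1 / η⌋₊ := Nat.floor_pos.mpr (by rw [le_div_iff₀ hη]; linarith)
  obtain ⟨r, hr1, hr2⟩ := Real.exists_rat_abs_sub_le_and_den_le α hN
  have hq0 : (0 : ℝ) < r.den := by exact_mod_cast r.den_pos
  have hq1 : (1 : ℝ) ≤ r.den := by exact_mod_cast r.den_pos
  have hrat : (r : ℝ) = r.num / r.den := Rat.cast_def r
  rw [hrat] at hr1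
  have hfl := Nat.lt_floor_add_one (1 / η)
  have hqN : (r.den : ℝ) ≤ ⌊1 / η⌋₊ := by exact_mod_cast hr2
  have hqη : (r.den : ℝ) ≤ 1 / η := hqN.trans (Nat.floor_le (by positivity))
  have hsq : |α - r.num / r.den| ≤ 1 / (r.den : ℝ) ^ 2 := by
    refine hr1.trans ?_
    rw [pow_two]
    gcongr
    linarith
  have hlt : |α - r.num / r.den| < η / r.den := by
    refine hr1.trans_lt ?_
    rw [div_lt_div_iff₀ (by positivity) hq0]
    rw [div_lt_iff₀ hη] at hfl
    nlinarith
  refine ⟨r.num, r.den, r.den_pos, Rat.isCoprime_num_den r, hsq, ?_, hqη⟩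
  -- if `q < P`, then `α` lies in the major arc around `b / q`; as `α ∈ (η, η + 1]`, `1 ≤ b ≤ q`
  by_contra! hcon
  apply hα2
  have hltη : |α - r.num / r.den| < η := hlt.trans_le (div_le_self hη.le hq1)
  obtain ⟨u1, u2⟩ := abs_lt.mp hltη
  obtain ⟨w1, w2⟩ := abs_lt.mp hlt
  have hnum0 : 0 < r.num := by
    have : (0 : ℝ) < r.num / r.den := by linarith [hα1.1]
    have := (div_pos_iff_of_pos_right hq0).mp this
    exact_mod_cast this
  have hnum1 : r.num ≤ r.den := by
    by_contra! h
    have h1 : (r.den : ℝ) + 1 ≤ r.num := by exact_mod_cast h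
    have h2 : 1 + 1 / (r.den : ℝ) ≤ r.num / r.den := by
      rw [le_div_iff₀ hq0]; field_simp; linarith
    have h3 : η + η / r.den < 1 / r.den := by
      rw [lt_div_iff₀ hq0, add_mul, div_mul_cancel₀ _ hq0.ne']
      nlinarith
    linarith [hα1.2]
  have hcast : ((r.num.toNat : ℕ) : ℝ) = r.num := by
    have : ((r.num.toNat : ℕ) : ℤ) = r.num := Int.toNat_of_nonneg hnum0.le
    exact_mod_cast congrArg (Int.cast (R := ℝ)) this
  have hnat : r.num.toNat = r.num.natAbs := by omega
  refine Set.mem_iUnion₂.mpr ⟨⟨r.den, r.num.toNat⟩, mem_fareyIndex.mpr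
    ⟨⟨r.den_pos, Nat.le_floor hcon.le⟩, ⟨by dsimp only; omega, by dsimp only; omega⟩, ?_⟩, ?_⟩
  · rw [hnat]; exact r.reduced
  · rw [majorArc, Set.mem_Ioc, hcast]
    constructor <;> linarith

/-- Comparison of two products factor by factor. The factor `W` on the left avoids the exponent
`s.card - 1` on the right. -/
lemma norm_prod_sub_prod_le {ι : Type*} (s : Finset ι) {u v : ι → ℂ} {W E : ℝ} (hW : 0 < W)
    (hu : ∀ i ∈ s, ‖u i‖ ≤ W) (hv : ∀ i ∈ s, ‖v i‖ ≤ W) (huv : ∀ i ∈ s, ‖u i - v i‖ ≤ E) :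
    W * ‖∏ i ∈ s, u i - ∏ i ∈ s, v i‖ ≤ s.card * W ^ s.card * E := by
  classical
  induction s using Finset.induction_on with
  | empty => simp
  | insert i s hi ih =>
    have ih' := ih (fun j hj => hu j (mem_insert_of_mem hj))
      (fun j hj => hv j (mem_insert_of_mem hj)) (fun j hj => huv j (mem_insert_of_mem hj))
    rw [prod_insert hi, prod_insert hi, card_insert_of_notMem hi]
    have h1 : u i * ∏ j ∈ s, u j - v i * ∏ j ∈ s, v j =
        u i * (∏ j ∈ s, u j - ∏ j ∈ s, v j) + (u i - v i) * ∏ j ∈ s, v j := by ring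
    have h2 : ‖∏ j ∈ s, v j‖ ≤ W ^ s.card := by
      rw [norm_prod, ← prod_const]
      exact prod_le_prod (fun _ _ => norm_nonneg _) fun j hj => hv j (mem_insert_of_mem hj)
    have h3 := hu i (mem_insert_self _ _)
    have h4 := huv i (mem_insert_self _ _)
    have hE : 0 ≤ E := (norm_nonneg _).trans h4
    calc W * ‖u i * ∏ j ∈ s, u j - v i * ∏ j ∈ s, v j‖
        ≤ W * (‖u i‖ * ‖∏ j ∈ s, u j - ∏ j ∈ s, v j‖ + ‖u i - v i‖ * ‖∏ j ∈ s, v j‖) := by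
          rw [h1, ← norm_mul, ← norm_mul]
          gcongr
          exact norm_add_le _ _
      _ ≤ W * (W * ‖∏ j ∈ s, u j - ∏ j ∈ s, v j‖ + E * W ^ s.card) := by gcongr
      _ ≤ W * (s.card * W ^ s.card * E) + W * (E * W ^ s.card) := by
          rw [mul_add]; gcongr
      _ = _ := by push_cast; ring

/-! ### The contribution of the major arcs -/

lemma norm_gaussQuad_le (q : ℕ) (m : ℤ) : ‖gaussQuad q m‖ ≤ q :=
  (norm_sum_le_of_le _ fun _ _ => (norm_e _).le).trans (by simp)

@[fun_prop]
lemma continuous_quadSum (c : ℤ) (X : ℕ) : Continuous (quadSum c X) := by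
  unfold quadSum; fun_prop

lemma norm_quadSum_le (c : ℤ) (X : ℕ) (α : ℝ) : ‖quadSum c X α‖ ≤ X :=
  (norm_sum_le_of_le _ fun _ _ => (norm_e _).le).trans (by simp)

lemma sign_mul_pow_three (a y : ℤ) : (a * y ^ 3).sign = (a * y).sign := by
  rw [Int.sign_mul, Int.sign_mul, pow_succ, Int.sign_mul]
  rcases eq_or_ne y 0 with rfl | hy
  · simp
  · rw [Int.sign_eq_one_of_pos (by positivity : 0 < y ^ 2), one_mul]

/-- The generating function of the solutions of `∑ a i * y i ^ 3 * x i ^ 2 = t` in positive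
integers `x i` with `|a i * y i ^ 3| * x i ^ 2 ≤ B`. -/
def genFun (n : ℕ) (a : Fin (n + 1) → ℤ) (t : ℤ) (y : Fin (n + 1) → ℤ) (B α : ℝ) : ℂ :=
  (∏ i, quadSum (a i * y i ^ 3) ⌊√(B / |((a i * y i ^ 3 : ℤ) : ℝ)|)⌋₊ α) * e (-(α * t))

lemma continuous_genFun (n : ℕ) (a : Fin (n + 1) → ℤ) (t : ℤ) (y : Fin (n + 1) → ℤ) (B : ℝ) :
    Continuous (genFun n a t y B) := by
  unfold genFun; fun_prop

lemma periodic_genFun (n : ℕ) (a : Fin (n + 1) → ℤ) (t : ℤ) (y : Fin (n + 1) → ℤ) (B : ℝ) :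
    Function.Periodic (genFun n a t y B) 1 := by
  intro α
  have h1 : ∀ (c : ℤ) (X : ℕ), quadSum c X (α + 1) = quadSum c X α := by
    intro c X
    refine sum_congr rfl fun x _ => ?_
    have : (α + 1) * (c * ((x : ℝ) + 1) ^ 2) =
        α * (c * ((x : ℝ) + 1) ^ 2) + ((c * ((x : ℤ) + 1) ^ 2 : ℤ) : ℝ) := by push_cast; ring
    rw [this, e_add, e_intCast, mul_one]
  have h2 : -((α + 1) * (t : ℝ)) = -(α * t) + ((-t : ℤ) : ℝ) := by push_cast; ring
  simp only [genFun, h1]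
  rw [h2, e_add, e_intCast, mul_one]

section
variable {n : ℕ} {a y : Fin (n + 1) → ℤ} (t : ℤ) {B η P : ℝ}

lemma sqrt_div_abs_le (hB : 0 ≤ B) {c : ℤ} (hc : c ≠ 0) : √(B / |(c : ℝ)|) ≤ √B := by
  have : (1 : ℝ) ≤ |(c : ℝ)| := by exact_mod_cast Int.one_le_abs hc
  exact Real.sqrt_le_sqrt (div_le_self hB this)

/-- The generating function near `b / q`. -/
lemma norm_genFun_sub_le (ha : ∀ i, a i ≠ 0) (hy : ∀ i, y i ≠ 0) (hB : 1 ≤ B)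
    {q b : ℕ} (hq : 0 < q) (hqP : (q : ℝ) ≤ P) {β : ℝ} (hβ : |β| ≤ η) :
    ‖genFun n a t y B (b / q + β) - sigma n a t y q b *
        (∏ i, √(B / |((a i * y i ^ 3 : ℤ) : ℝ)|) : ℝ) *
        (oscIntegral n (signs n a y) (B * β) * e (-(B * β * (t / B))))‖ ≤
      (n + 1) * √B ^ n * (28 * P * (1 + B * η)) := by
  have hB0 : 0 < B := by linarith
  have hq0 : (0 : ℝ) < q := by exact_mod_cast hq
  set c : Fin (n + 1) → ℤ := fun i => a i * y i ^ 3 with hc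
  have hc0 : ∀ i, c i ≠ 0 := fun i => mul_ne_zero (ha i) (pow_ne_zero _ (hy i))
  set u : Fin (n + 1) → ℂ := fun i => quadSum (c i) ⌊√(B / |(c i : ℝ)|)⌋₊ (b / q + β) with hu
  set v : Fin (n + 1) → ℂ := fun i => gaussQuad q (b * c i) / q * √(B / |(c i : ℝ)|) *
    fresnel ((c i).sign * (B * β)) with hv
  have hmain : sigma n a t y q b * (∏ i, √(B / |((a i * y i ^ 3 : ℤ) : ℝ)|) : ℝ) *
      (oscIntegral n (signs n a y) (B * β) * e (-(B * β * (t / B)))) =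
      (∏ i, v i) * e (-((b / q + β) * t)) := by
    have h1 : e (-((b / q + β) * t)) = e (-(b / q * t)) * e (-(B * β * (t / B))) := by
      rw [← e_add]; congr 1; field_simp; ring
    rw [h1, sigma_eq_prod, oscIntegral_eq_prod]
    simp only [hv, prod_mul_distrib, hc, sign_mul_pow_three, signs]
    push_cast
    ring
  have hgen : genFun n a t y B (b / q + β) = (∏ i, u i) * e (-((b / q + β) * t)) := rfl
  rw [hmain, hgen, ← sub_mul, norm_mul, norm_e, mul_one]
  have hW : 0 < √B := Real.sqrt_pos.mpr hB0
  have key := norm_prod_sub_prod_le (univ : Finset (Fin (n + 1))) (u := u) (v := v) (W := √B)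
    (E := 28 * P * (1 + B * η)) hW ?_ ?_ ?_
  · rw [card_univ, Fintype.card_fin, pow_succ] at key
    refine le_of_mul_le_mul_left (key.trans (le_of_eq ?_)) hW
    push_cast; ring
  · intro i _
    exact (norm_quadSum_le _ _ _).trans
      ((Nat.floor_le (Real.sqrt_nonneg _)).trans (sqrt_div_abs_le hB0.le (hc0 i)))
  · intro i _
    have h1 : ‖gaussQuad q (b * c i) / q‖ ≤ 1 := by
      rw [norm_div, Complex.norm_natCast, div_le_one hq0]
      exact norm_gaussQuad_le _ _
    have h2 := sqrt_div_abs_le hB0.le (hc0 i)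
    have h3 := norm_fresnel_le_one ((c i).sign * (B * β))
    simp only [hv]
    rw [norm_mul, norm_mul, Complex.norm_real, Real.norm_of_nonneg (Real.sqrt_nonneg _)]
    calc _ ≤ 1 * √B * 1 := by gcongr
      _ = √B := by ring
  · intro i _
    refine (norm_quadSum_sub_le hq (hc0 i) hB0.le β).trans ?_
    have : 0 ≤ P := hq0.le.trans hqP
    gcongr

/-- The part of the singular series with `q ≤ P`. -/
def partialSeries (n : ℕ) (a : Fin (n + 1) → ℤ) (t : ℤ) (y : Fin (n + 1) → ℤ) (P : ℝ) : ℂ :=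
  ∑ q ∈ Icc 1 ⌊P⌋₊, ∑ b ∈ reducedNumerators q, sigma n a t y q b

/-- The integral over the major arcs, after the substitution `γ = B β`. -/
lemma norm_majorArcs_sub_le (ha : ∀ i, a i ≠ 0) (hy : ∀ i, y i ≠ 0) (hB : 1 ≤ B)
    (hP : 1 ≤ P) (hη : 0 < η) :
    ‖∑ q ∈ Icc 1 ⌊P⌋₊, ∑ b ∈ reducedNumerators q, (∫ β in (-η)..η, genFun n a t y B (b / q + β)) -
      partialSeries n a t y P * (∏ i, √(B / |((a i * y i ^ 3 : ℤ) : ℝ)|) : ℝ) *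
        ((B : ℂ)⁻¹ * ∫ γ in (-(B * η))..(B * η),
          oscIntegral n (signs n a y) γ * e (-(γ * (t / B))))‖ ≤
      P ^ 2 * ((n + 1) * √B ^ n * (28 * P * (1 + B * η)) * (2 * η)) := by
  have hB0 : 0 < B := by linarith
  set Zp : ℂ := ((∏ i, √(B / |((a i * y i ^ 3 : ℤ) : ℝ)|) : ℝ) : ℂ) with hZp
  set E := (n + 1) * √B ^ n * (28 * P * (1 + B * η)) with hE
  have hE0 : 0 ≤ E := by positivity
  have hoscc : Continuous fun γ => oscIntegral n (signs n a y) γ * e (-(γ * (t / B))) :=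
    (continuous_oscIntegral n _).mul (by fun_prop)
  have hsubst : (B : ℂ)⁻¹ * ∫ γ in (-(B * η))..(B * η),
      oscIntegral n (signs n a y) γ * e (-(γ * (t / B))) =
      ∫ β in (-η)..η, oscIntegral n (signs n a y) (B * β) * e (-(B * β * (t / B))) := by
    rw [intervalIntegral.integral_comp_mul_left
      (fun γ => oscIntegral n (signs n a y) γ * e (-(γ * (t / B)))) hB0.ne', Complex.real_smul]
    push_cast
    rw [mul_neg]
  rw [hsubst]
  have harc : ∀ q ∈ Icc 1 ⌊P⌋₊, ∀ b : ℕ,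
      ‖(∫ β in (-η)..η, genFun n a t y B (b / q + β)) - sigma n a t y q b * Zp *
        ∫ β in (-η)..η, oscIntegral n (signs n a y) (B * β) * e (-(B * β * (t / B)))‖ ≤
        E * (2 * η) := by
    intro q hq b
    obtain ⟨hq1, hq2⟩ := mem_Icc.mp hq
    have hqP : (q : ℝ) ≤ P := (Nat.le_floor_iff' (by omega)).mp hq2
    rw [← intervalIntegral.integral_const_mul, ← intervalIntegral.integral_sub]
    · have := intervalIntegral.norm_integral_le_of_norm_le_const (a := -η) (b := η) (C := E)
        (f := fun β => genFun n a t y B (b / q + β) - sigma n a t y q b * Zp *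
          (oscIntegral n (signs n a y) (B * β) * e (-(B * β * (t / B))))) fun β hβ => by
          refine norm_genFun_sub_le t ha hy hB (by omega) hqP ?_
          rw [Set.uIoc_of_le (by linarith)] at hβ
          exact abs_le.mpr ⟨hβ.1.le, hβ.2⟩
      refine this.trans (le_of_eq ?_)
      rw [abs_of_nonneg (by linarith)]; ring
    · exact ((continuous_genFun n a t y B).comp (by fun_prop)).intervalIntegrable _ _
    · exact (continuous_const.mul (hoscc.comp (by fun_prop : Continuous fun β : ℝ => B * β))
        ).intervalIntegrable _ _
  rw [partialSeries, sum_mul, sum_mul, ← sum_sub_distrib]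
  have hfl : (⌊P⌋₊ : ℝ) ≤ P := Nat.floor_le (by linarith)
  calc _ ≤ ∑ q ∈ Icc 1 ⌊P⌋₊, P * (E * (2 * η)) := by
        refine norm_sum_le_of_le _ fun q hq => ?_
        rw [sum_mul, sum_mul, ← sum_sub_distrib]
        have hcard : ((reducedNumerators q).card : ℝ) ≤ P := by
          have h1 : (reducedNumerators q).card ≤ q := by
            refine (card_filter_le _ _).trans ?_
            simp
          have h2 : q ≤ ⌊P⌋₊ := (mem_Icc.mp hq).2
          have h3 : ((reducedNumerators q).card : ℝ) ≤ ⌊P⌋₊ := by exact_mod_cast h1.trans h2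
          linarith
        calc _ ≤ ∑ b ∈ reducedNumerators q, E * (2 * η) :=
              norm_sum_le_of_le _ fun b _ => harc q hq b
          _ = (reducedNumerators q).card * (E * (2 * η)) := by rw [sum_const, nsmul_eq_mul]
          _ ≤ _ := by gcongr
    _ = ⌊P⌋₊ * (P * (E * (2 * η))) := by rw [sum_const, nsmul_eq_mul]; simp
    _ ≤ P * (P * (E * (2 * η))) := by gcongr
    _ = _ := by ring

/-- The term of the weighted absolute singular series `∑_q q ^ θ ∑_b |σ(b / q)|` at `q`. The
weight makes the tail beyond `P` smaller by `P ^ (-θ)`. -/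
def absSeriesTerm (n : ℕ) (a : Fin (n + 1) → ℤ) (t : ℤ) (y : Fin (n + 1) → ℤ) (θ : ℝ) (q : ℕ) :
    ℝ := (q : ℝ) ^ θ * ∑ b ∈ reducedNumerators q, ‖sigma n a t y q b‖

lemma absSeriesTerm_nonneg (θ : ℝ) (q : ℕ) : 0 ≤ absSeriesTerm n a t y θ q := by
  unfold absSeriesTerm; positivity

lemma sum_norm_le_absSeriesTerm {θ : ℝ} (hθ : 0 ≤ θ) (q : ℕ) :
    ∑ b ∈ reducedNumerators q, ‖sigma n a t y q b‖ ≤ absSeriesTerm n a t y θ q := by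
  rcases Nat.eq_zero_or_pos q with rfl | hq
  · simp [reducedNumerators, absSeriesTerm]
  · have : (1 : ℝ) ≤ (q : ℝ) ^ θ := Real.one_le_rpow (by exact_mod_cast hq) hθ
    rw [absSeriesTerm]
    exact le_mul_of_one_le_left (sum_nonneg fun _ _ => norm_nonneg _) this

lemma summable_sum_norm_sigma {θ : ℝ} (hθ : 0 ≤ θ) (hs : Summable (absSeriesTerm n a t y θ)) :
    Summable fun q : ℕ => ∑ b ∈ reducedNumerators q, ‖sigma n a t y q b‖ :=
  hs.of_nonneg_of_le (fun _ => sum_nonneg fun _ _ => norm_nonneg _)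
    (sum_norm_le_absSeriesTerm t hθ)

lemma norm_singularSeries_le {θ : ℝ} (hθ : 0 ≤ θ) (hs : Summable (absSeriesTerm n a t y θ)) :
    ‖singularSeries n a t y‖ ≤ ∑' q, absSeriesTerm n a t y θ q :=
  tsum_of_norm_bounded hs.hasSum fun q =>
    (norm_sum_le _ _).trans (sum_norm_le_absSeriesTerm t hθ q)

lemma norm_partialSeries_le {θ : ℝ} (hθ : 0 ≤ θ) (hs : Summable (absSeriesTerm n a t y θ)) :
    ‖partialSeries n a t y P‖ ≤ ∑' q, absSeriesTerm n a t y θ q :=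
  calc _ ≤ ∑ q ∈ Icc 1 ⌊P⌋₊, absSeriesTerm n a t y θ q :=
        norm_sum_le_of_le _ fun q _ => (norm_sum_le _ _).trans (sum_norm_le_absSeriesTerm t hθ q)
    _ ≤ _ := hs.sum_le_tsum _ fun q _ => absSeriesTerm_nonneg t θ q

lemma norm_singularSeries_sub_partialSeries_le {θ : ℝ} (hθ : 0 ≤ θ) (hP : 1 ≤ P)
    (hs : Summable (absSeriesTerm n a t y θ)) :
    ‖partialSeries n a t y P - singularSeries n a t y‖ ≤
      P ^ (-θ) * ∑' q, absSeriesTerm n a t y θ q := by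
  have hP0 : 0 < P := by linarith
  set f : ℕ → ℂ := fun q => ∑ b ∈ reducedNumerators q, sigma n a t y q b with hf
  have hfs : Summable f := Summable.of_norm_bounded hs fun q =>
    (norm_sum_le _ _).trans (sum_norm_le_absSeriesTerm t hθ q)
  have h1 : partialSeries n a t y P - singularSeries n a t y =
      ∑' q, ((if q ∈ Icc 1 ⌊P⌋₊ then f q else 0) - f q) := by
    rw [Summable.tsum_sub (summable_of_ne_finset_zero (s := Icc 1 ⌊P⌋₊) fun q hq => if_neg hq) hfs,
      tsum_eq_sum (s := Icc 1 ⌊P⌋₊) fun q hq => if_neg hq]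
    congr 1
    exact sum_congr rfl fun q hq => by rw [if_pos hq]
  rw [h1, ← tsum_mul_left]
  refine tsum_of_norm_bounded (hs.mul_left _).hasSum fun q => ?_
  split_ifs with hq
  · rw [sub_self, norm_zero]
    exact mul_nonneg (by positivity) (absSeriesTerm_nonneg t θ q)
  · rw [zero_sub, norm_neg]
    rcases Nat.eq_zero_or_pos q with rfl | hq0
    · simp [hf, reducedNumerators, absSeriesTerm]
    · have hPq : P ≤ q := by
        rw [mem_Icc, not_and, not_le] at hq
        exact ((Nat.floor_lt hP0.le).mp (hq hq0)).le
      have h2 : 1 ≤ P ^ (-θ) * (q : ℝ) ^ θ := by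
        rw [Real.rpow_neg hP0.le, ← div_eq_inv_mul, one_le_div (by positivity)]
        gcongr
      rw [absSeriesTerm, ← mul_assoc]
      refine (norm_sum_le _ _).trans ?_
      exact le_mul_of_one_le_left (sum_nonneg fun _ _ => norm_nonneg _) h2

end

/-! ### Upper bounds for the number of solutions -/

lemma sqrt_pow_eq_rpow {B : ℝ} (hB : 0 ≤ B) (k : ℕ) : √B ^ k = B ^ ((k : ℝ) / 2) := by
  rw [Real.sqrt_eq_rpow, ← Real.rpow_natCast, ← Real.rpow_mul hB]; congr 1; ring

lemma exists_card_pairs_le_sqrt : ∃ C : ℝ, 1 ≤ C ∧ ∀ B : ℝ, 1 ≤ B →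
    ((pairs B).card : ℝ) ≤ C * √B := by
  obtain ⟨C, hC1, hC⟩ := exists_card_pairs_le
  refine ⟨C, hC1, fun B hB => ?_⟩
  have h := hC B 1 (by linarith) le_rfl
  rw [Real.one_rpow, mul_one, filter_true_of_mem] at h
  · exact h
  · intro p hp
    exact_mod_cast Int.one_le_abs (mem_pairs.mp hp).2.1

/-- If the `j`-th variable is restricted to a set `D j`, the number of solutions is at most `#(D j)`
times a constant times `B ^ ((n - 2) / 2 + ε)`: the `j`-th factor of the generating function is
estimated trivially, four others by their fourth moments. -/
lemma exists_card_solutions_le {n : ℕ} (hn : 4 ≤ n) {ε : ℝ} (hε : 0 < ε) :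
    ∃ C : ℝ, 0 ≤ C ∧ ∀ B : ℝ, 1 ≤ B → ∀ D : Fin (n + 1) → Finset (ℤ × ℤ), (∀ i, D i ⊆ pairs B) →
      ∀ a : Fin (n + 1) → ℤ, (∀ i, a i ≠ 0) → ∀ t : ℤ, ∀ j,
      (((Fintype.piFinset D).filter fun p => ∑ i, a i * sqf (p i) = t).card : ℝ) ≤
        C * (D j).card * B ^ (((n : ℝ) - 2) / 2 + ε) := by
  obtain ⟨C1, hC1, h1⟩ := exists_card_pairs_le_sqrt
  obtain ⟨C2, hC2, h2⟩ := exists_integral_pow_four_le hε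
  refine ⟨4 * C2 * C1 ^ (n - 4), by positivity, fun B hB D hD a ha t j => ?_⟩
  have hB0 : 0 < B := by linarith
  set F : Fin (n + 1) → ℝ → ℂ := fun i => expSum (D i) (fun p => a i * sqf p) with hF
  have hcount := card_solutions_eq_integral D (fun i p => a i * sqf p) t
  have hcF : ∀ i, Continuous (F i) := fun i => continuous_expSum _ _
  have hbound := setIntegral_prod_le hn hcF (s := 0) (U := (D j).card) (W := C1 * √B)
    (J := C2 * B ^ (1 + ε)) (m := Set.Ioc 0 (0 + 1)) measurableSet_Ioc subset_rfl (by positivity)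
    (fun i α => (norm_expSum_le _ _ _).trans (le_trans
      (by exact_mod_cast card_le_card (hD i)) (h1 B hB))) j
    (fun α _ => norm_expSum_le _ _ _)
    (fun i => by rw [hF, setIntegral_Ioc_expSum_pow]; exact h2 B hB (D i) (hD i) (a i) (ha i))
  calc (((Fintype.piFinset D).filter fun p => ∑ i, a i * sqf (p i) = t).card : ℝ)
      = ‖∫ α in (0 : ℝ)..1, (∏ i, F i α) * e (-(α * t))‖ := by
        rw [hF, ← hcount, Complex.norm_natCast]
    _ ≤ ∫ α in Set.Ioc (0 : ℝ) (0 + 1), ∏ i, ‖F i α‖ := by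
        rw [zero_add, intervalIntegral.integral_of_le zero_le_one]
        refine (norm_integral_le_integral_norm _).trans (le_of_eq ?_)
        refine integral_congr_ae (Filter.Eventually.of_forall fun α => ?_)
        simp only [norm_mul, norm_e, mul_one, norm_prod]
    _ ≤ _ := hbound
    _ = _ := by
        have h3 : ((n - 4 : ℕ) : ℝ) = n - 4 := by rw [Nat.cast_sub hn]; norm_num
        rw [mul_pow, sqrt_pow_eq_rpow hB0.le, h3]
        have h4 : B ^ (((n : ℝ) - 2) / 2 + ε) = B ^ (1 + ε) * B ^ (((n : ℝ) - 4) / 2) := by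
          rw [← Real.rpow_add hB0]; congr 1; ring
        rw [h4]; ring

/-! ### The minor arcs -/

open scoped Classical in
/-- The pairs `(x, y)` with `x ≠ 0`, `y` squarefree and `|a x² y³| ≤ B`. -/
def admissible (a : ℤ) (B : ℝ) : Finset (ℤ × ℤ) :=
  (pairs B).filter fun p => ((|a * sqf p| : ℤ) : ℝ) ≤ B ∧ Squarefree p.2

open scoped Classical in
lemma admissible_subset (a : ℤ) (B : ℝ) : admissible a B ⊆ pairs B := filter_subset _ _

open scoped Classical in
lemma mem_admissible {a : ℤ} (ha : a ≠ 0) {B : ℝ} {p : ℤ × ℤ} :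
    p ∈ admissible a B ↔ p.1 ≠ 0 ∧ ((|a * sqf p| : ℤ) : ℝ) ≤ B ∧ Squarefree p.2 := by
  rw [admissible, mem_filter, mem_pairs]
  constructor
  · rintro ⟨⟨h1, -, -⟩, h2, h3⟩; exact ⟨h1, h2, h3⟩
  · rintro ⟨h1, h2, h3⟩
    refine ⟨⟨h1, h3.ne_zero, le_trans ?_ h2⟩, h2, h3⟩
    rw [abs_mul]
    exact_mod_cast le_mul_of_one_le_left (abs_nonneg _) (Int.one_le_abs ha)

/-- The pairs in `admissible a B` with given second coordinate `y`. -/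
def slice (a y : ℤ) (B : ℝ) : Finset (ℤ × ℤ) := (admissible a B).filter fun p => p.2 = y

lemma slice_subset (a y : ℤ) (B : ℝ) : slice a y B ⊆ pairs B :=
  (filter_subset _ _).trans (admissible_subset a B)

/-- The values of `x` come in pairs `±x`, which accounts for the factor `2`. -/
lemma expSum_slice {a y : ℤ} (ha : a ≠ 0) (hy : Squarefree y) {B : ℝ} (hB : 0 ≤ B) (α : ℝ) :
    expSum (slice a y B) (fun p => a * sqf p) α =
      2 * quadSum (a * y ^ 3) ⌊√(B / |((a * y ^ 3 : ℤ) : ℝ)|)⌋₊ α := by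
  set X := ⌊√(B / |((a * y ^ 3 : ℤ) : ℝ)|)⌋₊ with hX
  have hc : a * y ^ 3 ≠ 0 := mul_ne_zero ha (pow_ne_zero _ hy.ne_zero)
  have hc0 : 0 < |((a * y ^ 3 : ℤ) : ℝ)| := by
    rw [abs_pos]; exact_mod_cast hc
  have hmem : ∀ p : ℤ × ℤ, p ∈ slice a y B ↔ p.2 = y ∧ p.1 ≠ 0 ∧ p.1.natAbs ≤ X := by
    intro p
    rw [slice, mem_filter, mem_admissible ha]
    have key : p.2 = y → ((((|a * sqf p| : ℤ) : ℝ) ≤ B) ↔ p.1.natAbs ≤ X) := by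
      rintro rfl
      rw [hX, Nat.le_floor_iff (Real.sqrt_nonneg _), Real.le_sqrt (by positivity),
        le_div_iff₀ hc0]
      · rw [Nat.cast_natAbs]
        have : ((|a * sqf p| : ℤ) : ℝ) = ((|p.1| : ℤ) : ℝ) ^ 2 * |((a * p.2 ^ 3 : ℤ) : ℝ)| := by
          rw [sqf]; push_cast; rw [← abs_pow, ← abs_mul]; congr 1; ring
        rw [this]
      · exact div_nonneg hB hc0.le
    constructor
    · rintro ⟨⟨h1, h2, -⟩, h3⟩; exact ⟨h3, h1, (key h3).mp h2⟩
    · rintro ⟨h3, h1, h2⟩; exact ⟨⟨h1, (key h3).mpr h2, h3 ▸ hy⟩, h3⟩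
  have hunion : slice a y B = (range X).image (fun k : ℕ => ((k : ℤ) + 1, y)) ∪
      (range X).image (fun k : ℕ => (-((k : ℤ) + 1), y)) := by
    ext p
    simp only [hmem, mem_union, mem_image, mem_range]
    constructor
    · rintro ⟨h1, h2, h3⟩
      rcases lt_or_gt_of_ne h2 with h | h
      · exact Or.inr ⟨p.1.natAbs - 1, by omega, Prod.ext (by dsimp only; omega) h1.symm⟩
      · exact Or.inl ⟨p.1.natAbs - 1, by omega, Prod.ext (by dsimp only; omega) h1.symm⟩
    · rintro (⟨k, hk, rfl⟩ | ⟨k, hk, rfl⟩) <;>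
        exact ⟨rfl, by dsimp only; omega, by dsimp only; omega⟩
  have hdisj : Disjoint ((range X).image (fun k : ℕ => ((k : ℤ) + 1, y)))
      ((range X).image (fun k : ℕ => (-((k : ℤ) + 1), y))) := by
    rw [disjoint_left]
    intro p hp hp'
    obtain ⟨k, -, rfl⟩ := mem_image.mp hp
    obtain ⟨k', -, h⟩ := mem_image.mp hp'
    have := congrArg Prod.fst h
    dsimp only at this; omega
  rw [expSum, hunion, sum_union hdisj, sum_image, sum_image, two_mul, quadSum]
  · congr 1 <;> refine sum_congr rfl fun k _ => ?_ <;> congr 1 <;> simp only [sqf] <;>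
      push_cast <;> ring
  · intro k _ k' _ h
    have := congrArg Prod.fst h
    dsimp only at this; omega
  · intro k _ k' _ h
    have := congrArg Prod.fst h
    dsimp only at this; omega

lemma card_slice_solutions {n : ℕ} {a y : Fin (n + 1) → ℤ} (ha : ∀ i, a i ≠ 0)
    (hy : ∀ i, Squarefree (y i)) (t : ℤ) {B : ℝ} (hB : 0 ≤ B) :
    (((Fintype.piFinset fun i => slice (a i) (y i) B).filter
      fun p => ∑ i, a i * sqf (p i) = t).card : ℂ) =
      2 ^ (n + 1) * ∫ α in (0 : ℝ)..1, genFun n a t y B α := by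
  rw [card_solutions_eq_integral _ (fun i p => a i * sqf p) t,
    ← intervalIntegral.integral_const_mul]
  refine intervalIntegral.integral_congr fun α _ => ?_
  simp only [expSum_slice (ha _) (hy _) hB, prod_mul_distrib, prod_const, card_univ,
    Fintype.card_fin, genFun]
  ring

/-- Weyl's inequality for the factor with index `0` and the fourth moment for four others. -/
lemma exists_norm_minorArcs_le {n : ℕ} (hn : 4 ≤ n) {ε : ℝ} (hε : 0 < ε) :
    ∃ C : ℝ, 0 ≤ C ∧ ∀ ν B H : ℝ, 0 < ν → ν ≤ 1 / 2 → 1 ≤ B → 1 ≤ H →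
      2 * B ^ (ν - 1) * (B ^ ν) ^ 2 < 1 →
      ∀ a y : Fin (n + 1) → ℤ, (∀ i, a i ≠ 0) → (∀ i, Squarefree (y i)) →
      (∀ i, |((a i * y i ^ 3 : ℤ) : ℝ)| ≤ H) → ∀ t : ℤ,
      ‖∫ α in minorArcs (B ^ ν) (B ^ (ν - 1)), genFun n a t y B α‖ ≤
        C * H * B ^ (((n : ℝ) - 1) / 2 + ε - ν / 4) := by
  obtain ⟨C2, hC2, h2⟩ := exists_integral_pow_four_le hε
  refine ⟨36 * C2, by positivity, fun ν B H hν hν2 hB hH hPη a y ha hy hcH t => ?_⟩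
  have hB0 : 0 < B := by linarith
  set c : Fin (n + 1) → ℤ := fun i => a i * y i ^ 3 with hc
  have hc0 : ∀ i, c i ≠ 0 := fun i => mul_ne_zero (ha i) (pow_ne_zero _ (hy i).ne_zero)
  set X : Fin (n + 1) → ℕ := fun i => ⌊√(B / |(c i : ℝ)|)⌋₊ with hX
  have hXB : ∀ i, (X i : ℝ) ≤ √B := fun i =>
    (Nat.floor_le (Real.sqrt_nonneg _)).trans (sqrt_div_abs_le hB0.le (hc0 i))
  have hP1 : 1 ≤ B ^ ν := Real.one_le_rpow hB hν.le
  have hη0 : 0 < B ^ (ν - 1) := by positivity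
  -- Weyl's inequality, with the points `α k` within `B ^ (-1 / 2 + ν / 2)` of an integer
  -- counted separately
  have hweyl : ∀ α ∈ minorArcs (B ^ ν) (B ^ (ν - 1)),
      ‖quadSum (c 0) (X 0) α‖ ≤ 9 * H * B ^ (1 / 2 - ν / 4) := by
    intro α hα
    obtain ⟨b, q, hq, hbq, happ, hqP, hqQ⟩ := exists_approx_of_mem_minorArcs hP1 hη0 hPη hα
    set δ := B ^ (-(1 / 2) + ν / 2) with hδ
    have hδ0 : 0 < δ := by positivity
    have hw := norm_sq_quadSum_le hq hbq happ (hc0 0) (X 0) hδ0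
    have hq0 : (0 : ℝ) < q := by exact_mod_cast hq
    have hX0 : (0 : ℝ) ≤ X 0 := Nat.cast_nonneg _
    have hXs : (X 0 : ℝ) ≤ B ^ (1 / 2 : ℝ) := by rw [← Real.sqrt_eq_rpow]; exact hXB 0
    have hXX : (X 0 : ℝ) * X 0 ≤ B := by
      calc (X 0 : ℝ) * X 0 ≤ √B * √B := by gcongr <;> exact hXB 0
        _ = B := Real.mul_self_sqrt hB0.le
    have hqQ' : (q : ℝ) ≤ B ^ (1 - ν) := by
      refine hqQ.trans (le_of_eq ?_)
      rw [one_div, ← Real.rpow_neg hB0.le]; congr 1; ring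
    have hle : ∀ x : ℝ, x ≤ 1 - ν / 2 → B ^ x ≤ B ^ (1 - ν / 2) := fun x hx =>
      Real.rpow_le_rpow_of_exponent_le hB hx
    set T := B ^ (1 - ν / 2) with hT
    have hT0 : 0 < T := by positivity
    have hcH0 : |(c 0 : ℝ)| ≤ H := hcH 0
    have t1 : X 0 * (4 * |(c 0 : ℝ)| * X 0 / q * (4 * q * δ)) ≤ 16 * H * T := by
      calc X 0 * (4 * |(c 0 : ℝ)| * X 0 / q * (4 * q * δ))
          = 16 * |(c 0 : ℝ)| * (X 0 * X 0 * δ) := by field_simp; ring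
        _ ≤ 16 * H * (B * δ) := by gcongr
        _ ≤ 16 * H * T := by
          gcongr
          rw [hδ]; nth_rewrite 1 [← Real.rpow_one B]
          rw [← Real.rpow_add hB0]
          exact hle _ (by linarith)
    have t2 : X 0 * (4 * |(c 0 : ℝ)| * X 0 / q * 3) ≤ 12 * H * T := by
      calc X 0 * (4 * |(c 0 : ℝ)| * X 0 / q * 3)
          = 12 * |(c 0 : ℝ)| * (X 0 * X 0 / q) := by ring
        _ ≤ 12 * H * (B / B ^ ν) := by gcongr
        _ ≤ 12 * H * T := by
          gcongr
          nth_rewrite 1 [← Real.rpow_one B]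
          rw [← Real.rpow_sub hB0]
          exact hle _ (by linarith)
    have t3 : X 0 * (4 * q * δ) ≤ 4 * T := by
      calc X 0 * (4 * q * δ) ≤ B ^ (1 / 2 : ℝ) * (4 * B ^ (1 - ν) * δ) := by gcongr
        _ = 4 * B ^ (1 / 2 + (1 - ν) + (-(1 / 2) + ν / 2)) := by
          rw [Real.rpow_add hB0 (1 / 2 + (1 - ν)), Real.rpow_add hB0 (1 / 2) (1 - ν)]; ring
        _ ≤ 4 * T := by
          gcongr
          exact hle _ (by linarith)
    have t4 : (X 0 : ℝ) ≤ T := hXs.trans (hle _ (by linarith))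
    have t5 : X 0 * (1 / δ) ≤ T := by
      calc X 0 * (1 / δ) ≤ B ^ (1 / 2 : ℝ) * (1 / δ) := by gcongr
        _ ≤ T := by
          rw [hδ, one_div (B ^ _), ← Real.rpow_neg hB0.le, ← Real.rpow_add hB0]
          exact hle _ (by linarith)
    have hsq : ‖quadSum (c 0) (X 0) α‖ ^ 2 ≤ 72 * H * T := by
      refine hw.trans ?_
      have : 2 * (X 0 : ℝ) * ((4 * |(c 0 : ℝ)| * X 0 / q + 1) * (4 * q * δ + 3) + 1 / δ) =
        2 * (X 0 * (4 * |(c 0 : ℝ)| * X 0 / q * (4 * q * δ)) +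
          X 0 * (4 * |(c 0 : ℝ)| * X 0 / q * 3) + X 0 * (4 * q * δ) + 3 * X 0 +
            X 0 * (1 / δ)) := by ring
      rw [this]
      nlinarith
    have hsq2 : 72 * H * T ≤ (9 * H * B ^ (1 / 2 - ν / 4)) ^ 2 := by
      have : (B ^ (1 / 2 - ν / 4)) ^ 2 = T := by
        rw [← Real.rpow_natCast, ← Real.rpow_mul hB0.le]; congr 1; push_cast; ring
      rw [mul_pow, this]
      gcongr
      nlinarith
    exact le_of_sq_le_sq (hsq.trans hsq2) (by positivity)
  have hfour : ∀ i, ∫ α in Set.Ioc (B ^ (ν - 1)) (B ^ (ν - 1) + 1), ‖quadSum (c i) (X i) α‖ ^ 4 ≤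
      C2 * B ^ (1 + ε) := by
    intro i
    have h3 := h2 B hB (slice (a i) (y i) B) (slice_subset _ _ _) (a i) (ha i)
    rw [← setIntegral_Ioc_expSum_pow _ _ (B ^ (ν - 1))] at h3
    refine le_trans ?_ h3
    refine setIntegral_mono_on ?_ ?_ measurableSet_Ioc fun α _ => ?_
    · exact integrableOn_of_continuous (by fun_prop) _ subset_rfl
    · exact integrableOn_of_continuous (by fun_prop) _ subset_rfl
    · rw [expSum_slice (ha i) (hy i) hB0.le, norm_mul]
      gcongr
      simp only [Complex.norm_ofNat]
      have := norm_nonneg (quadSum (c i) (X i) α)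
      change _ ≤ 2 * ‖quadSum (c i) (X i) α‖
      linarith
  have hbound := setIntegral_prod_le hn (F := fun i => quadSum (c i) (X i))
    (fun i => continuous_quadSum _ _) (s := B ^ (ν - 1)) (W := √B)
    (measurableSet_minorArcs (B ^ ν) (B ^ (ν - 1))) Set.sdiff_subset
    (by positivity : 0 ≤ 9 * H * B ^ (1 / 2 - ν / 4))
    (fun i α => (norm_quadSum_le _ _ _).trans (hXB i)) 0 hweyl hfour
  refine (norm_integral_le_integral_norm _).trans (le_trans (le_of_eq ?_) (hbound.trans
    (le_of_eq ?_)))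
  · refine integral_congr_ae (Filter.Eventually.of_forall fun α => ?_)
    simp only [genFun, norm_mul, norm_e, mul_one, norm_prod]
    rfl
  · have h3 : ((n - 4 : ℕ) : ℝ) = n - 4 := by rw [Nat.cast_sub hn]; norm_num
    rw [sqrt_pow_eq_rpow hB0.le, h3]
    have h4 : B ^ (((n : ℝ) - 1) / 2 + ε - ν / 4) =
        B ^ (1 / 2 - ν / 4) * B ^ (1 + ε) * B ^ (((n : ℝ) - 4) / 2) := by
      rw [← Real.rpow_add hB0, ← Real.rpow_add hB0]; congr 1; ring
    rw [h4]; ring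

/-! ### The asymptotic formula for fixed `y` -/

/-- The denominator `∏ |a i * y i ^ 3| ^ (1 / 2)` of the leading term. -/
def rootProd (n : ℕ) (a y : Fin (n + 1) → ℤ) : ℝ := ∏ i, √((|a i * y i ^ 3| : ℤ) : ℝ)

lemma one_le_rootProd {n : ℕ} {a y : Fin (n + 1) → ℤ} (ha : ∀ i, a i ≠ 0) (hy : ∀ i, y i ≠ 0) :
    1 ≤ rootProd n a y := by
  rw [rootProd, ← prod_const_one (s := (univ : Finset (Fin (n + 1))))]
  refine prod_le_prod (fun _ _ => zero_le_one) fun i _ => Real.one_le_sqrt.mpr ?_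
  exact_mod_cast Int.one_le_abs (mul_ne_zero (ha i) (pow_ne_zero 3 (hy i)))

lemma prod_sqrt_div_eq {n : ℕ} (a y : Fin (n + 1) → ℤ) {B : ℝ} (hB : 0 < B) :
    (∏ i, √(B / |((a i * y i ^ 3 : ℤ) : ℝ)|)) * B⁻¹ =
      B ^ (((n : ℝ) - 1) / 2) / rootProd n a y := by
  have h1 : ∏ i, √(B / |((a i * y i ^ 3 : ℤ) : ℝ)|) = √B ^ (n + 1) / rootProd n a y := by
    rw [rootProd]
    simp only [Real.sqrt_div hB.le, prod_div_distrib, prod_const, card_univ, Fintype.card_fin,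
      Int.cast_abs]
  rw [h1, sqrt_pow_eq_rpow hB.le, div_mul_eq_mul_div]
  congr 1
  rw [← Real.rpow_neg_one, ← Real.rpow_add hB]
  congr 1; push_cast; ring

/-- The circle method for `∑ a i * y i ^ 3 * x i ^ 2 = t` with fixed `y`, with major arcs of
level `B ^ (1 / 20)`. One part of the error is linear in the height `H` of the coefficients; the
other carries the weight of the leading term and can be summed over `y`. -/
lemma exists_norm_card_slice_sub_le {n : ℕ} (hn : 4 ≤ n) :
    ∃ C : ℝ, 0 ≤ C ∧ ∀ θ B H : ℝ, 0 ≤ θ → θ ≤ 1 / 2 → 4 ≤ B → 1 ≤ H →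
      ∀ a y : Fin (n + 1) → ℤ, (∀ i, a i ≠ 0) → (∀ i, Squarefree (y i)) →
      (∀ i, |((a i * y i ^ 3 : ℤ) : ℝ)| ≤ H) → ∀ t : ℤ, Summable (absSeriesTerm n a t y θ) →
      ‖(((Fintype.piFinset fun i => slice (a i) (y i) B).filter
          fun p => ∑ i, a i * sqf (p i) = t).card : ℂ) -
        2 ^ (n + 1) * leadingTerm n a t y * ((B ^ (((n : ℝ) - 1) / 2) : ℝ) : ℂ)‖ ≤
      C * H * B ^ (((n : ℝ) - 1) / 2 - 1 / 100) +
        C * ((∑' q, absSeriesTerm n a t y θ q) / rootProd n a y) *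
          (B ^ (((n : ℝ) - 1) / 2 - θ / 20) + |(t : ℝ)| * B ^ (((n : ℝ) - 1) / 2 - 1)) := by
  obtain ⟨C1, hC1, h1⟩ := exists_norm_minorArcs_le hn (ε := 1 / 400) (by norm_num)
  obtain ⟨C2, hC2, h2⟩ := exists_singularIntegral_truncation hn
  refine ⟨2 ^ (n + 1) * (C1 + 112 * (n + 1) + 2 * C2), by positivity,
    fun θ B H hθ hθ2 hB hH a y ha hy hcH t hs => ?_⟩
  have hB1 : 1 ≤ B := by linarith
  have hB0 : 0 < B := by linarith
  have hy0 : ∀ i, y i ≠ 0 := fun i => (hy i).ne_zero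
  have hε : IsSigns (signs n a y) := isSigns_signs ha hy0
  set P := B ^ (1 / 20 : ℝ) with hP
  set η := B ^ ((1 / 20 : ℝ) - 1) with hη
  have hP1 : 1 ≤ P := Real.one_le_rpow hB1 (by norm_num)
  have hP0 : 0 < P := by linarith
  have hη0 : 0 < η := by positivity
  have hBη : B * η = P := by
    rw [hη, hP]; nth_rewrite 1 [← Real.rpow_one B]
    rw [← Real.rpow_add hB0]; norm_num
  have hPη : 2 * η * P ^ 2 < 1 := by
    have e1 : η * P ^ 2 = B ^ (-(17 / 20) : ℝ) := by
      rw [hη, hP, ← Real.rpow_natCast (B ^ _), ← Real.rpow_mul hB0.le, ← Real.rpow_add hB0]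
      norm_num
    have e2 : B ^ (-(17 / 20) : ℝ) ≤ (4 : ℝ) ^ (-(17 / 20) : ℝ) :=
      Real.rpow_le_rpow_of_nonpos (by norm_num) hB (by norm_num)
    have e3 : (4 : ℝ) ^ (-(17 / 20) : ℝ) < 1 / 2 := by
      have : (4 : ℝ) = 2 ^ (2 : ℝ) := by norm_num
      rw [this, ← Real.rpow_mul (by norm_num), one_div, ← Real.rpow_neg_one]
      exact Real.rpow_lt_rpow_of_exponent_lt (by norm_num) (by norm_num)
    rw [mul_assoc, e1]; linarith
  set A := ∑' q, absSeriesTerm n a t y θ q with hA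
  have hA0 : 0 ≤ A := tsum_nonneg fun q => absSeriesTerm_nonneg t θ q
  set ρ := rootProd n a y with hρ
  have hρ1 : 1 ≤ ρ := one_le_rootProd ha hy0
  set X := B ^ (((n : ℝ) - 1) / 2) with hX
  have hX0 : 0 < X := by positivity
  have hmul : ∀ x : ℝ, X * B ^ x = B ^ (((n : ℝ) - 1) / 2 + x) := fun x => by
    rw [hX, ← Real.rpow_add hB0]
  -- minor arcs
  have hminor := h1 (1 / 20) B H (by norm_num) (by norm_num) hB1 hH hPη a y ha hy hcH t
  have hexp : ((n : ℝ) - 1) / 2 + 1 / 400 - 1 / 20 / 4 = ((n : ℝ) - 1) / 2 - 1 / 100 := by ring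
  rw [hexp] at hminor
  -- major arcs
  have hmajor := norm_majorArcs_sub_le t (a := a) (y := y) ha hy0 hB1 hP1 hη0
  set J := ∫ γ in (-(B * η))..(B * η), oscIntegral n (signs n a y) γ * e (-(γ * (t / B))) with hJ
  have hmajor2 : P ^ 2 * ((n + 1) * √B ^ n * (28 * P * (1 + B * η)) * (2 * η)) ≤
      112 * (n + 1) * B ^ (((n : ℝ) - 1) / 2 - 1 / 100) := by
    rw [hBη]
    calc _ ≤ P ^ 2 * ((n + 1) * √B ^ n * (28 * P * (P + P)) * (2 * η)) := by gcongr
      _ = 112 * (n + 1) * (√B ^ n * (P ^ 4 * η)) := by ring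
      _ = 112 * (n + 1) * B ^ ((n : ℝ) / 2 + (4 / 20 + (1 / 20 - 1))) := by
          rw [sqrt_pow_eq_rpow hB0.le, hP, hη, ← Real.rpow_natCast (B ^ _),
            ← Real.rpow_mul hB0.le, ← Real.rpow_add hB0, ← Real.rpow_add hB0]
          norm_num
      _ ≤ _ := by
          gcongr 112 * (n + 1) * ?_
          exact Real.rpow_le_rpow_of_exponent_le hB1 (by linarith)
  obtain ⟨hI1, hI2⟩ := h2 (signs n a y) hε
  have hI3 := hI2 P (t / B) hP1
  rw [← hBη, ← hJ, hBη] at hI3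
  -- comparison of the truncated and the completed main term
  set Zp : ℂ := ((∏ i, √(B / |((a i * y i ^ 3 : ℤ) : ℝ)|) : ℝ) : ℂ) with hZp
  have hZB : Zp * (B : ℂ)⁻¹ = ((X / ρ : ℝ) : ℂ) := by
    rw [hZp, ← Complex.ofReal_inv, ← Complex.ofReal_mul, prod_sqrt_div_eq a y hB0]
  have hlead : leadingTerm n a t y * (X : ℂ) =
      singularSeries n a t y * singularIntegral n (signs n a y) * ((X / ρ : ℝ) : ℂ) := by
    have e1 : leadingTerm n a t y =
      singularSeries n a t y * singularIntegral n (signs n a y) / (ρ : ℂ) := rfl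
    rw [e1]; push_cast; ring
  have hmain : ‖partialSeries n a t y P * Zp * ((B : ℂ)⁻¹ * J) - leadingTerm n a t y * (X : ℂ)‖ ≤
      2 * C2 * (A / ρ) * (B ^ (((n : ℝ) - 1) / 2 - θ / 20) +
        |(t : ℝ)| * B ^ (((n : ℝ) - 1) / 2 - 1)) := by
    have e1 : partialSeries n a t y P * Zp * ((B : ℂ)⁻¹ * J) - leadingTerm n a t y * (X : ℂ) =
        (partialSeries n a t y P * (J - singularIntegral n (signs n a y)) +
          (partialSeries n a t y P - singularSeries n a t y) *
            singularIntegral n (signs n a y)) * ((X / ρ : ℝ) : ℂ) := by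
      rw [hlead, ← hZB]; ring
    have b1 := norm_partialSeries_le (P := P) t hθ hs
    have b2 := norm_singularSeries_sub_partialSeries_le t hθ hP1 hs
    have hPhalf : P ^ (-(1 / 2) : ℝ) ≤ P ^ (-θ) :=
      Real.rpow_le_rpow_of_exponent_le hP1 (by linarith)
    have hPθ : P ^ (-θ) = B ^ (-(θ / 20)) := by
      rw [hP, ← Real.rpow_mul hB0.le]; congr 1; ring
    have htB : |(t : ℝ) / B| = |(t : ℝ)| * B ^ (-1 : ℝ) := by
      rw [abs_div, abs_of_pos hB0, Real.rpow_neg_one, div_eq_mul_inv]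
    have ht0 : 0 ≤ |(t : ℝ)| * B ^ (-1 : ℝ) := by positivity
    rw [e1, norm_mul, Complex.norm_real, Real.norm_of_nonneg (by positivity)]
    calc _ ≤ (A * (C2 * (P ^ (-θ) + |(t : ℝ) / B|)) + P ^ (-θ) * A * C2) * (X / ρ) := by
          gcongr
          refine (norm_add_le _ _).trans ?_
          rw [norm_mul, norm_mul]
          gcongr
          exact hI3.trans (by gcongr)
      _ = C2 * (A / ρ) * (2 * (X * B ^ (-(θ / 20))) + |(t : ℝ)| * (X * B ^ (-1 : ℝ))) := by
          rw [htB, hPθ]; ring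
      _ ≤ C2 * (A / ρ) * (2 * (X * B ^ (-(θ / 20))) + 2 * (|(t : ℝ)| * (X * B ^ (-1 : ℝ)))) := by
          have : 0 ≤ |(t : ℝ)| * (X * B ^ (-1 : ℝ)) := by positivity
          refine mul_le_mul_of_nonneg_left ?_ (by positivity)
          linarith
      _ = _ := by
          rw [hmul, hmul, ← sub_eq_add_neg, ← sub_eq_add_neg]; ring
  rw [card_slice_solutions ha hy t hB0.le, integral_eq_major_add_minor hη0 hPη
    (continuous_genFun n a t y B) (periodic_genFun n a t y B)]
  set Maj := ∑ q ∈ Icc 1 ⌊P⌋₊, ∑ b ∈ reducedNumerators q,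
    (∫ β in (-η)..η, genFun n a t y B (b / q + β)) with hMaj
  set Min := ∫ α in minorArcs P η, genFun n a t y B α with hMin
  have hdec : 2 ^ (n + 1) * (Maj + Min) - 2 ^ (n + 1) * leadingTerm n a t y * (X : ℂ) =
      2 ^ (n + 1) * (Min + (Maj - partialSeries n a t y P * Zp * ((B : ℂ)⁻¹ * J)) +
        (partialSeries n a t y P * Zp * ((B : ℂ)⁻¹ * J) - leadingTerm n a t y * (X : ℂ))) := by
    ring
  rw [hdec, norm_mul, norm_pow, Complex.norm_ofNat]
  set Y1 := B ^ (((n : ℝ) - 1) / 2 - 1 / 100) with hY1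
  have hY10 : 0 ≤ Y1 := by positivity
  set Y2 := B ^ (((n : ℝ) - 1) / 2 - θ / 20) + |(t : ℝ)| * B ^ (((n : ℝ) - 1) / 2 - 1) with hY2
  have hY20 : 0 ≤ Y2 := by positivity
  have hAρ : 0 ≤ A / ρ := by positivity
  calc _ ≤ 2 ^ (n + 1) * (C1 * H * Y1 + 112 * (n + 1) * Y1 + 2 * C2 * (A / ρ) * Y2) := by
        gcongr
        refine (norm_add_le _ _).trans (add_le_add ((norm_add_le _ _).trans ?_) hmain)
        exact add_le_add hminor (hmajor.trans hmajor2)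
    _ ≤ 2 ^ (n + 1) * ((C1 + 112 * (n + 1) + 2 * C2) * H * Y1 +
          (C1 + 112 * (n + 1) + 2 * C2) * (A / ρ) * Y2) := by
        gcongr 2 ^ (n + 1) * ?_
        have f1 : 112 * ((n : ℝ) + 1) * Y1 ≤ 112 * ((n : ℝ) + 1) * H * Y1 := by
          have : 0 ≤ 112 * ((n : ℝ) + 1) * Y1 := by positivity
          nlinarith
        have f2 : 0 ≤ 2 * C2 * H * Y1 := by positivity
        have f3 : 0 ≤ (C1 + 112 * (n + 1)) * (A / ρ) * Y2 := by positivity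
        nlinarith
    _ = _ := by ring

/-! ### The singular series on average over `y` -/

/-- The factor `(gcd(q, y) / |y|) ^ (3 / 2) |y| ^ θ` that `y` contributes to the bound for the
singular series. -/
def gcdWeight (θ : ℝ) (q : ℕ) (y : ℤ) : ℝ :=
  ((Nat.gcd q y.natAbs : ℝ) / |(y : ℝ)|) ^ (3 / 2 : ℝ) * |(y : ℝ)| ^ θ

lemma gcdWeight_nonneg (θ : ℝ) (q : ℕ) (y : ℤ) : 0 ≤ gcdWeight θ q y := by
  unfold gcdWeight; positivity

/-- With `d = gcd(q, y)` and `y = d k`, the weight is at most `q ^ θ |k| ^ (-3 / 2 + θ)`, and the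
number of `d` is `O(q ^ θ)`. -/
lemma exists_sum_gcdWeight_le {θ : ℝ} (hθ : 0 < θ) (hθ4 : θ ≤ 1 / 4) :
    ∃ C : ℝ, 1 ≤ C ∧ ∀ q : ℕ, 0 < q → ∀ F : Finset ℤ, (∀ y ∈ F, y ≠ 0) →
      ∑ y ∈ F, gcdWeight θ q y ≤ C * (q : ℝ) ^ (2 * θ) := by
  obtain ⟨C1, hC1, h1⟩ := exists_card_divisors_le hθ
  have hsum : Summable fun y : ℤ => |(y : ℝ)| ^ (-(5 / 4) : ℝ) :=
    Real.summable_abs_int_rpow (by norm_num)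
  set S := ∑' y : ℤ, |(y : ℝ)| ^ (-(5 / 4) : ℝ) with hS
  have hS0 : 0 ≤ S := tsum_nonneg fun y => by positivity
  refine ⟨C1 * (1 + S), by nlinarith, fun q hq F hF => ?_⟩
  have hq1 : (1 : ℝ) ≤ q := by exact_mod_cast hq
  have hq0 : (0 : ℝ) < q := by linarith
  have hmaps : ∀ y ∈ F, Nat.gcd q y.natAbs ∈ q.divisors := fun y _ =>
    Nat.mem_divisors.mpr ⟨Nat.gcd_dvd_left _ _, hq.ne'⟩
  rw [← sum_fiberwise_of_maps_to hmaps]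
  have hfib : ∀ d ∈ q.divisors, ∑ y ∈ F with Nat.gcd q y.natAbs = d, gcdWeight θ q y ≤
      (q : ℝ) ^ θ * S := by
    intro d hd
    have hdq : d ≤ q := Nat.divisor_le hd
    have hd0 : 0 < d := Nat.pos_of_mem_divisors hd
    have hd0' : (0 : ℝ) < d := by exact_mod_cast hd0
    set Fd := F.filter fun y => Nat.gcd q y.natAbs = d with hFd
    have hmul : ∀ y ∈ Fd, y = d * (y / d) := by
      intro y hy
      have h2 : d ∣ y.natAbs := (mem_filter.mp hy).2 ▸ Nat.gcd_dvd_right _ _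
      exact (Int.mul_ediv_cancel' (Int.natCast_dvd.mpr h2)).symm
    have hterm : ∀ y ∈ Fd, gcdWeight θ q y ≤
        (q : ℝ) ^ θ * |((y / d : ℤ) : ℝ)| ^ (-(5 / 4) : ℝ) := by
      intro y hy
      have h2 := hmul y hy
      set k := y / d with hk
      have hk0 : k ≠ 0 := by
        intro h; rw [h, mul_zero] at h2; exact hF y (mem_filter.mp hy).1 h2
      have hk1 : (1 : ℝ) ≤ |(k : ℝ)| := by exact_mod_cast Int.one_le_abs hk0
      have hkp : (0 : ℝ) < |(k : ℝ)| := by linarith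
      have hy2 : |(y : ℝ)| = d * |(k : ℝ)| := by
        rw [h2]; push_cast; rw [abs_mul, Nat.abs_cast]
      rw [gcdWeight, (mem_filter.mp hy).2, hy2]
      have e1 : (d : ℝ) / (d * |(k : ℝ)|) = |(k : ℝ)|⁻¹ := by field_simp
      rw [e1, Real.mul_rpow hd0'.le hkp.le, Real.inv_rpow hkp.le, ← Real.rpow_neg hkp.le]
      calc _ = (d : ℝ) ^ θ * (|(k : ℝ)| ^ (-(3 / 2) : ℝ) * |(k : ℝ)| ^ θ) := by ring
        _ = (d : ℝ) ^ θ * |(k : ℝ)| ^ (-(3 / 2) + θ) := by rw [Real.rpow_add hkp]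
        _ ≤ _ := by
          have h3 : (d : ℝ) ≤ q := by exact_mod_cast hdq
          gcongr
          linarith
    calc _ ≤ ∑ y ∈ Fd, (q : ℝ) ^ θ * |((y / d : ℤ) : ℝ)| ^ (-(5 / 4) : ℝ) := sum_le_sum hterm
      _ = (q : ℝ) ^ θ * ∑ k ∈ Fd.image (fun y : ℤ => y / (d : ℤ)), |(k : ℝ)| ^ (-(5 / 4) : ℝ) := by
          rw [← mul_sum, sum_image]
          intro y hy y' hy' h
          rw [hmul y hy, hmul y' hy']
          exact congrArg _ h
      _ ≤ _ := by
          gcongr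
          exact hsum.sum_le_tsum _ fun _ _ => by positivity
  calc _ ≤ ∑ d ∈ q.divisors, (q : ℝ) ^ θ * S := sum_le_sum hfib
    _ = q.divisors.card * ((q : ℝ) ^ θ * S) := by rw [sum_const, nsmul_eq_mul]
    _ ≤ (C1 * (q : ℝ) ^ θ) * ((q : ℝ) ^ θ * (1 + S)) := by
        gcongr
        · exact h1 q hq.ne'
        · linarith
    _ = _ := by
        rw [two_mul, Real.rpow_add hq0]; ring

/-- Separation of `a` and `y` by means of `gcd(q, a y³) ≤ gcd(q, a) gcd(q, y)³`. -/
lemma sqrt_gcd_div_le {q : ℕ} (hq : 0 < q) {a y : ℤ} (ha : a ≠ 0) (hy : y ≠ 0) :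
    √(2 * Nat.gcd q (a * y ^ 3).natAbs / q) / √((|a * y ^ 3| : ℤ) : ℝ) ≤
      √2 * (q : ℝ) ^ (-(1 / 2) : ℝ) * √(Nat.gcd q a.natAbs / |(a : ℝ)|) * gcdWeight 0 q y := by
  have hq0 : (0 : ℝ) < q := by exact_mod_cast hq
  have ha0 : 0 < |(a : ℝ)| := by positivity
  have hy0 : 0 < |(y : ℝ)| := by positivity
  set g := Nat.gcd q a.natAbs with hg
  set h := Nat.gcd q y.natAbs with hh
  have hgcd : (Nat.gcd q (a * y ^ 3).natAbs : ℝ) ≤ g * h ^ 3 := by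
    have h1 : Nat.gcd q (a * y ^ 3).natAbs ∣ g * h ^ 3 := by
      rw [Int.natAbs_mul, Int.natAbs_pow]
      refine (Nat.gcd_mul_right_dvd_mul_gcd q _ _).trans (Nat.mul_dvd_mul_left _ ?_)
      have h2 : ∀ k : ℕ, Nat.gcd q (y.natAbs ^ k) ∣ h ^ k := by
        intro k
        induction k with
        | zero => simp
        | succ k ih =>
          rw [pow_succ, pow_succ]
          exact (Nat.gcd_mul_right_dvd_mul_gcd q _ _).trans (Nat.mul_dvd_mul ih dvd_rfl)
      exact h2 3
    have h3 : 0 < g * h ^ 3 := by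
      have := Nat.gcd_pos_of_pos_left a.natAbs hq
      have := Nat.gcd_pos_of_pos_left y.natAbs hq
      positivity
    exact_mod_cast Nat.le_of_dvd h3 h1
  have e1 : gcdWeight 0 q y = √(((h : ℝ) / |(y : ℝ)|) ^ 3) := by
    rw [gcdWeight, ← hh, Real.rpow_zero, mul_one, Real.sqrt_eq_rpow, ← Real.rpow_natCast,
      ← Real.rpow_mul (by positivity)]
    norm_num
  have e2 : (q : ℝ) ^ (-(1 / 2) : ℝ) = √((q : ℝ)⁻¹) := by
    rw [Real.rpow_neg hq0.le, ← Real.sqrt_eq_rpow, Real.sqrt_inv]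
  rw [e1, e2, ← Real.sqrt_div (by positivity), ← Real.sqrt_mul (by norm_num),
    ← Real.sqrt_mul (by positivity), ← Real.sqrt_mul (by positivity)]
  refine Real.sqrt_le_sqrt ?_
  push_cast
  rw [abs_mul, abs_pow]
  calc _ ≤ 2 * ((g : ℝ) * h ^ 3) / q / (|(a : ℝ)| * |(y : ℝ)| ^ 3) := by gcongr
    _ = _ := by field_simp

lemma rpow_mul_sqrt_gcd_le {θ : ℝ} (hθ : 0 ≤ θ) (hθ2 : θ ≤ 1 / 2) {q : ℕ} (hq : 0 < q) {a : ℤ}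
    (ha : a ≠ 0) : |(a : ℝ)| ^ θ * √(Nat.gcd q a.natAbs / |(a : ℝ)|) ≤ (q : ℝ) ^ θ := by
  have ha0 : 0 < |(a : ℝ)| := by positivity
  set g := Nat.gcd q a.natAbs with hg
  have hg0 : 0 < g := Nat.gcd_pos_of_pos_left _ hq
  have hg0' : (0 : ℝ) < g := by exact_mod_cast hg0
  have hgq : (g : ℝ) ≤ q := by exact_mod_cast Nat.gcd_le_left _ hq
  have hga : (g : ℝ) ≤ |(a : ℝ)| := by
    have : g ≤ a.natAbs := Nat.gcd_le_right _ (Int.natAbs_pos.mpr ha)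
    rw [← Int.cast_abs, ← Nat.cast_natAbs]; exact_mod_cast this
  have h1 : √((g : ℝ) / |(a : ℝ)|) ≤ ((g : ℝ) / |(a : ℝ)|) ^ θ := by
    rw [Real.sqrt_eq_rpow]
    exact Real.rpow_le_rpow_of_exponent_ge (by positivity) ((div_le_one ha0).mpr hga) hθ2
  calc _ ≤ |(a : ℝ)| ^ θ * ((g : ℝ) / |(a : ℝ)|) ^ θ := by gcongr
    _ = (g : ℝ) ^ θ := by
        rw [← Real.mul_rpow ha0.le (by positivity)]; congr 1; field_simp
    _ ≤ _ := by gcongr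

/-- The terms of the singular series for a given modulus `q`, summed over `y` with the weights
`∏ |a i * y i ^ 3| ^ (-1 / 2)`. The gain of the factor `|a j * y j| ^ (1 / 40)` gives
the decay of the leading constant in the coefficients and of the sum over `y`. -/
lemma exists_sum_absSeriesTerm_le {n : ℕ} (hn : 4 ≤ n) :
    ∃ K : ℝ, 0 ≤ K ∧ ∀ a : Fin (n + 1) → ℤ, (∀ i, a i ≠ 0) → ∀ (t : ℤ) (j : Fin (n + 1)) (q : ℕ),
      ∀ s : Finset (Fin (n + 1) → ℤ), (∀ y ∈ s, ∀ i, y i ≠ 0) →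
      ∑ y ∈ s, |(a j : ℝ) * y j| ^ (1 / 40 : ℝ) *
        (absSeriesTerm n a t y (1 / 40) q / rootProd n a y) ≤ K * (q : ℝ) ^ (-(6 / 5) : ℝ) := by
  classical
  obtain ⟨C, hC1, hC⟩ := exists_sum_gcdWeight_le (θ := 1 / 40) (by norm_num) (by norm_num)
  refine ⟨(√2 * C) ^ (n + 1), by positivity, fun a ha t j q s hs => ?_⟩
  rcases Nat.eq_zero_or_pos q with rfl | hq
  · refine le_trans (le_of_eq (sum_eq_zero fun y _ => ?_)) (by positivity)
    simp [absSeriesTerm, reducedNumerators]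
  have hq0 : (0 : ℝ) < q := by exact_mod_cast hq
  have hq1 : (1 : ℝ) ≤ q := by exact_mod_cast hq
  set θ : ℝ := 1 / 40 with hθ
  set Q : ℝ := (q : ℝ) ^ (1 + 2 * θ) * (√2 * (q : ℝ) ^ (-(1 / 2) : ℝ)) ^ (n + 1) with hQ
  have hQ0 : 0 ≤ Q := by positivity
  have hterm : ∀ y ∈ s, |(a j : ℝ) * y j| ^ θ * (absSeriesTerm n a t y θ q / rootProd n a y) ≤
      Q * ∏ i, gcdWeight θ q (y i) := by
    intro y hy
    have hy0 := hs y hy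
    have hρ : 0 < rootProd n a y := by linarith [one_le_rootProd ha hy0]
    have h1 : absSeriesTerm n a t y θ q ≤
        (q : ℝ) ^ θ * (q * ∏ i, √(2 * Nat.gcd q (a i * y i ^ 3).natAbs / q)) := by
      rw [absSeriesTerm]
      gcongr
      have hcard : ((reducedNumerators q).card : ℝ) ≤ q := by
        have : (reducedNumerators q).card ≤ q := (card_filter_le _ _).trans (by simp)
        exact_mod_cast this
      calc _ ≤ ∑ b ∈ reducedNumerators q, ∏ i, √(2 * Nat.gcd q (a i * y i ^ 3).natAbs / q) :=
            sum_le_sum fun b hb => norm_sigma_le n a t y hq (mem_filter.mp hb).2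
        _ = (reducedNumerators q).card * ∏ i, √(2 * Nat.gcd q (a i * y i ^ 3).natAbs / q) := by
            rw [sum_const, nsmul_eq_mul]
        _ ≤ _ := by gcongr
    have h2 : absSeriesTerm n a t y θ q / rootProd n a y ≤ (q : ℝ) ^ θ * (q *
        ∏ i, (√2 * (q : ℝ) ^ (-(1 / 2) : ℝ) * √(Nat.gcd q (a i).natAbs / |(a i : ℝ)|) *
          gcdWeight 0 q (y i))) := by
      calc _ ≤ ((q : ℝ) ^ θ * (q * ∏ i, √(2 * Nat.gcd q (a i * y i ^ 3).natAbs / q))) /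
            rootProd n a y := by gcongr
        _ = (q : ℝ) ^ θ * (q * ∏ i, (√(2 * Nat.gcd q (a i * y i ^ 3).natAbs / q) /
            √((|a i * y i ^ 3| : ℤ) : ℝ))) := by
            rw [prod_div_distrib, ← rootProd]; ring
        _ ≤ _ := by
            gcongr with i
            exact sqrt_gcd_div_le hq (ha i) (hy0 i)
    rw [prod_mul_distrib, prod_mul_distrib, prod_const, card_univ, Fintype.card_fin] at h2
    have hg1 : ∀ i, √((Nat.gcd q (a i).natAbs : ℝ) / |(a i : ℝ)|) ≤ 1 := by
      intro i
      have := rpow_mul_sqrt_gcd_le (θ := 0) le_rfl (by norm_num) hq (ha i)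
      simpa using this
    have h3 : |(a j : ℝ)| ^ θ * ∏ i, √((Nat.gcd q (a i).natAbs : ℝ) / |(a i : ℝ)|) ≤
        (q : ℝ) ^ θ := by
      rw [← mul_prod_erase univ _ (mem_univ j), ← mul_assoc]
      calc _ ≤ (q : ℝ) ^ θ * 1 := by
            refine mul_le_mul (rpow_mul_sqrt_gcd_le (by norm_num) (by norm_num) hq (ha j))
              (prod_le_one (fun _ _ => Real.sqrt_nonneg _) fun i _ => hg1 i)
              (prod_nonneg fun _ _ => Real.sqrt_nonneg _) (by positivity)
        _ = _ := mul_one _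
    have h4 : |(y j : ℝ)| ^ θ * ∏ i, gcdWeight 0 q (y i) ≤ ∏ i, gcdWeight θ q (y i) := by
      have e1 : ∏ i, gcdWeight θ q (y i) = (∏ i, |(y i : ℝ)| ^ θ) * ∏ i, gcdWeight 0 q (y i) := by
        rw [← prod_mul_distrib]
        refine prod_congr rfl fun i _ => ?_
        simp only [gcdWeight, Real.rpow_zero]; ring
      have hy1 : ∀ i, 1 ≤ |(y i : ℝ)| ^ θ := fun i =>
        Real.one_le_rpow (by exact_mod_cast Int.one_le_abs (hy0 i)) (by norm_num)
      rw [e1]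
      refine mul_le_mul_of_nonneg_right ?_ (prod_nonneg fun i _ => gcdWeight_nonneg _ _ _)
      rw [← mul_prod_erase univ _ (mem_univ j)]
      refine le_mul_of_one_le_right (by positivity) ?_
      rw [← prod_const_one (s := univ.erase j)]
      exact prod_le_prod (fun _ _ => zero_le_one) fun i _ => hy1 i
    have hw0 : 0 ≤ ∏ i, gcdWeight 0 q (y i) := prod_nonneg fun i _ => gcdWeight_nonneg _ _ _
    calc _ ≤ |(a j : ℝ) * y j| ^ θ * ((q : ℝ) ^ θ * (q *
          ((√2 * (q : ℝ) ^ (-(1 / 2) : ℝ)) ^ (n + 1) *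
            (∏ i, √((Nat.gcd q (a i).natAbs : ℝ) / |(a i : ℝ)|)) *
              ∏ i, gcdWeight 0 q (y i)))) := by
          gcongr
      _ = (q : ℝ) ^ θ * q * (√2 * (q : ℝ) ^ (-(1 / 2) : ℝ)) ^ (n + 1) *
          ((|(a j : ℝ)| ^ θ * ∏ i, √((Nat.gcd q (a i).natAbs : ℝ) / |(a i : ℝ)|)) *
            (|(y j : ℝ)| ^ θ * ∏ i, gcdWeight 0 q (y i))) := by
          rw [abs_mul, Real.mul_rpow (abs_nonneg _) (abs_nonneg _)]; ring
      _ ≤ (q : ℝ) ^ θ * q * (√2 * (q : ℝ) ^ (-(1 / 2) : ℝ)) ^ (n + 1) *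
          ((q : ℝ) ^ θ * ∏ i, gcdWeight θ q (y i)) := by gcongr
      _ = _ := by
          rw [hQ, Real.rpow_add hq0, Real.rpow_one, two_mul, Real.rpow_add hq0]; ring
  set F : Fin (n + 1) → Finset ℤ := fun i => s.image fun y => y i with hF
  have hsub : s ⊆ Fintype.piFinset F := fun y hy =>
    Fintype.mem_piFinset.mpr fun i => mem_image_of_mem _ hy
  calc _ ≤ ∑ y ∈ s, Q * ∏ i, gcdWeight θ q (y i) := sum_le_sum hterm
    _ ≤ Q * ∑ y ∈ Fintype.piFinset F, ∏ i, gcdWeight θ q (y i) := by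
        rw [← mul_sum]
        gcongr
        · exact fun y _ _ => prod_nonneg fun i _ => gcdWeight_nonneg _ _ _
    _ = Q * ∏ i, ∑ y ∈ F i, gcdWeight θ q y := by rw [prod_univ_sum]
    _ ≤ Q * ∏ i : Fin (n + 1), (C * (q : ℝ) ^ (2 * θ)) := by
        gcongr with i
        · intro i _; exact sum_nonneg fun _ _ => gcdWeight_nonneg _ _ _
        · refine hC q hq (F i) fun y hy => ?_
          obtain ⟨z, hz, rfl⟩ := mem_image.mp hy
          exact hs z hz i
    _ = (√2 * C) ^ (n + 1) * (q : ℝ) ^ (1 + 2 * θ + (-(1 / 2) + 2 * θ) * (n + 1 : ℕ)) := by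
        rw [prod_const, card_univ, Fintype.card_fin, hQ, Real.rpow_add hq0 (1 + 2 * θ),
          Real.rpow_mul hq0.le (-(1 / 2) + 2 * θ), Real.rpow_natCast, Real.rpow_add hq0 (-(1 / 2))
            (2 * θ)]
        ring
    _ ≤ _ := by
        gcongr
        -- equality holds for `n = 4`
        have : (4 : ℝ) ≤ n := by exact_mod_cast hn
        rw [hθ]; push_cast; linarith

/-- Uniform convergence of the sum over `y` of the absolute singular series. -/
lemma exists_sum_absSeries_le {n : ℕ} (hn : 4 ≤ n) :
    ∃ K : ℝ, 0 ≤ K ∧ ∀ a : Fin (n + 1) → ℤ, (∀ i, a i ≠ 0) → ∀ t : ℤ,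
      (∀ y : Fin (n + 1) → ℤ, (∀ i, y i ≠ 0) → Summable (absSeriesTerm n a t y (1 / 40))) ∧
      ∀ j, ∀ s : Finset (Fin (n + 1) → ℤ), (∀ y ∈ s, ∀ i, y i ≠ 0) →
        ∑ y ∈ s, |(a j : ℝ) * y j| ^ (1 / 40 : ℝ) *
          ((∑' q, absSeriesTerm n a t y (1 / 40) q) / rootProd n a y) ≤ K := by
  obtain ⟨K, hK, h⟩ := exists_sum_absSeriesTerm_le hn
  have hsum : Summable fun q : ℕ => (q : ℝ) ^ (-(6 / 5) : ℝ) :=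
    Real.summable_nat_rpow.mpr (by norm_num)
  refine ⟨K * ∑' q : ℕ, (q : ℝ) ^ (-(6 / 5) : ℝ), by positivity, fun a ha t => ?_⟩
  have hsummable : ∀ y : Fin (n + 1) → ℤ, (∀ i, y i ≠ 0) →
      Summable (absSeriesTerm n a t y (1 / 40)) := by
    intro y hy
    have hρ : 0 < rootProd n a y := by linarith [one_le_rootProd ha hy]
    refine Summable.of_nonneg_of_le (absSeriesTerm_nonneg t _) (fun q => ?_)
      ((hsum.mul_left K).mul_left (rootProd n a y))
    have h1 := h a ha t 0 q {y} (by simpa using hy)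
    rw [sum_singleton] at h1
    have h2 : 1 ≤ |(a 0 : ℝ) * y 0| ^ (1 / 40 : ℝ) := by
      refine Real.one_le_rpow ?_ (by norm_num)
      exact_mod_cast Int.one_le_abs (mul_ne_zero (ha 0) (hy 0))
    have h3 : absSeriesTerm n a t y (1 / 40) q / rootProd n a y ≤ K * (q : ℝ) ^ (-(6 / 5) : ℝ) :=
      (le_mul_of_one_le_left (div_nonneg (absSeriesTerm_nonneg t _ q) hρ.le) h2).trans h1
    rw [div_le_iff₀ hρ] at h3
    linarith
  refine ⟨hsummable, fun j s hs => ?_⟩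
  have h1 : ∀ y ∈ s, Summable fun q => |(a j : ℝ) * y j| ^ (1 / 40 : ℝ) *
      (absSeriesTerm n a t y (1 / 40) q / rootProd n a y) := fun y hy =>
    ((hsummable y (hs y hy)).div_const _).mul_left _
  calc _ = ∑ y ∈ s, ∑' q, |(a j : ℝ) * y j| ^ (1 / 40 : ℝ) *
        (absSeriesTerm n a t y (1 / 40) q / rootProd n a y) := by
        refine sum_congr rfl fun y _ => ?_
        rw [tsum_mul_left, tsum_div_const]
    _ = ∑' q, ∑ y ∈ s, |(a j : ℝ) * y j| ^ (1 / 40 : ℝ) *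
        (absSeriesTerm n a t y (1 / 40) q / rootProd n a y) := (Summable.tsum_finsetSum h1).symm
    _ ≤ ∑' q : ℕ, K * (q : ℝ) ^ (-(6 / 5) : ℝ) :=
        Summable.tsum_le_tsum (fun q => h a ha t j q s hs) (summable_sum h1) (hsum.mul_left K)
    _ = _ := tsum_mul_left

/-! ### Convergence of the leading constant -/

/-- The sum over `y` of the leading terms converges absolutely, even when weighted by a small power
of `|a j * y j|`. -/
lemma exists_sum_leadingTerm_le {n : ℕ} (hn : 4 ≤ n) :
    ∃ K : ℝ, 0 ≤ K ∧ ∀ a : Fin (n + 1) → ℤ, (∀ i, a i ≠ 0) → ∀ (t : ℤ) (j : Fin (n + 1)),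
      ∀ s : Finset {y : Fin (n + 1) → ℤ // ∀ i, Squarefree (y i)},
      ∑ y ∈ s, |(a j : ℝ) * y.1 j| ^ (1 / 40 : ℝ) * ‖leadingTerm n a t y.1‖ ≤ K := by
  obtain ⟨C, hC0, hC⟩ := exists_singularIntegral_truncation hn
  obtain ⟨K, hK0, hK⟩ := exists_sum_absSeries_le hn
  refine ⟨C * K, by positivity, fun a ha t j s => ?_⟩
  obtain ⟨hs, hsum⟩ := hK a ha t
  have hterm : ∀ y ∈ s, |(a j : ℝ) * y.1 j| ^ (1 / 40 : ℝ) * ‖leadingTerm n a t y.1‖ ≤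
      C * (|(a j : ℝ) * y.1 j| ^ (1 / 40 : ℝ) *
        ((∑' q, absSeriesTerm n a t y.1 (1 / 40) q) / rootProd n a y.1)) := by
    intro y _
    have hy0 : ∀ i, y.1 i ≠ 0 := fun i => (y.2 i).ne_zero
    have hρ : 0 < rootProd n a y.1 := by linarith [one_le_rootProd ha hy0]
    have h1 : ‖leadingTerm n a t y.1‖ ≤
        (∑' q, absSeriesTerm n a t y.1 (1 / 40) q) * C / rootProd n a y.1 := by
      rw [leadingTerm, ← rootProd, norm_div, norm_mul, Complex.norm_real,
        Real.norm_of_nonneg hρ.le]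
      have h2 := norm_singularSeries_le t (by norm_num) (hs y.1 hy0)
      have h3 := (hC _ (isSigns_signs ha hy0)).1
      have h4 : 0 ≤ ∑' q, absSeriesTerm n a t y.1 (1 / 40) q := (norm_nonneg _).trans h2
      gcongr
    calc _ ≤ |(a j : ℝ) * y.1 j| ^ (1 / 40 : ℝ) *
          ((∑' q, absSeriesTerm n a t y.1 (1 / 40) q) * C / rootProd n a y.1) := by gcongr
      _ = _ := by ring
  calc _ ≤ _ := sum_le_sum hterm
    _ = C * ∑ y ∈ s.map (Function.Embedding.subtype _), |(a j : ℝ) * y j| ^ (1 / 40 : ℝ) *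
        ((∑' q, absSeriesTerm n a t y (1 / 40) q) / rootProd n a y) := by
        rw [← mul_sum, sum_map]; rfl
    _ ≤ C * K := by
        gcongr
        refine hsum j _ fun y hy i => ?_
        obtain ⟨z, -, rfl⟩ := mem_map.mp hy
        exact (z.2 i).ne_zero

lemma summable_norm_leadingTerm {n : ℕ} (hn : 4 ≤ n) {a : Fin (n + 1) → ℤ} (ha : ∀ i, a i ≠ 0)
    (t : ℤ) : Summable fun y : {y : Fin (n + 1) → ℤ // ∀ i, Squarefree (y i)} =>
      ‖leadingTerm n a t y.1‖ := by
  obtain ⟨K, -, hK⟩ := exists_sum_leadingTerm_le hn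
  refine summable_of_sum_le (fun _ => norm_nonneg _) fun s => (sum_le_sum fun y _ => ?_).trans
    (hK a ha t 0 s)
  refine le_mul_of_one_le_left (norm_nonneg _) (Real.one_le_rpow ?_ (by norm_num))
  exact_mod_cast Int.one_le_abs (mul_ne_zero (ha 0) (y.2 0).ne_zero)

/-- The leading constant decays in each coefficient, and truncating the sum over `y` to a set that
contains all `y` of height at most `Y` costs `O(Y ^ (-1 / 40))`. -/
lemma exists_leadingConstant_bounds {n : ℕ} (hn : 4 ≤ n) :
    ∃ K : ℝ, 0 ≤ K ∧ ∀ a : Fin (n + 1) → ℤ, (∀ i, a i ≠ 0) → ∀ t : ℤ,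
      (∀ j, ‖leadingConstant n a t‖ ≤ K * |(a j : ℝ)| ^ (-(1 / 40) : ℝ)) ∧
      ∀ Y : ℝ, 1 ≤ Y → ∀ s : Finset {y : Fin (n + 1) → ℤ // ∀ i, Squarefree (y i)},
        (∀ y ∉ s, ∃ i, Y < |(y.1 i : ℝ)|) →
        ‖leadingConstant n a t - 2 ^ (n + 1) * ∑ y ∈ s, leadingTerm n a t y.1‖ ≤
          K * Y ^ (-(1 / 40) : ℝ) := by
  classical
  obtain ⟨K, hK0, hK⟩ := exists_sum_leadingTerm_le hn
  refine ⟨2 ^ (n + 1) * ((n + 1) * K), by positivity, fun a ha t => ?_⟩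
  have hsum := summable_norm_leadingTerm hn ha t
  have ha1 : ∀ i, 1 ≤ |(a i : ℝ)| := fun i => by exact_mod_cast Int.one_le_abs (ha i)
  have hn1 : K ≤ (n + 1) * K := le_mul_of_one_le_left hK0 (by linarith [n.cast_nonneg (α := ℝ)])
  have hpart : ∀ (j : Fin (n + 1)) (Z : ℝ), 0 < Z →
      ∀ T : Finset {y : Fin (n + 1) → ℤ // ∀ i, Squarefree (y i)},
      (∀ y ∈ T, Z ≤ |(a j : ℝ) * y.1 j|) →
      ∑ y ∈ T, ‖leadingTerm n a t y.1‖ ≤ K * Z ^ (-(1 / 40) : ℝ) := by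
    intro j Z hZ T hT
    rw [Real.rpow_neg hZ.le, ← div_eq_mul_inv, le_div_iff₀ (by positivity), sum_mul]
    refine (sum_le_sum fun y hy => ?_).trans (hK a ha t j T)
    rw [mul_comm]
    gcongr
    exact hT y hy
  constructor
  · intro j
    rw [leadingConstant, norm_mul, norm_pow, Complex.norm_two, mul_assoc]
    gcongr
    refine (norm_tsum_le_tsum_norm hsum).trans ?_
    refine Real.tsum_le_of_sum_le (fun _ => norm_nonneg _) fun T => ?_
    refine (hpart j |(a j : ℝ)| (by linarith [ha1 j]) T fun y _ => ?_).trans (by gcongr)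
    rw [abs_mul]
    exact le_mul_of_one_le_right (abs_nonneg _)
      (by exact_mod_cast Int.one_le_abs (y.2 j).ne_zero)
  · intro Y hY s hs
    rw [leadingConstant, ← mul_sub, norm_mul, norm_pow, Complex.norm_two, mul_assoc]
    gcongr
    have hlim := (hsum.of_norm.hasSum.sub_const (∑ y ∈ s, leadingTerm n a t y.1)).norm
    refine le_of_tendsto hlim ?_
    filter_upwards [Filter.eventually_ge_atTop s] with T hT
    rw [← sum_sdiff hT, add_sub_cancel_right]
    calc _ ≤ ∑ y ∈ T \ s, ‖leadingTerm n a t y.1‖ := norm_sum_le _ _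
      _ ≤ ∑ y ∈ T \ s, ∑ j, if Y < |(y.1 j : ℝ)| then ‖leadingTerm n a t y.1‖ else 0 := by
          refine sum_le_sum fun y hy => ?_
          obtain ⟨i, hi⟩ := hs y (mem_sdiff.mp hy).2
          refine le_trans (le_of_eq (if_pos hi).symm) (single_le_sum
            (f := fun j => if Y < |(y.1 j : ℝ)| then ‖leadingTerm n a t y.1‖ else 0)
            (fun j _ => ?_) (mem_univ i))
          split_ifs <;> positivity
      _ = ∑ j, ∑ y ∈ (T \ s).filter fun y => Y < |(y.1 j : ℝ)|, ‖leadingTerm n a t y.1‖ := by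
          rw [sum_comm]
          exact sum_congr rfl fun j _ => (sum_filter _ _).symm
      _ ≤ ∑ j : Fin (n + 1), K * Y ^ (-(1 / 40) : ℝ) := by
          refine sum_le_sum fun j _ => hpart j Y (by linarith) _ fun y hy => ?_
          rw [abs_mul]
          exact (mem_filter.mp hy).2.le.trans (le_mul_of_one_le_left (abs_nonneg _) (ha1 j))
      _ = _ := by
          rw [sum_const, card_univ, Fintype.card_fin, nsmul_eq_mul]; push_cast; ring

/-! ### Splitting the count according to the size of `a` and `y` -/

open scoped Classical in
/-- The set `solutionSet n a t B` as a finset, the two tuples being regrouped as one tuple of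
pairs. -/
def solutionFinset (n : ℕ) (a : Fin (n + 1) → ℤ) (t : ℤ) (B : ℝ) :
    Finset (Fin (n + 1) → ℤ × ℤ) :=
  (Fintype.piFinset fun i => admissible (a i) B).filter fun p => ∑ i, a i * sqf (p i) = t

lemma solutionSet_eq_image {n : ℕ} {a : Fin (n + 1) → ℤ} (ha : ∀ i, a i ≠ 0) (t : ℤ) (B : ℝ) :
    solutionSet n a t B =
      (fun p : Fin (n + 1) → ℤ × ℤ => (fun i => (p i).1, fun i => (p i).2)) ''
        (solutionFinset n a t B : Set (Fin (n + 1) → ℤ × ℤ)) := by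
  ext ⟨x, y⟩
  simp only [solutionSet, solutionFinset, Set.mem_ofPred_eq, Set.mem_image, mem_coe, mem_filter,
    Fintype.mem_piFinset, mem_admissible (ha _), Prod.mk.injEq]
  constructor
  · rintro ⟨h0, h1, h2, h3⟩
    refine ⟨fun i => (x i, y i), ⟨fun i => ⟨(h0 i).1, ?_, h3 i⟩, ?_⟩, rfl, rfl⟩
    · have := h2 i
      rwa [mul_assoc] at this
    · rw [← h1]
      exact sum_congr rfl fun i _ => (mul_assoc _ _ _).symm
  · rintro ⟨p, ⟨h1, h2⟩, rfl, rfl⟩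
    refine ⟨fun i => ⟨(h1 i).1, (h1 i).2.2.ne_zero⟩, ?_, fun i => ?_, fun i => (h1 i).2.2⟩
    · rw [← h2]
      exact sum_congr rfl fun i _ => mul_assoc _ _ _
    · have := (h1 i).2.1
      rwa [sqf, ← mul_assoc] at this

lemma finite_solutionSet {n : ℕ} {a : Fin (n + 1) → ℤ} (ha : ∀ i, a i ≠ 0) (t : ℤ) (B : ℝ) :
    (solutionSet n a t B).Finite := by
  rw [solutionSet_eq_image ha]
  exact (finite_toSet _).image _

lemma ncard_solutionSet {n : ℕ} {a : Fin (n + 1) → ℤ} (ha : ∀ i, a i ≠ 0) (t : ℤ) (B : ℝ) :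
    (solutionSet n a t B).ncard = (solutionFinset n a t B).card := by
  rw [solutionSet_eq_image ha, Set.ncard_image_of_injective, Set.ncard_coe_finset]
  intro p p' h
  rw [Prod.mk.injEq] at h
  exact funext fun i => Prod.ext (congrFun h.1 i) (congrFun h.2 i)

/-- The trivial bound for bounded `B`. -/
lemma exists_card_solutionFinset_le (n : ℕ) : ∃ C : ℝ, 0 ≤ C ∧ ∀ a : Fin (n + 1) → ℤ,
    (∀ i, a i ≠ 0) → ∀ t : ℤ, ∀ B : ℝ, 1 ≤ B → B ≤ 4 →
      ((solutionFinset n a t B).card : ℝ) ≤ C := by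
  obtain ⟨C, hC1, hC⟩ := exists_card_pairs_le_sqrt
  refine ⟨(C * √4) ^ (n + 1), by positivity, fun a ha t B hB hB4 => ?_⟩
  calc ((solutionFinset n a t B).card : ℝ) ≤
        ((Fintype.piFinset fun i => admissible (a i) B).card : ℝ) := by
        exact_mod_cast card_filter_le _ _
    _ = ∏ i, ((admissible (a i) B).card : ℝ) := by rw [Fintype.card_piFinset]; push_cast; rfl
    _ ≤ ∏ i : Fin (n + 1), C * √4 := by
        refine prod_le_prod (fun _ _ => Nat.cast_nonneg _) fun i _ => ?_
        calc ((admissible (a i) B).card : ℝ) ≤ (pairs B).card := by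
              exact_mod_cast card_le_card (admissible_subset _ _)
          _ ≤ C * √B := hC B hB
          _ ≤ _ := by gcongr
    _ = _ := by rw [prod_const, card_univ, Fintype.card_fin]

lemma admissible_subset_pairs_div {a : ℤ} (ha : a ≠ 0) (B : ℝ) :
    admissible a B ⊆ pairs (B / |(a : ℝ)|) := by
  intro p hp
  obtain ⟨h1, h2, h3⟩ := (mem_admissible ha).mp hp
  refine mem_pairs.mpr ⟨h1, h3.ne_zero, ?_⟩
  rw [le_div_iff₀ (by positivity), mul_comm]
  rw [abs_mul] at h2
  exact_mod_cast h2

/-- A large coefficient leaves few choices for its variable. -/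
lemma exists_card_solutionFinset_le_of_lt {n : ℕ} (hn : 4 ≤ n) {η : ℝ} (hη : 0 < η) :
    ∃ K : ℝ, 0 ≤ K ∧ ∀ a : Fin (n + 1) → ℤ, (∀ i, a i ≠ 0) → ∀ t : ℤ, ∀ B : ℝ, 1 ≤ B →
      ∀ j, B ^ η ≤ |(a j : ℝ)| →
      ((solutionFinset n a t B).card : ℝ) ≤ K * B ^ (((n : ℝ) - 1) / 2 - η / 4) := by
  obtain ⟨C1, hC1, h1⟩ := exists_card_pairs_le
  obtain ⟨C2, hC2, h2⟩ := exists_card_solutions_le hn (ε := η / 4) (by linarith)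
  refine ⟨C2 * C1, by positivity, fun a ha t B hB j hj => ?_⟩
  have hB0 : 0 < B := by linarith
  have hcard : ((admissible (a j) B).card : ℝ) ≤ C1 * B ^ (1 / 2 - η / 2) := by
    have h3 := h1 (B / |(a j : ℝ)|) 1 (by positivity) le_rfl
    rw [Real.one_rpow, mul_one, filter_true_of_mem fun p hp => by
      exact_mod_cast Int.one_le_abs (mem_pairs.mp hp).2.1] at h3
    calc ((admissible (a j) B).card : ℝ) ≤ (pairs (B / |(a j : ℝ)|)).card := by
          exact_mod_cast card_le_card (admissible_subset_pairs_div (ha j) B)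
      _ ≤ C1 * √(B / |(a j : ℝ)|) := h3
      _ ≤ C1 * √(B / B ^ η) := by gcongr
      _ = _ := by
          nth_rw 1 [← Real.rpow_one B]
          rw [← Real.rpow_sub hB0, Real.sqrt_eq_rpow, ← Real.rpow_mul hB0.le]
          congr 2; ring
  calc _ ≤ C2 * (admissible (a j) B).card * B ^ (((n : ℝ) - 2) / 2 + η / 4) :=
        h2 B hB _ (fun i => admissible_subset _ _) a ha t j
    _ ≤ C2 * (C1 * B ^ (1 / 2 - η / 2)) * B ^ (((n : ℝ) - 2) / 2 + η / 4) := by gcongr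
    _ = C2 * C1 * (B ^ (1 / 2 - η / 2) * B ^ (((n : ℝ) - 2) / 2 + η / 4)) := by ring
    _ = _ := by
        rw [← Real.rpow_add hB0]; congr 2; ring

/-- Solutions with a large `y j` are rare, as are the pairs `(x, y)` with `y` large. -/
lemma exists_card_filter_solutionFinset_le {n : ℕ} (hn : 4 ≤ n) {η : ℝ} (hη : 0 < η) :
    ∃ K : ℝ, 0 ≤ K ∧ ∀ a : Fin (n + 1) → ℤ, (∀ i, a i ≠ 0) → ∀ t : ℤ, ∀ B : ℝ, 1 ≤ B →
      (((solutionFinset n a t B).filter fun p => ¬ ∀ j, |((p j).2 : ℝ)| ≤ B ^ η).card : ℝ) ≤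
        K * B ^ (((n : ℝ) - 1) / 2 - η / 8) := by
  classical
  obtain ⟨C1, hC1, h1⟩ := exists_card_pairs_le
  obtain ⟨C2, hC2, h2⟩ := exists_card_solutions_le hn (ε := η / 8) (by linarith)
  refine ⟨(n + 1) * (C2 * C1), by positivity, fun a ha t B hB => ?_⟩
  have hB0 : 0 < B := by linarith
  set E : Fin (n + 1) → Finset (ℤ × ℤ) := fun j =>
    (admissible (a j) B).filter fun p => B ^ η ≤ |(p.2 : ℝ)| with hE
  set D : Fin (n + 1) → Fin (n + 1) → Finset (ℤ × ℤ) := fun j =>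
    Function.update (fun i => admissible (a i) B) j (E j) with hD
  have hDs : ∀ j i, D j i ⊆ pairs B := by
    intro j i
    by_cases h : i = j
    · subst h
      simp only [hD, Function.update_self]
      exact (filter_subset _ _).trans (admissible_subset _ _)
    · simp only [hD, Function.update_of_ne h]
      exact admissible_subset _ _
  have hEcard : ∀ j, ((E j).card : ℝ) ≤ C1 * (B ^ (1 / 2 : ℝ) * B ^ (-(η / 4))) := by
    intro j
    calc ((E j).card : ℝ) ≤ ((pairs B).filter fun p => B ^ η ≤ |(p.2 : ℝ)|).card := by
          exact Nat.cast_le.mpr (card_le_card (filter_subset_filter _ (admissible_subset _ _)))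
      _ ≤ C1 * √B * (B ^ η) ^ (-(1 / 4) : ℝ) := h1 B _ hB0.le (Real.one_le_rpow hB hη.le)
      _ = _ := by
          rw [Real.sqrt_eq_rpow, ← Real.rpow_mul hB0.le, mul_assoc]
          congr 3; ring
  have hcov : ((solutionFinset n a t B).filter fun p => ¬ ∀ j, |((p j).2 : ℝ)| ≤ B ^ η) ⊆
      univ.biUnion fun j => (Fintype.piFinset (D j)).filter fun p => ∑ i, a i * sqf (p i) = t := by
    intro p hp
    obtain ⟨hp1, hp2⟩ := mem_filter.mp hp
    obtain ⟨hp3, hp4⟩ := mem_filter.mp hp1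
    push Not at hp2
    obtain ⟨j, hj⟩ := hp2
    refine mem_biUnion.mpr ⟨j, mem_univ _, mem_filter.mpr ⟨Fintype.mem_piFinset.mpr fun i => ?_,
      hp4⟩⟩
    have hpi := Fintype.mem_piFinset.mp hp3 i
    by_cases h : i = j
    · subst h
      simp only [hD, Function.update_self]
      exact mem_filter.mpr ⟨hpi, hj.le⟩
    · simpa only [hD, Function.update_of_ne h] using hpi
  have hj : ∀ j, (((Fintype.piFinset (D j)).filter fun p => ∑ i, a i * sqf (p i) = t).card : ℝ) ≤
      C2 * C1 * B ^ (((n : ℝ) - 1) / 2 - η / 8) := by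
    intro j
    calc _ ≤ C2 * (D j j).card * B ^ (((n : ℝ) - 2) / 2 + η / 8) := h2 B hB _ (hDs j) a ha t j
      _ ≤ C2 * (C1 * (B ^ (1 / 2 : ℝ) * B ^ (-(η / 4)))) * B ^ (((n : ℝ) - 2) / 2 + η / 8) := by
          gcongr
          simpa only [hD, Function.update_self] using hEcard j
      _ = C2 * C1 * (B ^ (1 / 2 : ℝ) * B ^ (-(η / 4)) * B ^ (((n : ℝ) - 2) / 2 + η / 8)) := by ring
      _ = _ := by
          rw [← Real.rpow_add hB0, ← Real.rpow_add hB0]; congr 2; ring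
  calc _ ≤ ((univ.biUnion fun j => (Fintype.piFinset (D j)).filter
          fun p => ∑ i, a i * sqf (p i) = t).card : ℝ) := by exact_mod_cast card_le_card hcov
    _ ≤ ∑ j, (((Fintype.piFinset (D j)).filter fun p => ∑ i, a i * sqf (p i) = t).card : ℝ) := by
        exact_mod_cast card_biUnion_le
    _ ≤ ∑ j : Fin (n + 1), C2 * C1 * B ^ (((n : ℝ) - 1) / 2 - η / 8) := sum_le_sum fun j _ => hj j
    _ = _ := by
        rw [sum_const, card_univ, Fintype.card_fin, nsmul_eq_mul]; push_cast; ring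

open scoped Classical in
/-- The tuples of squarefree integers of absolute value at most `Y`. -/
def squarefreeBox (n : ℕ) (Y : ℝ) : Finset (Fin (n + 1) → ℤ) :=
  Fintype.piFinset fun _ => (Icc (-(⌊Y⌋₊ : ℤ)) ⌊Y⌋₊).filter Squarefree

lemma mem_squarefreeBox {n : ℕ} {Y : ℝ} (hY : 0 ≤ Y) {y : Fin (n + 1) → ℤ} :
    y ∈ squarefreeBox n Y ↔ ∀ i, |(y i : ℝ)| ≤ Y ∧ Squarefree (y i) := by
  simp only [squarefreeBox, Fintype.mem_piFinset, mem_filter, mem_Icc, ← abs_le]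
  refine forall_congr' fun i => and_congr_left fun _ => ?_
  rw [← Int.natCast_natAbs, Nat.cast_le, Nat.le_floor_iff hY, ← Int.cast_abs, Nat.cast_natAbs]

lemma card_squarefreeBox_le (n : ℕ) {Y : ℝ} (hY : 1 ≤ Y) :
    ((squarefreeBox n Y).card : ℝ) ≤ (3 * Y) ^ (n + 1) := by
  classical
  rw [squarefreeBox, Fintype.card_piFinset, prod_const, card_univ, Fintype.card_fin, Nat.cast_pow]
  gcongr
  have h2 : (⌊Y⌋₊ : ℝ) ≤ Y := Nat.floor_le (by linarith)
  have h3 : ((⌊Y⌋₊ : ℤ) + 1 - -(⌊Y⌋₊ : ℤ)).toNat = 2 * ⌊Y⌋₊ + 1 := by omega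
  calc _ ≤ ((2 * ⌊Y⌋₊ + 1 : ℕ) : ℝ) := by
        rw [← h3, ← Int.card_Icc]
        exact Nat.cast_le.mpr (card_le_card (filter_subset _ _))
    _ ≤ _ := by push_cast; linarith

lemma card_filter_solutionFinset_eq_sum {n : ℕ} {a : Fin (n + 1) → ℤ} (ha : ∀ i, a i ≠ 0) (t : ℤ)
    (B : ℝ) {Y : ℝ} (hY : 0 ≤ Y) :
    ((solutionFinset n a t B).filter fun p => ∀ j, |((p j).2 : ℝ)| ≤ Y).card =
      ∑ y ∈ squarefreeBox n Y, ((Fintype.piFinset fun i => slice (a i) (y i) B).filter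
        fun p => ∑ i, a i * sqf (p i) = t).card := by
  classical
  rw [card_eq_sum_card_fiberwise (f := fun p i => (p i).2) (t := squarefreeBox n Y)]
  · refine sum_congr rfl fun y hy => congrArg _ ?_
    ext p
    simp only [solutionFinset, slice, mem_filter, Fintype.mem_piFinset]
    constructor
    · rintro ⟨⟨⟨h1, h2⟩, h3⟩, rfl⟩
      exact ⟨fun i => ⟨h1 i, rfl⟩, h2⟩
    · rintro ⟨h1, h2⟩
      refine ⟨⟨⟨fun i => (h1 i).1, h2⟩, fun j => ?_⟩, funext fun i => (h1 i).2⟩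
      rw [(h1 j).2]
      exact ((mem_squarefreeBox hY).mp hy j).1
  · intro p hp
    obtain ⟨h1, h2⟩ := mem_filter.mp hp
    have h3 := Fintype.mem_piFinset.mp (mem_filter.mp h1).1
    exact (mem_squarefreeBox hY).mpr fun i => ⟨h2 i, ((mem_admissible (ha i)).mp (h3 i)).2.2⟩

/-- The contribution of small `y` when all coefficients are small. -/
lemma exists_norm_card_filter_sub_le {n : ℕ} (hn : 4 ≤ n) {η : ℝ} (hη : 0 < η)
    (hηn : η * (n + 5) ≤ 1 / 400) :
    ∃ K : ℝ, 0 ≤ K ∧ ∀ a : Fin (n + 1) → ℤ, (∀ i, a i ≠ 0) → ∀ t : ℤ, ∀ B : ℝ, 4 ≤ B →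
      (∀ i, |(a i : ℝ)| ≤ B ^ η) →
      ‖(((solutionFinset n a t B).filter fun p => ∀ j, |((p j).2 : ℝ)| ≤ B ^ η).card : ℂ) -
        leadingConstant n a t * ((B ^ (((n : ℝ) - 1) / 2) : ℝ) : ℂ)‖ ≤
      K * (B ^ (((n : ℝ) - 1) / 2 - η / 40) + |(t : ℝ)| * B ^ (((n : ℝ) - 1) / 2 - 1)) := by
  classical
  obtain ⟨C1, hC1, h1⟩ := exists_norm_card_slice_sub_le hn
  obtain ⟨K2, hK2, h2⟩ := exists_sum_absSeries_le hn
  obtain ⟨K3, hK3, h3⟩ := exists_leadingConstant_bounds hn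
  refine ⟨3 ^ (n + 1) * C1 + C1 * K2 + K3, by positivity, fun a ha t B hB haB => ?_⟩
  have hB0 : 0 < B := by linarith
  have hB1 : 1 ≤ B := by linarith
  have hn0 : (0 : ℝ) ≤ n := n.cast_nonneg
  have hη1 : η ≤ 1 / 400 := by nlinarith
  set Y := B ^ η with hYdef
  have hY1 : 1 ≤ Y := Real.one_le_rpow hB1 hη.le
  have hY0 : 0 < Y := by linarith
  set m : ℝ := ((n : ℝ) - 1) / 2 with hm
  set S := squarefreeBox n Y with hS
  have hSq : ∀ y ∈ S, ∀ i, Squarefree (y i) := fun y hy i =>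
    ((mem_squarefreeBox hY0.le).mp hy i).2
  have hne : ∀ y ∈ S, ∀ i, y i ≠ 0 := fun y hy i => (hSq y hy i).ne_zero
  set N : (Fin (n + 1) → ℤ) → ℕ := fun y => ((Fintype.piFinset fun i => slice (a i) (y i) B).filter
    fun p => ∑ i, a i * sqf (p i) = t).card with hN
  set A : (Fin (n + 1) → ℤ) → ℝ := fun y =>
    (∑' q, absSeriesTerm n a t y (1 / 40) q) / rootProd n a y with hA
  have hA0 : ∀ y ∈ S, 0 ≤ A y := fun y hy => div_nonneg
    (tsum_nonneg fun q => absSeriesTerm_nonneg t _ q)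
    (by linarith [one_le_rootProd ha (hne y hy)])
  have hAsum : ∑ y ∈ S, A y ≤ K2 := by
    refine (sum_le_sum fun y hy => ?_).trans ((h2 a ha t).2 0 S hne)
    refine le_mul_of_one_le_left (hA0 y hy) (Real.one_le_rpow ?_ (by norm_num))
    exact_mod_cast Int.one_le_abs (mul_ne_zero (ha 0) (hne y hy 0))
  set X := B ^ (m - 1 / 800) + |(t : ℝ)| * B ^ (m - 1) with hX
  have hX0 : 0 ≤ X := by positivity
  have hterm : ∀ y ∈ S, ‖(N y : ℂ) - 2 ^ (n + 1) * leadingTerm n a t y * ((B ^ m : ℝ) : ℂ)‖ ≤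
      C1 * Y ^ 4 * B ^ (m - 1 / 100) + C1 * A y * X := by
    intro y hy
    have h4 := h1 (1 / 40) B (Y ^ 4) (by norm_num) (by norm_num) hB (one_le_pow₀ hY1) a y ha
      (hSq y hy) (fun i => ?_) t ((h2 a ha t).1 y (hne y hy))
    · convert h4 using 6
      norm_num
    · push_cast
      rw [abs_mul, abs_pow]
      calc _ ≤ Y * Y ^ 3 := by
            gcongr
            · exact haB i
            · exact ((mem_squarefreeBox hY0.le).mp hy i).1
        _ = _ := by ring
  have htail := (h3 a ha t).2 Y hY1 (S.subtype fun y => ∀ i, Squarefree (y i)) (fun y hy => by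
    by_contra hcon
    push Not at hcon
    exact hy (mem_subtype.mpr ((mem_squarefreeBox hY0.le).mpr fun i => ⟨hcon i, y.2 i⟩)))
  rw [sum_subtype_of_mem (fun y => leadingTerm n a t y) hSq] at htail
  rw [card_filter_solutionFinset_eq_sum ha t B hY0.le, Nat.cast_sum]
  have hsplit : ∑ y ∈ S, (N y : ℂ) - leadingConstant n a t * ((B ^ m : ℝ) : ℂ) =
      ∑ y ∈ S, ((N y : ℂ) - 2 ^ (n + 1) * leadingTerm n a t y * ((B ^ m : ℝ) : ℂ)) -
        (leadingConstant n a t - 2 ^ (n + 1) * ∑ y ∈ S, leadingTerm n a t y) *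
          ((B ^ m : ℝ) : ℂ) := by
    rw [sum_sub_distrib, ← sum_mul, ← mul_sum]; ring
  -- the error linear in the height `Y ^ 4` of the coefficients, taken `(3 Y) ^ (n + 1)` times
  have hminor : (S.card : ℝ) * (C1 * Y ^ 4 * B ^ (m - 1 / 100)) ≤
      3 ^ (n + 1) * C1 * B ^ (m - η / 40) := by
    calc _ ≤ (3 * Y) ^ (n + 1) * (C1 * Y ^ 4 * B ^ (m - 1 / 100)) := by
          gcongr
          exact card_squarefreeBox_le n hY1
      _ = 3 ^ (n + 1) * C1 * (Y ^ (n + 5) * B ^ (m - 1 / 100)) := by ring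
      _ = 3 ^ (n + 1) * C1 * B ^ (η * (n + 5 : ℕ) + (m - 1 / 100)) := by
          rw [hYdef, ← Real.rpow_natCast (B ^ η) (n + 5), ← Real.rpow_mul hB0.le,
            ← Real.rpow_add hB0]
      _ ≤ _ := by
          gcongr
          push_cast
          linarith
  have hXle : X ≤ B ^ (m - η / 40) + |(t : ℝ)| * B ^ (m - 1) := by
    rw [hX]
    gcongr ?_ + _
    exact Real.rpow_le_rpow_of_exponent_le hB1 (by linarith)
  calc _ ≤ ‖∑ y ∈ S, ((N y : ℂ) - 2 ^ (n + 1) * leadingTerm n a t y * ((B ^ m : ℝ) : ℂ))‖ +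
        ‖leadingConstant n a t - 2 ^ (n + 1) * ∑ y ∈ S, leadingTerm n a t y‖ * B ^ m := by
        rw [hsplit]
        refine (norm_sub_le _ _).trans (le_of_eq ?_)
        rw [norm_mul, Complex.norm_real, Real.norm_of_nonneg (by positivity)]
    _ ≤ ∑ y ∈ S, (C1 * Y ^ 4 * B ^ (m - 1 / 100) + C1 * A y * X) +
        K3 * Y ^ (-(1 / 40) : ℝ) * B ^ m := by
        gcongr
        exact norm_sum_le_of_le _ hterm
    _ = S.card * (C1 * Y ^ 4 * B ^ (m - 1 / 100)) + C1 * (∑ y ∈ S, A y) * X +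
        K3 * B ^ (m - η / 40) := by
        rw [sum_add_distrib, sum_const, nsmul_eq_mul, ← sum_mul, ← mul_sum, hYdef,
          ← Real.rpow_mul hB0.le, mul_assoc K3, ← Real.rpow_add hB0]
        congr 3; ring
    _ ≤ 3 ^ (n + 1) * C1 * B ^ (m - η / 40) +
        C1 * K2 * (B ^ (m - η / 40) + |(t : ℝ)| * B ^ (m - 1)) + K3 * B ^ (m - η / 40) := by
        gcongr
    _ ≤ _ := by
        have h5 : 0 ≤ |(t : ℝ)| * B ^ (m - 1) := by positivity
        have h6 : 0 ≤ 3 ^ (n + 1) * C1 + K3 := by positivity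
        nlinarith [mul_nonneg h6 h5]

/-- The asymptotic formula, by cases on the size of `B` and of the coefficients. -/
lemma exists_norm_card_sub_leadingConstant_le {n : ℕ} (hn : 4 ≤ n) {η : ℝ} (hη : 0 < η)
    (hηn : η * (n + 5) ≤ 1 / 400) :
    ∃ K : ℝ, 0 ≤ K ∧ ∀ a : Fin (n + 1) → ℤ, (∀ i, a i ≠ 0) → ∀ t : ℤ, ∀ B : ℝ, 1 ≤ B →
      ‖((solutionFinset n a t B).card : ℂ) -
        leadingConstant n a t * ((B ^ (((n : ℝ) - 1) / 2) : ℝ) : ℂ)‖ ≤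
      K * (B ^ (((n : ℝ) - 1) / 2 - η / 40) + |(t : ℝ)| * B ^ (((n : ℝ) - 1) / 2 - 1)) := by
  obtain ⟨C1, hC1, h1⟩ := exists_card_solutionFinset_le n
  obtain ⟨K2, hK2, h2⟩ := exists_card_solutionFinset_le_of_lt hn hη
  obtain ⟨K3, hK3, h3⟩ := exists_card_filter_solutionFinset_le hn hη
  obtain ⟨K4, hK4, h4⟩ := exists_norm_card_filter_sub_le hn hη hηn
  obtain ⟨K5, hK5, h5⟩ := exists_leadingConstant_bounds hn
  refine ⟨C1 + K2 + K3 + K4 + 4 * K5, by positivity, fun a ha t B hB => ?_⟩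
  have hB0 : 0 < B := by linarith
  have hn4 : (4 : ℝ) ≤ n := by exact_mod_cast hn
  have hη1 : η ≤ 1 / 400 := by nlinarith
  set m : ℝ := ((n : ℝ) - 1) / 2 with hm
  set X := B ^ (m - η / 40) with hX
  set R := |(t : ℝ)| * B ^ (m - 1) with hR
  have hX0 : 0 ≤ X := by positivity
  have hR0 : 0 ≤ R := by positivity
  have htriv : ‖((solutionFinset n a t B).card : ℂ) - leadingConstant n a t * ((B ^ m : ℝ) : ℂ)‖ ≤
      (solutionFinset n a t B).card + ‖leadingConstant n a t‖ * B ^ m := by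
    refine (norm_sub_le _ _).trans (le_of_eq ?_)
    rw [norm_mul, Complex.norm_real, Real.norm_of_nonneg (by positivity), Complex.norm_natCast]
  have hfin : ∀ c : ℝ, 0 ≤ c → c ≤ C1 + K2 + K3 + K4 + 4 * K5 →
      c * (X + R) ≤ (C1 + K2 + K3 + K4 + 4 * K5) * (X + R) := fun c _ hc => by gcongr
  rcases lt_or_ge B 4 with hB4 | hB4
  · have hX1 : 1 ≤ X := Real.one_le_rpow hB (by rw [hm]; linarith)
    have e1 : B ^ m ≤ 4 * X := by
      calc B ^ m = B ^ (η / 40) * X := by rw [hX, ← Real.rpow_add hB0]; congr 1; ring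
        _ ≤ B ^ (1 : ℝ) * X := by gcongr; linarith
        _ ≤ _ := by rw [Real.rpow_one]; gcongr
    have e2 : ‖leadingConstant n a t‖ ≤ K5 := ((h5 a ha t).1 0).trans
      (mul_le_of_le_one_right hK5 (Real.rpow_le_one_of_one_le_of_nonpos
        (by exact_mod_cast Int.one_le_abs (ha 0)) (by norm_num)))
    calc _ ≤ C1 * X + K5 * (4 * X) := by
          refine htriv.trans (add_le_add ?_ (by gcongr))
          exact (h1 a ha t B hB hB4.le).trans (le_mul_of_one_le_right hC1 hX1)
      _ = (C1 + 4 * K5) * X := by ring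
      _ ≤ (C1 + 4 * K5) * (X + R) := by gcongr; linarith
      _ ≤ _ := hfin _ (by positivity) (by linarith)
  · by_cases hbig : ∃ j, B ^ η < |(a j : ℝ)|
    · obtain ⟨j, hj⟩ := hbig
      have e1 : ‖leadingConstant n a t‖ * B ^ m ≤ K5 * X := by
        calc _ ≤ K5 * |(a j : ℝ)| ^ (-(1 / 40) : ℝ) * B ^ m := by
              gcongr
              exact (h5 a ha t).1 j
          _ ≤ K5 * (B ^ η) ^ (-(1 / 40) : ℝ) * B ^ m := by
              gcongr ?_ * ?_ * _
              exact Real.rpow_le_rpow_of_nonpos (by positivity) hj.le (by norm_num)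
          _ = _ := by
              rw [hX, ← Real.rpow_mul hB0.le, mul_assoc, ← Real.rpow_add hB0]
              congr 2; ring
      have e2 : ((solutionFinset n a t B).card : ℝ) ≤ K2 * X :=
        (h2 a ha t B hB j hj.le).trans (by rw [hX]; gcongr; linarith)
      calc _ ≤ K2 * X + K5 * X := htriv.trans (add_le_add e2 e1)
        _ = (K2 + K5) * X := by ring
        _ ≤ (K2 + K5) * (X + R) := by gcongr; linarith
        _ ≤ _ := hfin _ (by positivity) (by linarith)
    · push Not at hbig
      have e1 := h4 a ha t B hB4 hbig
      have e2 : (((solutionFinset n a t B).filter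
          fun p => ¬ ∀ j, |((p j).2 : ℝ)| ≤ B ^ η).card : ℝ) ≤ K3 * X :=
        (h3 a ha t B hB).trans (by rw [hX]; gcongr; linarith)
      rw [← card_filter_add_card_filter_not (s := solutionFinset n a t B)
        (fun p => ∀ j, |((p j).2 : ℝ)| ≤ B ^ η), Nat.cast_add, add_sub_right_comm]
      calc _ ≤ K4 * (X + R) + K3 * X := by
            refine (norm_add_le _ _).trans (add_le_add e1 ?_)
            rwa [Complex.norm_natCast]
        _ ≤ K4 * (X + R) + K3 * (X + R) := by gcongr; linarith
        _ = (K4 + K3) * (X + R) := by ring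
        _ ≤ _ := hfin _ (by positivity) (by linarith)

end SquarefulCount

end

theorem mainTheorem2 (n : ℕ) (hn : 4 ≤ n) :
    -- for all admissible data, the series and integrals defining `C_{a,t}` converge absolutely
    (∀ a : Fin (n + 1) → ℤ, (∀ i, a i ≠ 0) → Finset.univ.gcd a = 1 → ∀ t : ℤ,
      (∀ y : Fin (n + 1) → ℤ, (∀ i, Squarefree (y i)) →
        (Summable fun q : ℕ =>
          ∑ b ∈ SquarefulCount.reducedNumerators q, ‖SquarefulCount.sigma n a t y q b‖) ∧
        MeasureTheory.Integrable
          (SquarefulCount.oscIntegral n (SquarefulCount.signs n a y)) MeasureTheory.volume) ∧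
      Summable fun y : {y : Fin (n + 1) → ℤ // ∀ i, Squarefree (y i)} =>
        ‖SquarefulCount.leadingTerm n a t y.1‖) ∧
    -- asymptotic formula; `δ` and `K` depend on `n` only
    ∃ δ : ℝ, 0 < δ ∧ δ < 1 ∧ ∃ K : ℝ,
      ∀ a : Fin (n + 1) → ℤ, (∀ i, a i ≠ 0) → Finset.univ.gcd a = 1 → ∀ t : ℤ,
        ‖SquarefulCount.leadingConstant n a t‖ ≤ K ∧
        ∀ B : ℝ, 1 ≤ B →
          (SquarefulCount.solutionSet n a t B).Finite ∧
          ‖((SquarefulCount.solutionSet n a t B).ncard : ℂ) -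
              SquarefulCount.leadingConstant n a t * ((B ^ (((n : ℝ) - 1) / 2) : ℝ) : ℂ)‖ ≤
            K * (B ^ (((n : ℝ) - 1) / 2 - δ) + |(t : ℝ)| * B ^ (((n : ℝ) - 1) / 2 - 1)) := by
  -- with `η = 1 / (400 (n + 5))`, summing the minor arc errors over `y` costs `B ^ (1 / 400)`
  have hη : (0 : ℝ) < 1 / (400 * (n + 5)) := by positivity
  have hηn : 1 / (400 * ((n : ℝ) + 5)) * (n + 5) ≤ 1 / 400 := by
    apply le_of_eq
    field_simp
  have hη1 : 1 / (400 * ((n : ℝ) + 5)) ≤ 1 := by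
    rw [div_le_one (by positivity)]
    linarith [n.cast_nonneg (α := ℝ)]
  obtain ⟨K₁, hK₁, h₁⟩ := SquarefulCount.exists_leadingConstant_bounds hn
  obtain ⟨K₂, hK₂, h₂⟩ := SquarefulCount.exists_norm_card_sub_leadingConstant_le hn hη hηn
  obtain ⟨K₃, -, h₃⟩ := SquarefulCount.exists_sum_absSeries_le hn
  refine ⟨fun a ha _ t => ⟨fun y hy => ?_, SquarefulCount.summable_norm_leadingTerm hn ha t⟩,
    1 / (400 * (n + 5)) / 40, by positivity, by linarith, max K₁ K₂, fun a ha _ t => ⟨?_, ?_⟩⟩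
  · have hy0 : ∀ i, y i ≠ 0 := fun i => (hy i).ne_zero
    exact ⟨SquarefulCount.summable_sum_norm_sigma t (by norm_num) ((h₃ a ha t).1 y hy0),
      SquarefulCount.integrable_oscIntegral hn (SquarefulCount.isSigns_signs ha hy0)⟩
  · refine le_trans (((h₁ a ha t).1 0).trans (mul_le_of_le_one_right hK₁ ?_)) (le_max_left _ _)
    exact Real.rpow_le_one_of_one_le_of_nonpos
      (by exact_mod_cast Int.one_le_abs (ha 0)) (by norm_num)
  · intro B hB
    refine ⟨SquarefulCount.finite_solutionSet ha t B, ?_⟩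
    rw [SquarefulCount.ncard_solutionSet ha]
    refine (h₂ a ha t B hB).trans ?_
    gcongr
    exact le_max_right _ _
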